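/- **Setting.** Let $n\ge 1$, $m\ge 0$, let $K\subset\mathbb{R}^n$ be a proper cone (a closed convex cone that is pointed, i.e. $K\cap(-K)=\{0\}$, and has nonempty interior), with dual cone $K^*=\{s:\langle x,s\rangle\ge 0\ \forall x\in K\}$, and let $A\in\mathbb{R}^{m\times n}$, $b\in\mathbb{R}^m$, $c\in\mathbb{R}^n$. Let $F$ be a $\nu$-LHSCB for $K$: a thrice differentiable, strictly convex function on $\operatorname{int}K$ such that, with $\|v\|_x=\sqrt{\langle v,F''(x)v\rangle}$, for all $x,x'\in\operatorname{int}K$ and $t>0$: $F(tx)=F(x)-\nu\log t$; $\{u\in\mathbb{R}^n:\|u-x\|_x<1\}\subseteq\operatorname{int}K$; and $(1-\|x'-x\|_x)^2F''(x')\preceq F''(x)\preceq(1-\|x'-x\|_x)^{-2}F''(x')$ whenever $\|x'-x\|_x<1$. Let $F_*(s)=\sup\{-\langle s,x\rangle-F(x):x\in\operatorname{int}K\}$. For $z=(y,x,\tau,s,\kappa)\in\mathbb{R}^m\times\mathbb{R}^n\times\mathbb{R}\times\mathbb{R}^n\times\mathbb{R}$ put $$G(z)=\bigl(Ax-\tau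 b,\ -A^\top y+\tau c-s,\ \langle b,y\rangle-\langle c,x\rangle-\kappa\bigr),$$ $\tilde x=-F_*'(s)$, $\tilde s=-F'(x)$, $\mu=\langle x,s\rangle/\nu$, $\tilde\mu=\langle\tilde x,\tilde s\rangle/\nu$, $\mu^{\mathrm e}=(\langle x,s\rangle+\tau\kappa)/(\nu+1)$, $\delta^P=x-\mu\tilde x$, $\delta^D=s-\mu\tilde s$, $w=F''(x)\tilde x-\tilde\mu\tilde s$, and $$W=\mu F''(x)+\frac{ss^\top}{\nu\mu}-\frac{\mu\tilde s\tilde s^\top}{\nu}+\frac{\delta^D(\delta^D)^\top}{\langle\delta^P,\delta^D\rangle}-\frac{\mu\,ww^\top}{\|\tilde x\|_x^2-\nu\tilde\mu^2},$$ where the last two terms are read as $0$ when $\delta^P=0$ (then $\delta^D=w=0$ too). **Algorithm.** One iteration from $z$ consists of the following. *Predictor:* take a solution $\Delta z^{\rm aff}$ of $G(\Delta z^{\rm aff})=-G(z)$, $\tau\Delta\kappa^{\rm aff}+\kappa\Delta\tau^{\rm aff}=-\tau\kappa$, $W\Delta x^{\rm aff}+\Delta s^{\rm aff}=-s$, and a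 solution $\Delta z^{\rm cen}$ of $G(\Delta z^{\rm cen})=G(z)$, $\tau\Delta\kappa^{\rm cen}+\kappa\Delta\tau^{\rm cen}=\mu^{\mathrm e}$, $W\Delta x^{\rm cen}+\Delta s^{\rm cen}=\mu^{\mathrm e}\tilde s$; set $z_+=z+\alpha(\Delta z^{\rm aff}+\gamma\Delta z^{\rm cen})$. *Corrector:* with all quantities computed at $z_+$, take a solution $\Delta z^{\rm cor}$ of $G(\Delta z^{\rm cor})=0$, $\tau_+\Delta\kappa^{\rm cor}+\kappa_+\Delta\tau^{\rm cor}=0$, $W_+\Delta x^{\rm cor}+\Delta s^{\rm cor}=\mu_+\tilde s_+-s_+$; set $z_{++}=z_++\Delta z^{\rm cor}$, the start of the next iteration. Fix $$\alpha=\tfrac1{100\nu},\qquad\beta=\gamma=0.9,\qquad\eta=\tfrac1{400\sqrt\nu},$$ and consider the conditions (A1) $x\in\operatorname{int}K$ and $s\in\operatorname{int}K^*$; (A2) $\beta\mu^{\mathrm e}\le\tau\kappa$; (A3) $\tau,\kappa>0$; (A4) $\beta\mu^{\mathrm e}\tilde\mu\le1$; (A5) $\|\delta^P\|_x\le\eta$.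 **Theorem.** 1. Let $z$ satisfy (A1)–(A5). Then the two predictor systems are solvable; for every choice of solutions, $z_+$ satisfies (A1) and (A3) and the corrector system is solvable; and for every choice of its solution, $z_{++}$ satisfies (A1)–(A5), $\mu^{\mathrm e}_{++}=(1-\alpha(1-\gamma))\mu^{\mathrm e}$ and $G(z_{++})=(1-\alpha(1-\gamma))G(z)$. 2. Let $z_0$ be a starting point with $x_0=s_0=-F'(x_0)$, $x_0\in\operatorname{int}K$, $y_0=0$, $\tau_0=\kappa_0=1$. Then the algorithm can be run from $z_0$ indefinitely, and for every run $z_0,z_1,z_2,\dots$ and every $k$, $z_k$ satisfies (A1)–(A5), $\mu^{\mathrm e}(z_k)=(1-\alpha(1-\gamma))^k$ and $G(z_k)=(1-\alpha(1-\gamma))^kG(z_0)$. Moreover, for every $\varepsilon\in(0,1)$ the run reaches an iterate $z$ with $$\mu^{\mathrm e}\le\varepsilon\qquad\text{and}\qquad\|G(z)\|\le\varepsilon\|G(z_0)\|$$ within $O(\nu\log(1/\varepsilon))$ iterations; precisely, within $\lceil C\,\nu\log(1/\varepsilon)\rceil$ iterations, where $C>0$ is an absolute constant, independent of $m,n,A,b,c,K,F,\nu,z_0,\varepsilon$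 and the run. (Here $\|\cdot\|$ is the Euclidean norm.) -/

import Mathlib

open scoped InnerProductSpace

noncomputable section

namespace ConicIPM

/-- `ℝⁿ` with the dot product and the Euclidean norm. -/
abbrev Vec (n : ℕ) := EuclideanSpace ℝ (Fin n)

/-! ### Cones and logarithmically homogeneous self-concordant barriers -/

/-- A closed convex cone in `ℝⁿ` that is pointed (contains no line) and full-dimensional.
(Mathlib's `ProperCone` is only closed and convex and contains `0`.) -/
structure IsProper {n : ℕ} (K : ProperCone ℝ (Vec n)) : Prop where
  pointed : ∀ x ∈ K, -x ∈ K → x = 0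
  fullDim : (interior (K : Set (Vec n))).Nonempty

/-- The dual cone `K* = {s | ⟨x, s⟩ ≥ 0 for all x ∈ K}`. -/
abbrev dualCone {n : ℕ} (K : ProperCone ℝ (Vec n)) : ProperCone ℝ (Vec n) :=
  ProperCone.innerDual (K : Set (Vec n))

/-- The Hessian `F''(x)` with respect to the dot product, as a linear operator on `ℝⁿ`. -/
def hessian {n : ℕ} (F : Vec n → ℝ) (x : Vec n) : Vec n →L[ℝ] Vec n :=
  fderiv ℝ (gradient F) x

/-- The local norm `‖v‖ₓ = √⟨v, F''(x) v⟩`. -/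
def localNorm {n : ℕ} (F : Vec n → ℝ) (x v : Vec n) : ℝ :=
  Real.sqrt ⟪v, hessian F x v⟫_ℝ

/-- `F` is a `ν`-LHSCB for `K`: a logarithmically homogeneous self-concordant barrier with
parameter `ν`. Only the values of `F` on `interior K` matter. -/
structure IsLHSCB {n : ℕ} (K : ProperCone ℝ (Vec n)) (F : Vec n → ℝ) (ν : ℝ) : Prop where
  /-- `F` is differentiable on `interior K`. -/
  diff₁ : DifferentiableOn ℝ F (interior (K : Set (Vec n)))
  /-- `F` is twice differentiable on `interior K`. -/
  diff₂ : DifferentiableOn ℝ (gradient F) (interior (K : Set (Vec n)))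
  /-- `F` is thrice differentiable on `interior K`. -/
  diff₃ : DifferentiableOn ℝ (hessian F) (interior (K : Set (Vec n)))
  strictConvex : StrictConvexOn ℝ (interior (K : Set (Vec n))) F
  /-- Logarithmic homogeneity. -/
  logHom : ∀ x ∈ interior (K : Set (Vec n)), ∀ t : ℝ, 0 < t →
    F (t • x) = F x - ν * Real.log t
  /-- The open Dikin ellipsoid around each interior point lies in the interior. -/
  dikin : ∀ x ∈ interior (K : Set (Vec n)), ∀ x' : Vec n, localNorm F x (x' - x) < 1 →
    x' ∈ interior (K : Set (Vec n))
  /-- `(1 - ‖x' - x‖ₓ)² F''(x') ≼ F''(x)` in the Löwner order. -/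
  lower : ∀ x ∈ interior (K : Set (Vec n)), ∀ x' ∈ interior (K : Set (Vec n)),
    localNorm F x (x' - x) < 1 → ∀ v : Vec n,
      (1 - localNorm F x (x' - x)) ^ 2 * ⟪v, hessian F x' v⟫_ℝ ≤ ⟪v, hessian F x v⟫_ℝ
  /-- `F''(x) ≼ (1 - ‖x' - x‖ₓ)⁻² F''(x')` in the Löwner order. -/
  upper : ∀ x ∈ interior (K : Set (Vec n)), ∀ x' ∈ interior (K : Set (Vec n)),
    localNorm F x (x' - x) < 1 → ∀ v : Vec n,
      ⟪v, hessian F x v⟫_ℝ ≤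
        1 / (1 - localNorm F x (x' - x)) ^ 2 * ⟪v, hessian F x' v⟫_ℝ

/-- The conjugate barrier `F_*(s) = sup {-⟨s, x⟩ - F(x) : x ∈ interior K}`. -/
def conjugate {n : ℕ} (K : ProperCone ℝ (Vec n)) (F : Vec n → ℝ) (s : Vec n) : ℝ :=
  sSup ((fun x : Vec n => -⟪s, x⟫_ℝ - F x) '' interior (K : Set (Vec n)))

/-! ### The homogeneous model -/

/-- Data of the conic problem `inf {⟨c, x⟩ : A x = b, x ∈ K}` with `A ∈ ℝ^{m × n}`. -/
structure ConicProgram (m n : ℕ) where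
  A : Matrix (Fin m) (Fin n) ℝ
  b : Vec m
  c : Vec n
  K : ProperCone ℝ (Vec n)

/-- The vectors `z = (y, x, τ, s, κ)`. -/
@[ext] structure Point (m n : ℕ) where
  y : Vec m
  x : Vec n
  τ : ℝ
  s : Vec n
  κ : ℝ

instance {m n : ℕ} : Add (Point m n) :=
  ⟨fun z w => ⟨z.y + w.y, z.x + w.x, z.τ + w.τ, z.s + w.s, z.κ + w.κ⟩⟩

instance {m n : ℕ} : SMul ℝ (Point m n) :=
  ⟨fun a z => ⟨a • z.y, a • z.x, a * z.τ, a • z.s, a * z.κ⟩⟩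

/-- The space `ℝᵐ × ℝⁿ × ℝ` of residuals, with the Euclidean norm. -/
abbrev Residual (m n : ℕ) := WithLp 2 (Vec m × WithLp 2 (Vec n × ℝ))

/-- The residual `G(z) = (A x - τ b, -Aᵀ y + τ c - s, ⟨b, y⟩ - ⟨c, x⟩ - κ)`. -/
def ConicProgram.G {m n : ℕ} (P : ConicProgram m n) (z : Point m n) : Residual m n :=
  WithLp.toLp 2
    (Matrix.toEuclideanLin P.A z.x - z.τ • P.b,
      WithLp.toLp 2
        (-Matrix.toEuclideanLin P.A.transpose z.y + z.τ • P.c - z.s,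
          ⟪P.b, z.y⟫_ℝ - ⟪P.c, z.x⟫_ℝ - z.κ))

/-! ### Quantities attached to an iterate

Here `K` is a cone, `F` a barrier for it and `ν` its parameter. -/

section Quantities

/-- The shadow iterate `x̃ = -F_*'(s)`. -/
def xTilde {n : ℕ} (K : ProperCone ℝ (Vec n)) (F : Vec n → ℝ) (s : Vec n) : Vec n :=
  -gradient (conjugate K F) s

/-- The shadow iterate `s̃ = -F'(x)`. -/
def sTilde {n : ℕ} (F : Vec n → ℝ) (x : Vec n) : Vec n :=
  -gradient F x

/-- `μ = ⟨x, s⟩ / ν`. -/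
def mu {m n : ℕ} (ν : ℝ) (z : Point m n) : ℝ := ⟪z.x, z.s⟫_ℝ / ν

/-- `μ̃ = ⟨x̃, s̃⟩ / ν`. -/
def muTilde {m n : ℕ} (K : ProperCone ℝ (Vec n)) (F : Vec n → ℝ) (ν : ℝ)
    (z : Point m n) : ℝ :=
  ⟪xTilde K F z.s, sTilde F z.x⟫_ℝ / ν

/-- The complementarity `μᵉ = (⟨x, s⟩ + τ κ) / (ν + 1)` in the extended cone. -/
def muE {m n : ℕ} (ν : ℝ) (z : Point m n) : ℝ := (⟪z.x, z.s⟫_ℝ + z.τ * z.κ) / (ν + 1)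

/-- `δᴾ = x - μ x̃`. -/
def deltaP {m n : ℕ} (K : ProperCone ℝ (Vec n)) (F : Vec n → ℝ) (ν : ℝ)
    (z : Point m n) : Vec n :=
  z.x - mu ν z • xTilde K F z.s

/-- `δᴰ = s - μ s̃`. -/
def deltaD {m n : ℕ} (F : Vec n → ℝ) (ν : ℝ) (z : Point m n) : Vec n :=
  z.s - mu ν z • sTilde F z.x

/-- The outer product `v vᵀ` as a linear operator. -/
def outer {n : ℕ} (v : Vec n) : Vec n →L[ℝ] Vec n := InnerProductSpace.rankOne ℝ v v

/-- The scaling matrix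
`W = μ F''(x) + s sᵀ/(ν μ) - μ s̃ s̃ᵀ/ν + δᴰ (δᴰ)ᵀ/⟨δᴾ, δᴰ⟩ - μ w wᵀ/(‖x̃‖ₓ² - ν μ̃²)` with
`w = F''(x) x̃ - μ̃ s̃`. If `δᴾ = 0` then `δᴰ = w = 0` and both denominators vanish; the last two
terms are then `0`. -/
def scaling {m n : ℕ} (K : ProperCone ℝ (Vec n)) (F : Vec n → ℝ) (ν : ℝ)
    (z : Point m n) : Vec n →L[ℝ] Vec n :=
  mu ν z • hessian F z.x
    + (1 / (ν * mu ν z)) • outer z.s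
    - (mu ν z / ν) • outer (sTilde F z.x)
    + (1 / ⟪deltaP K F ν z, deltaD F ν z⟫_ℝ) • outer (deltaD F ν z)
    - (mu ν z / (localNorm F z.x (xTilde K F z.s) ^ 2 - ν * muTilde K F ν z ^ 2)) •
        outer (hessian F z.x (xTilde K F z.s) - muTilde K F ν z • sTilde F z.x)

/-- `x ∈ int K`, `s ∈ int K*`, `τ > 0` and `κ > 0`. -/
structure IsInterior {m n : ℕ} (K : ProperCone ℝ (Vec n)) (z : Point m n) : Prop where
  x_mem : z.x ∈ interior (K : Set (Vec n))
  s_mem : z.s ∈ interior (dualCone K : Set (Vec n))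
  τ_pos : 0 < z.τ
  κ_pos : 0 < z.κ

/-- The assumptions that are imposed on an iterate at the start of every iteration. -/
structure InNeighborhood {m n : ℕ} (K : ProperCone ℝ (Vec n)) (F : Vec n → ℝ) (ν β η : ℝ)
    (z : Point m n) : Prop where
  interior : IsInterior K z
  tauKappa : β * muE ν z ≤ z.τ * z.κ
  muTilde_le : β * muE ν z * muTilde K F ν z ≤ 1
  deltaP_le : localNorm F z.x (deltaP K F ν z) ≤ η

end Quantities

/-! ### The algorithm -/

/-- `d` solves the linear system of the affine direction at `z`. -/
structure IsAffineDirection {m n : ℕ} (P : ConicProgram m n) (F : Vec n → ℝ) (ν : ℝ)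
    (z d : Point m n) : Prop where
  residual : P.G d = -P.G z
  tauKappa : z.τ * d.κ + z.κ * d.τ = -(z.τ * z.κ)
  xs : scaling P.K F ν z d.x + d.s = -z.s

/-- `d` solves the linear system of the centering direction at `z`. -/
structure IsCenteringDirection {m n : ℕ} (P : ConicProgram m n) (F : Vec n → ℝ) (ν : ℝ)
    (z d : Point m n) : Prop where
  residual : P.G d = P.G z
  tauKappa : z.τ * d.κ + z.κ * d.τ = muE ν z
  xs : scaling P.K F ν z d.x + d.s = muE ν z • sTilde F z.x

/-- `d` solves the linear system of the corrector direction at `z`. -/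
structure IsCorrectorDirection {m n : ℕ} (P : ConicProgram m n) (F : Vec n → ℝ) (ν : ℝ)
    (z d : Point m n) : Prop where
  residual : P.G d = 0
  tauKappa : z.τ * d.κ + z.κ * d.τ = 0
  xs : scaling P.K F ν z d.x + d.s = mu ν z • sTilde F z.x - z.s

/-- `z₁ = z + α (Δz_aff + γ Δz_cen)`. -/
def IsPredictorStep {m n : ℕ} (P : ConicProgram m n) (F : Vec n → ℝ) (ν α γ : ℝ)
    (z z₁ : Point m n) : Prop :=
  ∃ dAff dCen : Point m n, IsAffineDirection P F ν z dAff ∧ IsCenteringDirection P F ν z dCen ∧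
    z₁ = z + α • (dAff + γ • dCen)

/-- `z₂ = z₁ + Δz_cor`. -/
def IsCorrectorStep {m n : ℕ} (P : ConicProgram m n) (F : Vec n → ℝ) (ν : ℝ)
    (z₁ z₂ : Point m n) : Prop :=
  ∃ dCor : Point m n, IsCorrectorDirection P F ν z₁ dCor ∧ z₂ = z₁ + dCor

/-- The starting points: `x₀ = s₀ = -F'(x₀)`, `y₀ = 0`, `τ₀ = κ₀ = 1`. -/
structure IsStart {m n : ℕ} (K : ProperCone ℝ (Vec n)) (F : Vec n → ℝ)
    (z : Point m n) : Prop where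
  x_mem : z.x ∈ interior (K : Set (Vec n))
  x_eq : z.x = -gradient F z.x
  s_eq : z.s = z.x
  y_eq : z.y = 0
  τ_eq : z.τ = 1
  κ_eq : z.κ = 1

/-- A run of the algorithm from `z₀` with predictor step size `α` and centering parameter `γ`:
`z k` is the iterate after `k` iterations and `zp k` the point after the predictor step of the
next iteration. -/
structure IsRun {m n : ℕ} (P : ConicProgram m n) (F : Vec n → ℝ) (ν α γ : ℝ) (z₀ : Point m n)
    (z zp : ℕ → Point m n) : Prop where
  start : z 0 = z₀
  predictor : ∀ k, IsPredictorStep P F ν α γ (z k) (zp k)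
  corrector : ∀ k, IsCorrectorStep P F ν (zp k) (z (k + 1))

end ConicIPM

end

open scoped InnerProductSpace

noncomputable section

namespace ConicIPM

/-! ### Seminorms of positive semidefinite operators -/

section QuadraticForm

variable {n : ℕ}

/-! Write `q = 1/√ν`, so `α = q²/100` and `η = q/400`, and let `a = ‖δᴾ‖ₓ`. Two properties of the
scaling matrix drive everything. First, the secant equations `W x = s` and `W x̃ = s̃`
(`scaling_apply_x`, `scaling_apply_xTilde`) turn each right-hand side, after a shift by a multiple
of `z` in the predictor, into `W g` for an explicit `g`. Second, `W` differs from `μ F''(x)` by a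
relative error of at most `17 a` (`abs_inner_scaling_sub_le`): the last two rank-one terms are both
close to `μ (F''δᴾ)(F''δᴾ)ᵀ/‖δᴾ‖ₓ²`, with opposite signs. So for small `a`, `W` is definite and its
norm is equivalent to the local norm.

The homogeneous model is skew-symmetric: a direction with zero residual has `⟨Δx, Δs⟩ + Δτ Δκ = 0`.
This gives an energy identity (`ConicProgram.energy_eq`) that bounds the direction by its right-hand
side, and with definiteness of `W` it gives solvability. It also makes the change of `μᵉ` and of the
residual exact.

Predictor: the direction has local norm `O(√ν)`, so a step `α` moves the point by `O(q)` and `δᴾ`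
may grow to at most `q/200`. Corrector: its right-hand side is `W(-δᴾ)`, so the step has size
`O(a)`; in the expansion of the new `δᴰ` (`abs_inner_deltaD_step_le`) the term linear in the old
`δᴰ` has coefficient zero, and what is left is `O(a²)` apart from the effect of the tiny change of
`μ`. This brings `δᴾ` below `q/400` again.

(A4) is handled by `⟨δᴾ, δᴰ⟩ = ν μ (μ μ̃ - 1)`. Since the left side is close to `μ a²`, `μ μ̃` is at
least 1 and barely larger. Hence (A4) yields `β μᵉ ≤ μ`, and a slightly stronger lower bound on `μ`
yields (A4) back. The predictor supplies that slack, `q²/1250`, for both `μ` and `τκ`: `μᵉ` falls by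
the factor `1 - q²/1000`, while the lower bounds for `μ` and `τκ` lose only second-order terms. The
corrector spends it.

The barrier theory needed (range of `F'`, gradient of the conjugate, `-F'(x)` well inside the dual
cone) follows from Hessian comparison, the Dikin ellipsoid and homogeneity. -/

/-- Symmetric positive semidefinite operators. -/
structure IsPSD (T : Vec n →L[ℝ] Vec n) : Prop where
  symm : ∀ u v : Vec n, ⟪u, T v⟫_ℝ = ⟪v, T u⟫_ℝ
  nonneg : ∀ v : Vec n, 0 ≤ ⟪v, T v⟫_ℝ

/-- The seminorm `√⟨v, T v⟩`. -/
def qnorm (T : Vec n →L[ℝ] Vec n) (v : Vec n) : ℝ := Real.sqrt ⟪v, T v⟫_ℝ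

theorem localNorm_eq_qnorm (F : Vec n → ℝ) (x v : Vec n) :
    localNorm F x v = qnorm (hessian F x) v := rfl

theorem localNorm_nonneg (F : Vec n → ℝ) (x v : Vec n) : 0 ≤ localNorm F x v :=
  Real.sqrt_nonneg _

theorem localNorm_smul (F : Vec n → ℝ) (x : Vec n) (c : ℝ) (v : Vec n) :
    localNorm F x (c • v) = |c| * localNorm F x v := by
  simp only [localNorm, map_smul, inner_smul_left, inner_smul_right, conj_trivial]
  rw [← mul_assoc, Real.sqrt_mul (mul_self_nonneg c), Real.sqrt_mul_self_eq_abs]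

theorem qnorm_nonneg (T : Vec n →L[ℝ] Vec n) (v : Vec n) : 0 ≤ qnorm T v := Real.sqrt_nonneg _

@[simp] theorem qnorm_zero (T : Vec n →L[ℝ] Vec n) : qnorm T 0 = 0 := by simp [qnorm]

theorem qnorm_smul (T : Vec n →L[ℝ] Vec n) (c : ℝ) (v : Vec n) :
    qnorm T (c • v) = |c| * qnorm T v := by
  simp only [qnorm, map_smul, inner_smul_left, inner_smul_right, conj_trivial]
  rw [← mul_assoc, Real.sqrt_mul (mul_self_nonneg c), Real.sqrt_mul_self_eq_abs]

theorem qnorm_neg (T : Vec n →L[ℝ] Vec n) (v : Vec n) : qnorm T (-v) = qnorm T v := by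
  simp [qnorm]

namespace IsPSD

variable {T : Vec n →L[ℝ] Vec n} (hT : IsPSD T)
include hT

theorem qnorm_sq (v : Vec n) : qnorm T v ^ 2 = ⟪v, T v⟫_ℝ := Real.sq_sqrt (hT.nonneg v)

theorem abs_inner_le (u v : Vec n) : |⟪u, T v⟫_ℝ| ≤ qnorm T u * qnorm T v := by
  have h : ∀ t : ℝ, 0 ≤ ⟪v, T v⟫_ℝ * (t * t) + (2 * ⟪u, T v⟫_ℝ) * t + ⟪u, T u⟫_ℝ := by
    intro t
    have := hT.nonneg (u + t • v)
    simp only [map_add, map_smul, inner_add_left, inner_add_right, inner_smul_left,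
      inner_smul_right, conj_trivial] at this
    rw [hT.symm v u] at this
    linarith
  have hd := discrim_le_zero h
  rw [discrim] at hd
  apply abs_le_of_sq_le_sq _ (mul_nonneg (qnorm_nonneg _ _) (qnorm_nonneg _ _))
  rw [mul_pow, hT.qnorm_sq, hT.qnorm_sq]
  linarith

theorem qnorm_add_le (u v : Vec n) : qnorm T (u + v) ≤ qnorm T u + qnorm T v := by
  refine (sq_le_sq₀ (qnorm_nonneg _ _) (add_nonneg (qnorm_nonneg _ _) (qnorm_nonneg _ _))).1 ?_
  have h := le_of_abs_le (hT.abs_inner_le u v)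
  rw [add_sq, hT.qnorm_sq, hT.qnorm_sq, hT.qnorm_sq]
  simp only [map_add, inner_add_left, inner_add_right]
  rw [hT.symm v u]
  linarith

theorem qnorm_sub_le (u v : Vec n) : qnorm T (u - v) ≤ qnorm T u + qnorm T v := by
  rw [sub_eq_add_neg, ← qnorm_neg T v]
  exact hT.qnorm_add_le _ _

/-- A symmetric operator is bounded in the `T`-norm by its numerical range. -/
theorem abs_inner_le_of_forall_abs_inner_self_le (hdef : ∀ v, qnorm T v = 0 → v = 0)
    {B : Vec n →L[ℝ] Vec n} (hB : ∀ u v : Vec n, ⟪u, B v⟫_ℝ = ⟪v, B u⟫_ℝ) {c : ℝ}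
    (hc : ∀ v, |⟪v, B v⟫_ℝ| ≤ c * qnorm T v ^ 2) (u v : Vec n) :
    |⟪u, B v⟫_ℝ| ≤ c * qnorm T u * qnorm T v := by
  -- Polarisation of `B`, then the parallelogram law for the `T`-norm. Rescaling both vectors to
  -- unit length afterwards turns the sum of squares into a product.
  have key : ∀ u v : Vec n, |⟪u, B v⟫_ℝ| ≤ c / 2 * (qnorm T u ^ 2 + qnorm T v ^ 2) := by
    intro u v
    have h₁ := abs_le.1 (hc (u + v))
    have h₂ := abs_le.1 (hc (u - v))
    rw [hT.qnorm_sq] at h₁ h₂ ⊢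
    rw [hT.qnorm_sq]
    simp only [map_add, map_sub, inner_add_left, inner_add_right, inner_sub_left,
      inner_sub_right] at h₁ h₂
    rw [hB v u, hT.symm v u] at h₁ h₂
    rw [abs_le]
    constructor <;> linarith
  by_cases hu : qnorm T u = 0
  · simp [hdef u hu]
  by_cases hv : qnorm T v = 0
  · simp [hdef v hv]
  have h := key ((qnorm T u)⁻¹ • u) ((qnorm T v)⁻¹ • v)
  have hu' := (qnorm_nonneg T u).lt_of_ne' hu
  have hv' := (qnorm_nonneg T v).lt_of_ne' hv
  simp only [qnorm_smul, map_smul, inner_smul_left, inner_smul_right, conj_trivial, abs_mul,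
    abs_inv, abs_of_pos hu', abs_of_pos hv', inv_mul_cancel₀ hu, inv_mul_cancel₀ hv] at h
  rw [← mul_assoc, ← mul_inv, inv_mul_le_iff₀ (by positivity)] at h
  linarith

end IsPSD

end QuadraticForm

/-! ### Interiors of cones -/

section Cone

variable {n : ℕ} {K : ProperCone ℝ (Vec n)}

theorem smul_mem_cone {x : Vec n} (hx : x ∈ K) {t : ℝ} (ht : 0 ≤ t) : t • x ∈ K :=
  K.smul_mem hx ht

theorem convex_interior : Convex ℝ (interior (K : Set (Vec n))) := by
  apply Convex.interior
  intro x hx y hy a b ha hb _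
  exact K.add_mem (smul_mem_cone hx ha) (smul_mem_cone hy hb)

theorem add_mem_interior {x y : Vec n} (hx : x ∈ interior (K : Set (Vec n))) (hy : y ∈ K) :
    x + y ∈ interior (K : Set (Vec n)) := by
  rw [mem_interior]
  refine ⟨(fun z => z - y) ⁻¹' interior (K : Set (Vec n)), ?_,
    isOpen_interior.preimage (by fun_prop), by simpa using hx⟩
  intro z hz
  have := K.add_mem (interior_subset hz) hy
  simpa using this

theorem smul_mem_interior {x : Vec n} (hx : x ∈ interior (K : Set (Vec n))) {t : ℝ} (ht : 0 < t) :
    t • x ∈ interior (K : Set (Vec n)) := by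
  rw [mem_interior]
  refine ⟨(fun z => t⁻¹ • z) ⁻¹' interior (K : Set (Vec n)), ?_,
    isOpen_interior.preimage (by fun_prop), by simpa [ht.ne'] using hx⟩
  intro z hz
  have := smul_mem_cone (interior_subset hz) ht.le
  simpa [ht.ne'] using this

theorem IsProper.zero_notMem_interior (hn : 0 < n) (hK : IsProper K) :
    (0 : Vec n) ∉ interior (K : Set (Vec n)) := by
  intro h
  have hmem : ∀ v : Vec n, v ∈ K := by
    intro v
    have ht : Filter.Tendsto (fun t : ℝ => t • v) (nhdsWithin 0 (Set.Ioi 0)) (nhds 0) := by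
      have : Filter.Tendsto (fun t : ℝ => t • v) (nhds 0) (nhds ((0 : ℝ) • v)) :=
        Continuous.tendsto (by fun_prop) 0
      rw [zero_smul] at this
      exact this.mono_left nhdsWithin_le_nhds
    obtain ⟨t, ht, htpos⟩ := ((ht.eventually (isOpen_interior.mem_nhds h)).and
      self_mem_nhdsWithin).exists
    have := smul_mem_cone (interior_subset ht) (inv_nonneg.2 (le_of_lt htpos))
    simpa [(ne_of_gt htpos : t ≠ 0)] using this
  have : Nonempty (Fin n) := ⟨⟨0, hn⟩⟩
  obtain ⟨v, hv⟩ := exists_ne (0 : Vec n)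
  exact hv (hK.pointed v (hmem v) (hmem _))

end Cone

/-! ### Calculus of barriers -/

namespace IsLHSCB

variable {n : ℕ} {K : ProperCone ℝ (Vec n)} {F : Vec n → ℝ} {ν : ℝ} (hF : IsLHSCB K F ν)
  {x : Vec n}
include hF

theorem hasGradientAt (hx : x ∈ interior (K : Set (Vec n))) : HasGradientAt F (gradient F x) x :=
  (hF.diff₁.differentiableAt (isOpen_interior.mem_nhds hx)).hasGradientAt

theorem hasFDerivAt (hx : x ∈ interior (K : Set (Vec n))) :
    HasFDerivAt F (InnerProductSpace.toDual ℝ (Vec n) (gradient F x)) x :=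
  (hF.hasGradientAt hx).hasFDerivAt

theorem hasFDerivAt_gradient (hx : x ∈ interior (K : Set (Vec n))) :
    HasFDerivAt (gradient F) (hessian F x) x :=
  (hF.diff₂.differentiableAt (isOpen_interior.mem_nhds hx)).hasFDerivAt

theorem hasDerivAt_line {h : Vec n} {t : ℝ} (hx : x + t • h ∈ interior (K : Set (Vec n))) :
    HasDerivAt (fun t : ℝ => F (x + t • h)) ⟪gradient F (x + t • h), h⟫_ℝ t := by
  have h₁ : HasDerivAt (fun t : ℝ => x + t • h) h t := by
    simpa using ((hasDerivAt_id t).smul_const h).const_add x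
  exact (hF.hasFDerivAt hx).comp_hasDerivAt t h₁

theorem hasDerivAt_gradient_line {h : Vec n} {t : ℝ}
    (hx : x + t • h ∈ interior (K : Set (Vec n))) (v : Vec n) :
    HasDerivAt (fun t : ℝ => ⟪v, gradient F (x + t • h)⟫_ℝ)
      ⟪v, hessian F (x + t • h) h⟫_ℝ t := by
  have h₁ : HasDerivAt (fun t : ℝ => x + t • h) h t := by
    simpa using ((hasDerivAt_id t).smul_const h).const_add x
  have h₂ := (hF.hasFDerivAt_gradient hx).comp_hasDerivAt t h₁
  have h₃ := (hasDerivAt_const t v).inner ℝ h₂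
  simpa using h₃

theorem gradient_inequality {x y : Vec n} (hx : x ∈ interior (K : Set (Vec n)))
    (hy : y ∈ interior (K : Set (Vec n))) : F x + ⟪gradient F x, y - x⟫_ℝ ≤ F y := by
  have hc : ConvexOn ℝ (Set.Icc (0 : ℝ) 1) (fun t : ℝ => F (x + t • (y - x))) := by
    have := (hF.strictConvex.convexOn).comp_affineMap (AffineMap.lineMap x y)
    refine (this.subset ?_ (convex_Icc 0 1)).congr ?_
    · intro t ht
      exact convex_interior.lineMap_mem hx hy ht
    · intro t _
      simp [AffineMap.lineMap_apply, add_comm]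
  have h0 : HasDerivAt (fun t : ℝ => F (x + t • (y - x))) ⟪gradient F x, y - x⟫_ℝ 0 := by
    have := hF.hasDerivAt_line (x := x) (h := y - x) (t := 0) (by simpa using hx)
    simpa using this
  have := hc.le_slope_of_hasDerivAt (x := 0) (y := 1) (by simp) (by simp) one_pos h0
  simp only [slope_def_field, one_smul, zero_smul, add_zero, add_sub_cancel, sub_zero,
    div_one] at this
  linarith

theorem hessian_symm (hx : x ∈ interior (K : Set (Vec n))) (u v : Vec n) :
    ⟪u, hessian F x v⟫_ℝ = ⟪v, hessian F x u⟫_ℝ := by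
  have h₁ : ∀ᶠ y in nhds x,
      HasFDerivAt F (InnerProductSpace.toDual ℝ (Vec n) (gradient F y)) y :=
    Filter.eventually_of_mem (isOpen_interior.mem_nhds hx) fun y hy => hF.hasFDerivAt hy
  have h₂ : HasFDerivAt (fun y => InnerProductSpace.toDual ℝ (Vec n) (gradient F y))
      ((InnerProductSpace.toDual ℝ (Vec n)).toContinuousLinearEquiv.toContinuousLinearMap.comp
        (hessian F x)) x :=
    (InnerProductSpace.toDual ℝ (Vec n)).toContinuousLinearEquiv.toContinuousLinearMap.hasFDerivAt.comp
      x (hF.hasFDerivAt_gradient hx)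
  have := second_derivative_symmetric_of_eventually h₁ h₂ v u
  simp at this
  rw [real_inner_comm, this, real_inner_comm]

/-- The gradient of a convex function is monotone, and this form is a limit of its difference
quotients along `v`. -/
theorem hessian_nonneg (hx : x ∈ interior (K : Set (Vec n))) (v : Vec n) :
    0 ≤ ⟪v, hessian F x v⟫_ℝ := by
  have h₁ := hF.hasDerivAt_gradient_line (x := x) (h := v) (t := 0) (by simpa using hx) v
  simp only [zero_smul, add_zero] at h₁
  have h₂ := h₁.tendsto_slope_zero_right
  refine ge_of_tendsto h₂ ?_
  have h₃ : Filter.Tendsto (fun t : ℝ => x + t • v) (nhds 0) (nhds (x + (0 : ℝ) • v)) :=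
    Continuous.tendsto (by fun_prop) 0
  rw [zero_smul, add_zero] at h₃
  have h₄ : ∀ᶠ t in nhdsWithin (0 : ℝ) (Set.Ioi 0), x + t • v ∈ interior (K : Set (Vec n)) :=
    (h₃.mono_left nhdsWithin_le_nhds).eventually (isOpen_interior.mem_nhds hx)
  filter_upwards [h₄, self_mem_nhdsWithin] with t ht htpos
  have htpos : 0 < t := htpos
  have a := hF.gradient_inequality hx ht
  have b := hF.gradient_inequality ht hx
  simp only [add_sub_cancel_left, sub_add_cancel_left, inner_neg_right, inner_smul_right] at a b
  simp only [zero_add, zero_smul, add_zero, smul_eq_mul]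
  rw [real_inner_comm, real_inner_comm (gradient F x)]
  have : 0 ≤ t * (⟪gradient F (x + t • v), v⟫_ℝ - ⟪gradient F x, v⟫_ℝ) := by linarith
  exact mul_nonneg (inv_nonneg.2 htpos.le) (nonneg_of_mul_nonneg_right this htpos)

theorem isPSD (hx : x ∈ interior (K : Set (Vec n))) : IsPSD (hessian F x) :=
  ⟨hF.hessian_symm hx, hF.hessian_nonneg hx⟩

theorem localNorm_sq (hx : x ∈ interior (K : Set (Vec n))) (v : Vec n) :
    localNorm F x v ^ 2 = ⟪v, hessian F x v⟫_ℝ := (hF.isPSD hx).qnorm_sq v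

/-! #### Logarithmic homogeneity -/

theorem gradient_smul (hx : x ∈ interior (K : Set (Vec n))) {t : ℝ} (ht : 0 < t) :
    gradient F (t • x) = t⁻¹ • gradient F x := by
  have h₁ : HasFDerivAt (fun y => F (t • y))
      ((InnerProductSpace.toDual ℝ (Vec n) (gradient F (t • x))).comp
        (t • ContinuousLinearMap.id ℝ (Vec n))) x :=
    (hF.hasFDerivAt (smul_mem_interior hx ht)).comp x
      ((t • ContinuousLinearMap.id ℝ (Vec n)).hasFDerivAt)
  have h₂ : HasFDerivAt (fun y => F (t • y))
      (InnerProductSpace.toDual ℝ (Vec n) (gradient F x)) x := by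
    refine ((hF.hasFDerivAt hx).sub_const (ν * Real.log t)).congr_of_eventuallyEq ?_
    filter_upwards [isOpen_interior.mem_nhds hx] with y hy using hF.logHom y hy t ht
  have h₃ := h₁.unique h₂
  have h₄ : t • gradient F (t • x) = gradient F x := by
    apply ext_inner_right ℝ
    intro v
    have := congrArg (fun L => L v) h₃
    simpa [inner_smul_left, inner_smul_right] using this
  rw [← h₄, smul_smul, inv_mul_cancel₀ ht.ne', one_smul]

theorem hessian_smul (hx : x ∈ interior (K : Set (Vec n))) {t : ℝ} (ht : 0 < t) (v : Vec n) :
    hessian F (t • x) v = (t⁻¹ * t⁻¹) • hessian F x v := by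
  have h₁ : HasFDerivAt (fun y => gradient F (t • y))
      ((hessian F (t • x)).comp (t • ContinuousLinearMap.id ℝ (Vec n))) x :=
    (hF.hasFDerivAt_gradient (smul_mem_interior hx ht)).comp x
      ((t • ContinuousLinearMap.id ℝ (Vec n)).hasFDerivAt)
  have h₂ : HasFDerivAt (fun y => gradient F (t • y)) (t⁻¹ • hessian F x) x := by
    refine ((hF.hasFDerivAt_gradient hx).const_smul t⁻¹).congr_of_eventuallyEq ?_
    filter_upwards [isOpen_interior.mem_nhds hx] with y hy using hF.gradient_smul hy ht
  have := congrArg (fun L => L v) (h₁.unique h₂)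
  simp only [ContinuousLinearMap.comp_apply, smul_apply,
    ContinuousLinearMap.id_apply, map_smul] at this
  rw [mul_smul, ← this, smul_smul, inv_mul_cancel₀ ht.ne', one_smul]

theorem localNorm_smul_base (hx : x ∈ interior (K : Set (Vec n))) {t : ℝ} (ht : 0 < t)
    (v : Vec n) : localNorm F (t • x) v = t⁻¹ * localNorm F x v := by
  rw [localNorm, localNorm, hF.hessian_smul hx ht, inner_smul_right,
    Real.sqrt_mul (mul_self_nonneg _), Real.sqrt_mul_self (inv_nonneg.2 ht.le)]

theorem inner_gradient_self (hx : x ∈ interior (K : Set (Vec n))) :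
    ⟪gradient F x, x⟫_ℝ = -ν := by
  have h₁ : HasDerivAt (fun t : ℝ => F (t • x)) ⟪gradient F x, x⟫_ℝ 1 := by
    have h₁ : HasDerivAt (fun t : ℝ => t • x) x 1 := by
      simpa using (hasDerivAt_id (1 : ℝ)).smul_const x
    exact HasFDerivAt.comp_hasDerivAt (l := F) (f := fun t : ℝ => t • x) 1
      (by rw [one_smul]; exact hF.hasFDerivAt hx) h₁
  have h₂ : HasDerivAt (fun t : ℝ => F (t • x)) (-(ν * 1⁻¹)) 1 := by
    refine (((Real.hasDerivAt_log one_ne_zero).const_mul ν).const_sub (F x)).congr_of_eventuallyEq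
      ?_
    filter_upwards [lt_mem_nhds (zero_lt_one (α := ℝ))] with t ht using hF.logHom x hx t ht
  simpa using h₁.unique h₂

/-- Differentiate `F'(t x) = t⁻¹ F'(x)` at `t = 1`. Together with the analogous identity for `F`
this gives `‖x‖ₓ² = ν`. -/
theorem hessian_self (hx : x ∈ interior (K : Set (Vec n))) :
    hessian F x x = -gradient F x := by
  have h₁ : HasDerivAt (fun t : ℝ => gradient F (t • x)) (hessian F x x) 1 := by
    have h₁ : HasDerivAt (fun t : ℝ => t • x) x 1 := by
      simpa using (hasDerivAt_id (1 : ℝ)).smul_const x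
    exact HasFDerivAt.comp_hasDerivAt (l := gradient F) (f := fun t : ℝ => t • x) 1
      (by simpa using hF.hasFDerivAt_gradient hx) h₁
  have h₂ : HasDerivAt (fun t : ℝ => gradient F (t • x)) ((-((1 : ℝ) ^ 2)⁻¹) • gradient F x) 1 := by
    refine ((hasDerivAt_inv one_ne_zero).smul_const (gradient F x)).congr_of_eventuallyEq ?_
    filter_upwards [lt_mem_nhds (zero_lt_one (α := ℝ))] with t ht using hF.gradient_smul hx ht
  simpa using h₁.unique h₂

theorem inner_sTilde_self (hx : x ∈ interior (K : Set (Vec n))) : ⟪x, sTilde F x⟫_ℝ = ν := by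
  rw [sTilde, inner_neg_right, real_inner_comm, hF.inner_gradient_self hx, neg_neg]

theorem localNorm_self_sq (hx : x ∈ interior (K : Set (Vec n))) : localNorm F x x ^ 2 = ν := by
  rw [hF.localNorm_sq hx, hF.hessian_self hx]
  exact hF.inner_sTilde_self hx

theorem localNorm_self (hx : x ∈ interior (K : Set (Vec n))) :
    localNorm F x x = Real.sqrt ν := by
  rw [← hF.localNorm_self_sq hx]
  exact (Real.sqrt_sq (Real.sqrt_nonneg _)).symm

/-- The origin lies at local distance `√ν` from `x`. If `ν < 1`, the Dikin ellipsoid would put it in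
the interior of a pointed cone. -/
theorem one_le_parameter (hn : 0 < n) (hK : IsProper K) : 1 ≤ ν := by
  obtain ⟨x, hx⟩ := hK.fullDim
  by_contra! h
  refine hK.zero_notMem_interior hn (hF.dikin x hx 0 ?_)
  rw [zero_sub, localNorm_eq_qnorm, qnorm_neg, ← localNorm_eq_qnorm, hF.localNorm_self hx,
    Real.sqrt_lt' one_pos]
  simpa using h

/-- Along a null direction the Dikin ellipsoid contains a whole line through `x`. Rescaling and
closedness put both `v` and `-v` in `K`. -/
theorem eq_zero_of_localNorm_eq_zero (hK : IsProper K) (hx : x ∈ interior (K : Set (Vec n)))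
    {v : Vec n} (hv : localNorm F x v = 0) : v = 0 := by
  have key : ∀ u : Vec n, localNorm F x u = 0 → u ∈ K := by
    intro u hu
    have hmem : ∀ k : ℕ, (1 / ((k : ℝ) + 1)) • x + u ∈ K := by
      intro k
      have h₁ : x + ((k : ℝ) + 1) • u ∈ interior (K : Set (Vec n)) := by
        apply hF.dikin x hx
        rw [add_sub_cancel_left, localNorm_eq_qnorm, qnorm_smul, ← localNorm_eq_qnorm, hu]
        simp
      have h₂ := smul_mem_cone (interior_subset h₁) (t := 1 / ((k : ℝ) + 1)) (by positivity)
      rwa [smul_add, smul_smul, one_div_mul_cancel (by positivity), one_smul] at h₂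
    have hlim : Filter.Tendsto (fun k : ℕ => (1 / ((k : ℝ) + 1)) • x + u) Filter.atTop (nhds u) := by
      have := (tendsto_one_div_add_atTop_nhds_zero_nat (𝕜 := ℝ)).smul_const x |>.add_const u
      simpa using this
    exact K.isClosed.mem_of_tendsto hlim (Filter.Eventually.of_forall hmem)
  refine hK.pointed v (key v hv) (key (-v) ?_)
  rw [localNorm_eq_qnorm, qnorm_neg]
  exact hv

end IsLHSCB

namespace IsLHSCB

variable {n : ℕ} {K : ProperCone ℝ (Vec n)} {F : Vec n → ℝ} {ν : ℝ} (hF : IsLHSCB K F ν)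
  {x : Vec n}

/-! #### Local comparison of Hessians -/

/-- Compactness of the unit sphere; this transfers local-norm estimates to the Euclidean topology.
The sphere is empty when `n = 0`, which is the second case. -/
theorem exists_norm_le_localNorm (hF : IsLHSCB K F ν) (hK : IsProper K)
    (hx : x ∈ interior (K : Set (Vec n))) :
    ∃ c : ℝ, 0 < c ∧ ∀ v : Vec n, ‖v‖ ≤ c * localNorm F x v := by
  have hcont : Continuous (fun v : Vec n => localNorm F x v) := by
    unfold localNorm; fun_prop
  by_cases hne : (Metric.sphere (0 : Vec n) 1).Nonempty
  · obtain ⟨u, hu, hmin⟩ := (isCompact_sphere (0 : Vec n) 1).exists_isMinOn hne hcont.continuousOn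
    have hupos : 0 < localNorm F x u := by
      refine (Real.sqrt_nonneg _).lt_of_ne' fun h => ?_
      rw [hF.eq_zero_of_localNorm_eq_zero hK hx h] at hu
      simp at hu
    refine ⟨(localNorm F x u)⁻¹, inv_pos.2 hupos, fun v => ?_⟩
    rw [inv_mul_eq_div, le_div_iff₀ hupos]
    by_cases hv : v = 0
    · simp [hv, localNorm]
    have hv' : 0 < ‖v‖ := norm_pos_iff.2 hv
    have h := hmin (show ‖v‖⁻¹ • v ∈ Metric.sphere (0 : Vec n) 1 by
      simp [norm_smul, hv'.ne'])
    simp only [Set.mem_ofPred_eq, localNorm_eq_qnorm, qnorm_smul, abs_inv, abs_norm] at h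
    rwa [inv_mul_eq_div, le_div_iff₀ hv', mul_comm] at h
  · refine ⟨1, one_pos, fun v => ?_⟩
    by_cases hv : v = 0
    · simp [hv, localNorm]
    · exact (hne ⟨‖v‖⁻¹ • v, by simp [norm_smul, hv]⟩).elim

include hF

theorem add_mem_of_localNorm_lt (hx : x ∈ interior (K : Set (Vec n))) {h : Vec n}
    (hh : localNorm F x h < 1) : x + h ∈ interior (K : Set (Vec n)) :=
  hF.dikin x hx _ (by simpa using hh)

theorem hessian_le (hx : x ∈ interior (K : Set (Vec n))) {h : Vec n} {r : ℝ}
    (hh : localNorm F x h ≤ r) (hr : r < 1) (v : Vec n) :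
    (1 - r) ^ 2 * ⟪v, hessian F (x + h) v⟫_ℝ ≤ ⟪v, hessian F x v⟫_ℝ := by
  have h1 : localNorm F x h < 1 := hh.trans_lt hr
  have hx' := hF.add_mem_of_localNorm_lt hx h1
  have := hF.lower x hx _ hx' (by simpa using h1) v
  rw [add_sub_cancel_left] at this
  refine le_trans (mul_le_mul_of_nonneg_right ?_ (hF.hessian_nonneg hx' v)) this
  exact pow_le_pow_left₀ (by linarith) (by linarith) 2

theorem le_hessian (hx : x ∈ interior (K : Set (Vec n))) {h : Vec n} {r : ℝ}
    (hh : localNorm F x h ≤ r) (hr : r < 1) (v : Vec n) :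
    (1 - r) ^ 2 * ⟪v, hessian F x v⟫_ℝ ≤ ⟪v, hessian F (x + h) v⟫_ℝ := by
  have h1 : localNorm F x h < 1 := hh.trans_lt hr
  have hx' := hF.add_mem_of_localNorm_lt hx h1
  have := hF.upper x hx _ hx' (by simpa using h1) v
  rw [add_sub_cancel_left, one_div_mul_eq_div,
    le_div_iff₀ (by have : 0 < 1 - localNorm F x h := by linarith
                    positivity)] at this
  refine le_trans ?_ this
  rw [mul_comm]
  refine mul_le_mul_of_nonneg_left ?_ (hF.hessian_nonneg hx v)
  exact pow_le_pow_left₀ (by linarith) (by linarith) 2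

theorem localNorm_le_of_near (hx : x ∈ interior (K : Set (Vec n))) {h : Vec n} {r : ℝ}
    (hh : localNorm F x h ≤ r) (hr : r < 1) (v : Vec n) :
    (1 - r) * localNorm F x v ≤ localNorm F (x + h) v := by
  have hx' := hF.add_mem_of_localNorm_lt hx (hh.trans_lt hr)
  refine (sq_le_sq₀ (mul_nonneg (by linarith) (localNorm_nonneg F x v))
    (localNorm_nonneg F (x + h) v)).1 ?_
  rw [mul_pow, hF.localNorm_sq hx, hF.localNorm_sq hx']
  exact hF.le_hessian hx hh hr v

omit hF in
theorem localNorm_smul_le {h : Vec n} {t : ℝ} (ht : t ∈ Set.Icc (0 : ℝ) 1) :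
    localNorm F x (t • h) ≤ localNorm F x h := by
  rw [localNorm_eq_qnorm, qnorm_smul, abs_of_nonneg ht.1]
  exact mul_le_of_le_one_left (qnorm_nonneg _ _) ht.2

theorem add_smul_mem (hx : x ∈ interior (K : Set (Vec n))) {h : Vec n}
    (hh : localNorm F x h < 1) {t : ℝ} (ht : t ∈ Set.Icc (0 : ℝ) 1) :
    x + t • h ∈ interior (K : Set (Vec n)) :=
  hF.add_mem_of_localNorm_lt hx ((localNorm_smul_le ht).trans_lt hh)

/-- First order Taylor expansion of the gradient. -/
theorem abs_inner_gradient_sub_le (hK : IsProper K) (hx : x ∈ interior (K : Set (Vec n)))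
    {h : Vec n} (hh : localNorm F x h ≤ 1 / 10) (v : Vec n) :
    |⟪v, gradient F (x + h) - gradient F x - hessian F x h⟫_ℝ| ≤
      5 / 2 * localNorm F x h ^ 2 * localNorm F x v := by
  set r := localNorm F x h with hr
  have hr0 : 0 ≤ r := Real.sqrt_nonneg _
  have hseg : ∀ t ∈ Set.Icc (0 : ℝ) 1, x + t • h ∈ interior (K : Set (Vec n)) := fun t ht =>
    hF.add_smul_mem hx (by linarith) ht
  have hder : ∀ t ∈ Set.Icc (0 : ℝ) 1,
      HasDerivAt (fun t : ℝ => ⟪v, gradient F (x + t • h)⟫_ℝ - t * ⟪v, hessian F x h⟫_ℝ)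
        (⟪v, hessian F (x + t • h) h⟫_ℝ - ⟪v, hessian F x h⟫_ℝ) t := by
    intro t ht
    have := (hF.hasDerivAt_gradient_line (hseg t ht) v).sub
      ((hasDerivAt_id t).mul_const ⟪v, hessian F x h⟫_ℝ)
    rw [one_mul] at this
    exact this
  obtain ⟨t, ht, hslope⟩ := exists_hasDerivAt_eq_slope _ _ (zero_lt_one (α := ℝ))
    (fun t ht => (hder t ht).continuousAt.continuousWithinAt)
    (fun t ht => hder t (Set.Ioo_subset_Icc_self ht))
  have ht' := Set.Ioo_subset_Icc_self ht
  have hB : ∀ u w : Vec n, ⟪u, (hessian F (x + t • h) - hessian F x) w⟫_ℝ =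
      ⟪w, (hessian F (x + t • h) - hessian F x) u⟫_ℝ := by
    intro u w
    simp only [sub_apply, inner_sub_right]
    rw [hF.hessian_symm (hseg t ht'), hF.hessian_symm hx]
  -- For `r ≤ 1/10`, both `1 - (1 - r)²` and `(1 - r)⁻² - 1` are at most `5/2 r`. The numerical
  -- range of the Hessian difference then bounds its bilinear form.
  have hc : ∀ w, |⟪w, (hessian F (x + t • h) - hessian F x) w⟫_ℝ| ≤
      (5 / 2 * r) * qnorm (hessian F x) w ^ 2 := by
    intro w
    have htr : localNorm F x (t • h) ≤ r := localNorm_smul_le ht'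
    have h₁ := hF.hessian_le hx htr (by linarith) w
    have h₂ := hF.le_hessian hx htr (by linarith) w
    rw [(hF.isPSD hx).qnorm_sq]
    simp only [sub_apply, inner_sub_right]
    have h₃ := hF.hessian_nonneg hx w
    set a := ⟪w, hessian F x w⟫_ℝ
    set b := ⟪w, hessian F (x + t • h) w⟫_ℝ
    rw [abs_le]
    constructor
    · nlinarith [mul_nonneg hr0 h₃, mul_nonneg (mul_nonneg hr0 hr0) h₃]
    · have h₄ : 1 ≤ (1 + 5 / 2 * r) * (1 - r) ^ 2 := by nlinarith [mul_nonneg hr0 hr0]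
      have h₅ : (1 - r) ^ 2 * b ≤ (1 - r) ^ 2 * ((1 + 5 / 2 * r) * a) := by nlinarith
      have := le_of_mul_le_mul_left h₅ (by have : 0 < 1 - r := by linarith
                                           positivity)
      linarith
  have := (hF.isPSD hx).abs_inner_le_of_forall_abs_inner_self_le
    (fun w hw => hF.eq_zero_of_localNorm_eq_zero hK hx hw) hB hc v h
  rw [sub_apply, inner_sub_right, hslope] at this
  simp only [one_smul, zero_smul, add_zero, sub_zero, div_one, one_mul, zero_mul] at this
  rw [← localNorm_eq_qnorm, ← localNorm_eq_qnorm, ← hr] at this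
  rw [inner_sub_right, inner_sub_right]
  convert this using 1
  · congr 1; ring
  · ring

theorem exists_inner_gradient_sub_eq (hx : x ∈ interior (K : Set (Vec n))) {h : Vec n}
    (hh : localNorm F x h < 1) :
    ∃ t ∈ Set.Icc (0 : ℝ) 1, ⟪h, gradient F (x + h) - gradient F x⟫_ℝ =
      ⟪h, hessian F (x + t • h) h⟫_ℝ := by
  obtain ⟨t, ht, hslope⟩ := exists_hasDerivAt_eq_slope _ _ (zero_lt_one (α := ℝ))
    (fun t ht => (hF.hasDerivAt_gradient_line
      (hF.add_smul_mem hx hh ht) h).continuousAt.continuousWithinAt)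
    (fun t ht => hF.hasDerivAt_gradient_line
      (hF.add_smul_mem hx hh (Set.Ioo_subset_Icc_self ht)) h)
  refine ⟨t, Set.Ioo_subset_Icc_self ht, ?_⟩
  rw [hslope, inner_sub_right]
  simp

theorem le_inner_gradient_sub (hx : x ∈ interior (K : Set (Vec n))) {h : Vec n}
    (hh : localNorm F x h ≤ 1 / 2) :
    localNorm F x h ^ 2 / 4 ≤ ⟪h, gradient F (x + h) - gradient F x⟫_ℝ := by
  obtain ⟨t, ht, he⟩ := hF.exists_inner_gradient_sub_eq hx (hh.trans_lt (by norm_num))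
  have := hF.le_hessian hx ((localNorm_smul_le ht).trans hh) (by norm_num) h
  rw [he, hF.localNorm_sq hx]
  linarith

theorem inner_gradient_sub_le (hx : x ∈ interior (K : Set (Vec n))) {h : Vec n}
    (hh : localNorm F x h ≤ 1 / 2) :
    ⟪h, gradient F (x + h) - gradient F x⟫_ℝ ≤ 4 * localNorm F x h ^ 2 := by
  obtain ⟨t, ht, he⟩ := hF.exists_inner_gradient_sub_eq hx (hh.trans_lt (by norm_num))
  have := hF.hessian_le hx ((localNorm_smul_le ht).trans hh) (by norm_num) h
  rw [he, hF.localNorm_sq hx]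
  linarith

/-! #### Growth of the barrier -/

/-- Mean value theorem for `t ↦ F(x + t h) - c t²`. When `c` is the intended quadratic bound, the
gradient estimate at the intermediate point dominates `2 c t`, so no integration is needed. -/
theorem exists_bregman_eq (hx : x ∈ interior (K : Set (Vec n))) {h : Vec n}
    (hh : localNorm F x h < 1) (c : ℝ) :
    ∃ t ∈ Set.Ioo (0 : ℝ) 1, F (x + h) - F x - ⟪gradient F x, h⟫_ℝ - c =
      t⁻¹ * ⟪t • h, gradient F (x + t • h) - gradient F x⟫_ℝ - 2 * c * t := by
  have hder : ∀ t ∈ Set.Icc (0 : ℝ) 1,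
      HasDerivAt (fun t : ℝ => F (x + t • h) - c * (t * t))
        (⟪gradient F (x + t • h), h⟫_ℝ - c * (1 * t + t * 1)) t := fun t ht =>
    (hF.hasDerivAt_line (hF.add_smul_mem hx hh ht)).sub
      (((hasDerivAt_id t).mul (hasDerivAt_id t)).const_mul c)
  obtain ⟨t, ht, hslope⟩ := exists_hasDerivAt_eq_slope _ _ (zero_lt_one (α := ℝ))
    (fun t ht => (hder t ht).continuousAt.continuousWithinAt)
    (fun t ht => hder t (Set.Ioo_subset_Icc_self ht))
  refine ⟨t, ht, ?_⟩
  simp only [one_smul, zero_smul, add_zero, sub_zero, div_one, one_mul, mul_zero,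
    mul_one] at hslope
  rw [inner_smul_left, conj_trivial, ← mul_assoc, inv_mul_cancel₀ ht.1.ne', one_mul,
    inner_sub_right, real_inner_comm _ h, real_inner_comm _ h]
  linarith

theorem bregman_ge (hx : x ∈ interior (K : Set (Vec n))) {h : Vec n}
    (hh : localNorm F x h ≤ 1 / 2) :
    F x + ⟪gradient F x, h⟫_ℝ + localNorm F x h ^ 2 / 8 ≤ F (x + h) := by
  obtain ⟨t, ht, he⟩ := hF.exists_bregman_eq hx (hh.trans_lt (by norm_num))
    (localNorm F x h ^ 2 / 8)
  have := hF.le_inner_gradient_sub hx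
    ((localNorm_smul_le (Set.Ioo_subset_Icc_self ht)).trans hh)
  rw [localNorm_eq_qnorm, qnorm_smul, abs_of_pos ht.1, ← localNorm_eq_qnorm] at this
  have h₁ := mul_le_mul_of_nonneg_left this (inv_nonneg.2 ht.1.le)
  have h₂ : t⁻¹ * ((t * localNorm F x h) ^ 2 / 4) = t * localNorm F x h ^ 2 / 4 := by
    field_simp [ht.1.ne']
  nlinarith

theorem bregman_le (hx : x ∈ interior (K : Set (Vec n))) {h : Vec n}
    (hh : localNorm F x h ≤ 1 / 2) :
    F (x + h) ≤ F x + ⟪gradient F x, h⟫_ℝ + 2 * localNorm F x h ^ 2 := by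
  obtain ⟨t, ht, he⟩ := hF.exists_bregman_eq hx (hh.trans_lt (by norm_num))
    (2 * localNorm F x h ^ 2)
  have := hF.inner_gradient_sub_le hx
    ((localNorm_smul_le (Set.Ioo_subset_Icc_self ht)).trans hh)
  rw [localNorm_eq_qnorm, qnorm_smul, abs_of_pos ht.1, ← localNorm_eq_qnorm] at this
  have h₁ := mul_le_mul_of_nonneg_left this (inv_nonneg.2 ht.1.le)
  have h₂ : t⁻¹ * (4 * (t * localNorm F x h) ^ 2) = 4 * (t * localNorm F x h ^ 2) := by
    field_simp [ht.1.ne']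
  nlinarith

/-- Convexity extrapolates the quadratic gain `1/32` at local distance `1/2` to linear growth
farther out: with `t r = 1/2`, `1/32 = t r/16`. -/
theorem bregman_ge_of_half_le (hx : x ∈ interior (K : Set (Vec n))) {h : Vec n}
    (hxh : x + h ∈ interior (K : Set (Vec n))) (hh : 1 / 2 ≤ localNorm F x h) :
    F x + ⟪gradient F x, h⟫_ℝ + localNorm F x h / 16 ≤ F (x + h) := by
  set r := localNorm F x h with hr
  have hrpos : 0 < r := by linarith
  set t := 1 / (2 * r) with ht
  have ht0 : 0 < t := by positivity
  have ht1 : t ≤ 1 := by rw [ht, div_le_one (by positivity)]; linarith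
  have htr : t * r = 1 / 2 := by rw [ht]; field_simp
  have hn : localNorm F x (t • h) = 1 / 2 := by
    rw [localNorm_eq_qnorm, qnorm_smul, abs_of_pos ht0, ← localNorm_eq_qnorm, ← hr, htr]
  have h₁ := hF.bregman_ge hx hn.le
  rw [hn, inner_smul_right] at h₁
  have h₂ := hF.strictConvex.convexOn.2 hx hxh (sub_nonneg.2 ht1) ht0.le (by ring)
  rw [show (1 - t) • x + t • (x + h) = x + t • h by module] at h₂
  simp only [smul_eq_mul] at h₂
  have h₃ : t * (F x + ⟪gradient F x, h⟫_ℝ + r / 16) ≤ t * F (x + h) := by nlinarith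
  exact le_of_mul_le_mul_left h₃ ht0

/-! #### The gradient and the dual cone -/

/-- Along a ray of the cone `F` decreases logarithmically, while a positive slope of the tangent
plane would force linear growth. Adding a small multiple of `x` moves `y` into the interior and
keeps half of the slope. -/
theorem inner_gradient_nonpos (hν : 0 < ν) (hx : x ∈ interior (K : Set (Vec n))) {y : Vec n}
    (hy : y ∈ K) : ⟪gradient F x, y⟫_ℝ ≤ 0 := by
  by_contra! hpos
  set c := ⟪gradient F x, y⟫_ℝ with hc
  have hy' : y + (c / (2 * ν)) • x ∈ interior (K : Set (Vec n)) := by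
    rw [add_comm]
    exact add_mem_interior (smul_mem_interior hx (by positivity)) hy
  set y' := y + (c / (2 * ν)) • x with hy'def
  have hcy : ⟪gradient F x, y'⟫_ℝ = c / 2 := by
    rw [hy'def, inner_add_right, inner_smul_right, hF.inner_gradient_self hx, ← hc]
    field_simp; ring
  set M := |F y' - F x - ν| with hM
  set l := 1 + 2 * M / c with hl
  have hM0 : 0 ≤ M := abs_nonneg _
  have hl1 : 1 ≤ l := by
    have : 0 ≤ 2 * M / c := by positivity
    linarith
  have h₁ := hF.gradient_inequality hx (smul_mem_interior hy' (by linarith : 0 < l))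
  rw [hF.logHom y' hy' l (by linarith), inner_sub_right, inner_smul_right, hcy,
    hF.inner_gradient_self hx] at h₁
  have h₂ : 0 ≤ ν * Real.log l := mul_nonneg hν.le (Real.log_nonneg hl1)
  have h₃ : l * (c / 2) = c / 2 + M := by rw [hl]; field_simp
  have := le_abs_self (F y' - F x - ν)
  linarith

/-- Moving from `x` along `y` to local distance `1/2` raises the slope by a definite amount, yet the
slope there is still nonpositive; so it was well below zero at `x`. This says quantitatively that
`-F'(x)` is interior to the dual cone. -/
theorem localNorm_le_inner_sTilde (hν : 0 < ν) (hx : x ∈ interior (K : Set (Vec n))) {y : Vec n}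
    (hy : y ∈ K) : localNorm F x y / 8 ≤ ⟪y, sTilde F x⟫_ℝ := by
  rw [sTilde, inner_neg_right, real_inner_comm]
  rcases (localNorm_nonneg F x y).eq_or_lt with h0 | hpos
  · rw [← h0]
    have := hF.inner_gradient_nonpos hν hx hy
    linarith
  set r := localNorm F x y with hr
  have hr0 : r ≠ 0 := hpos.ne'
  have hn : localNorm F x ((1 / (2 * r)) • y) = 1 / 2 := by
    rw [localNorm_eq_qnorm, qnorm_smul, abs_of_pos (by positivity), ← localNorm_eq_qnorm, ← hr]
    field_simp
  have h₁ := hF.le_inner_gradient_sub hx hn.le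
  have h₂ := hF.inner_gradient_nonpos hν
    (hF.add_mem_of_localNorm_lt hx (hn.trans_lt (by norm_num))) hy
  rw [hn, inner_smul_left, inner_sub_right, real_inner_comm, real_inner_comm _ y,
    conj_trivial] at h₁
  rw [div_mul_eq_mul_div, le_div_iff₀ (by positivity)] at h₁
  linarith

theorem mem_interior_dualCone (hK : IsProper K) (hν : 0 < ν)
    (hx : x ∈ interior (K : Set (Vec n))) {s : Vec n} {θ : ℝ} (hθ : θ < 1 / 8)
    (hs : ∀ v, |⟪v, s + gradient F x⟫_ℝ| ≤ θ * localNorm F x v) :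
    s ∈ interior (dualCone K : Set (Vec n)) := by
  obtain ⟨c, hc, hcn⟩ := hF.exists_norm_le_localNorm hK hx
  rw [mem_interior_iff_mem_nhds]
  refine Filter.mem_of_superset (Metric.ball_mem_nhds s
    (show 0 < (1 / 8 - θ) / c from div_pos (by linarith) hc)) ?_
  intro s' hs'
  rw [SetLike.mem_coe, ProperCone.mem_innerDual]
  intro y hy
  have h₁ := hF.localNorm_le_inner_sTilde hν hx hy
  have h₂ := (abs_le.1 (hs y)).1
  have h₃ : |⟪y, s' - s⟫_ℝ| ≤ (1 / 8 - θ) * localNorm F x y := by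
    refine (abs_real_inner_le_norm y (s' - s)).trans ?_
    rw [Metric.mem_ball, dist_eq_norm] at hs'
    calc ‖y‖ * ‖s' - s‖ ≤ (c * localNorm F x y) * ((1 / 8 - θ) / c) :=
          mul_le_mul (hcn y) hs'.le (norm_nonneg _) ((norm_nonneg _).trans (hcn y))
      _ = (1 / 8 - θ) * localNorm F x y := by field_simp
  have h₄ := (abs_le.1 h₃).1
  have : ⟪y, s'⟫_ℝ = ⟪y, s' - s⟫_ℝ + ⟪y, s + gradient F x⟫_ℝ + ⟪y, sTilde F x⟫_ℝ := by
    simp only [sTilde, inner_sub_right, inner_add_right, inner_neg_right]; ring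
  linarith

/-- If the gradient of `F + ⟨s, ·⟩` is small at `x`, then it vanishes at a point near `x`. -/
theorem exists_gradient_eq_near (hK : IsProper K) (hx : x ∈ interior (K : Set (Vec n)))
    {s : Vec n} {θ : ℝ} (hθ : θ < 1 / 16)
    (hs : ∀ v, |⟪v, s + gradient F x⟫_ℝ| ≤ θ * localNorm F x v) :
    ∃ h : Vec n, localNorm F x h < 1 / 2 ∧ gradient F (x + h) = -s := by
  obtain ⟨c, hc, hcn⟩ := hF.exists_norm_le_localNorm hK hx
  have hcont : Continuous (fun v : Vec n => localNorm F x v) := by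
    unfold localNorm; fun_prop
  have hcomp : IsCompact {h : Vec n | localNorm F x h ≤ 1 / 2} := by
    refine Metric.isCompact_of_isClosed_isBounded (isClosed_le hcont continuous_const)
      ((Metric.isBounded_closedBall (x := (0 : Vec n)) (r := c * (1 / 2))).subset ?_)
    intro v hv
    rw [mem_closedBall_zero_iff]
    exact (hcn v).trans (mul_le_mul_of_nonneg_left hv hc.le)
  have hder : ∀ h : Vec n, localNorm F x h ≤ 1 / 2 →
      HasFDerivAt (fun h => F (x + h) + ⟪s, h⟫_ℝ)
        (InnerProductSpace.toDual ℝ (Vec n) (gradient F (x + h)) +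
          InnerProductSpace.toDual ℝ (Vec n) s) h := by
    intro h hh
    have h₁ := hF.hasFDerivAt (hF.add_mem_of_localNorm_lt hx (hh.trans_lt (by norm_num)))
    have h₂ : HasFDerivAt (fun h => x + h) (ContinuousLinearMap.id ℝ (Vec n)) h :=
      (hasFDerivAt_id h).const_add x
    exact (h₁.comp h h₂).add (InnerProductSpace.toDual ℝ (Vec n) s).hasFDerivAt
  obtain ⟨h, hh, hmin⟩ := hcomp.exists_isMinOn ⟨0, by simp [localNorm]⟩
    (fun h hh => (hder h hh).continuousAt.continuousWithinAt)
  -- On the boundary of the ellipsoid the growth `1/32` exceeds the loss `θ/2`, so the minimiser is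
  -- not there.
  have hlt : localNorm F x h < 1 / 2 := by
    refine lt_of_le_of_ne hh fun he => ?_
    have h₁ : F (x + h) + ⟪s, h⟫_ℝ ≤ F (x + 0) + ⟪s, (0 : Vec n)⟫_ℝ :=
      hmin (by simp [localNorm])
    have h₂ := hF.bregman_ge hx hh
    have h₃ := (abs_le.1 (hs h)).1
    rw [he] at h₂ h₃
    rw [inner_add_right, real_inner_comm, real_inner_comm (gradient F x)] at h₃
    rw [add_zero, inner_zero_right] at h₁
    linarith
  refine ⟨h, hlt, ?_⟩
  have hloc : IsLocalMin (fun h => F (x + h) + ⟪s, h⟫_ℝ) h := by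
    refine Filter.mem_of_superset ((isOpen_lt hcont continuous_const).mem_nhds hlt) ?_
    intro v hv
    exact hmin (show localNorm F x v ≤ 1 / 2 from le_of_lt hv)
  have h0 := hloc.hasFDerivAt_eq_zero (hder h hlt.le)
  rw [← map_add, map_eq_zero_iff _ (InnerProductSpace.toDual ℝ (Vec n)).injective] at h0
  exact eq_neg_of_add_eq_zero_left h0

/-- An interior `s` satisfies `⟨s, y⟩ ≥ ε‖y‖` on the cone. The tangent plane of `F` at a far point
`l e` has slope `l⁻¹ F'(e)`, of norm at most `ε`, so `⟨s, ·⟩` absorbs it. -/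
theorem bddBelow_of_mem_interior_dualCone (hK : IsProper K) {s : Vec n}
    (hs : s ∈ interior (dualCone K : Set (Vec n))) :
    BddBelow ((fun y => F y + ⟪s, y⟫_ℝ) '' interior (K : Set (Vec n))) := by
  obtain ⟨e, he⟩ := hK.fullDim
  obtain ⟨ε, hε, hball⟩ := Metric.nhds_basis_closedBall.mem_iff.1
    (mem_interior_iff_mem_nhds.1 hs)
  have hgrow : ∀ y ∈ K, ε * ‖y‖ ≤ ⟪s, y⟫_ℝ := by
    intro y hy
    by_cases h0 : y = 0
    · simp [h0]
    have hn : 0 < ‖y‖ := norm_pos_iff.2 h0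
    have hmem : s - (ε / ‖y‖) • y ∈ dualCone K := by
      apply hball
      rw [Metric.mem_closedBall, dist_eq_norm, sub_sub_cancel_left, norm_neg, norm_smul,
        Real.norm_of_nonneg (by positivity)]
      field_simp; rfl
    rw [ProperCone.mem_innerDual] at hmem
    have := hmem hy
    rw [inner_sub_right, inner_smul_right, real_inner_self_eq_norm_sq, real_inner_comm] at this
    have h₂ : ε / ‖y‖ * ‖y‖ ^ 2 = ε * ‖y‖ := by field_simp
    linarith
  set l := ‖gradient F e‖ / ε + 1 with hl
  have hlpos : 0 < l := by positivity
  refine ⟨F (l • e) + ν, ?_⟩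
  rintro _ ⟨y, hy, rfl⟩
  have hle := smul_mem_interior he hlpos
  have h₁ := hF.gradient_inequality hle hy
  rw [inner_sub_right, hF.inner_gradient_self hle, hF.gradient_smul he hlpos, inner_smul_left,
    conj_trivial] at h₁
  have h₂ := hgrow y (interior_subset hy)
  have h₃ := (abs_le.1 (abs_real_inner_le_norm (gradient F e) y)).1
  have h₄ : l⁻¹ * (‖gradient F e‖ * ‖y‖) ≤ ε * ‖y‖ := by
    rw [inv_mul_le_iff₀ hlpos, ← mul_assoc]
    refine mul_le_mul_of_nonneg_right ?_ (norm_nonneg _)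
    have : l * ε = ‖gradient F e‖ + ε := by rw [hl]; field_simp
    linarith
  have h₅ := mul_le_mul_of_nonneg_left h₃ (inv_nonneg.2 hlpos.le)
  simp only
  linarith

/-- A near-minimiser of `F + ⟨s, ·⟩` must have small gradient in the dual local norm, and then an
exact critical point exists nearby. No compactness of sublevel sets is needed. -/
theorem exists_gradient_eq_neg (hK : IsProper K) {s : Vec n}
    (hs : s ∈ interior (dualCone K : Set (Vec n))) :
    ∃ y ∈ interior (K : Set (Vec n)), gradient F y = -s := by
  have hbdd := hF.bddBelow_of_mem_interior_dualCone hK hs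
  -- A step of local length `1/80` against a gradient larger than `1/20` gains more than `1/1600 -
  -- 2/6400 = 1/3200`, which would undercut the infimum.
  obtain ⟨_, ⟨x, hx, rfl⟩, hlt⟩ := Real.lt_sInf_add_pos (hK.fullDim.image
    (fun y => F y + ⟪s, y⟫_ℝ)) (show (0 : ℝ) < 1 / 3200 by norm_num)
  have hsmall : ∀ v, |⟪v, s + gradient F x⟫_ℝ| ≤ 1 / 20 * localNorm F x v := by
    by_contra! hcon
    obtain ⟨v, hv⟩ := hcon
    obtain ⟨u, hu⟩ : ∃ u : Vec n, ⟪u, s + gradient F x⟫_ℝ < -(1 / 20 * localNorm F x u) := by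
      rcases lt_abs.1 hv with h | h
      · refine ⟨-v, ?_⟩
        rw [localNorm_eq_qnorm, qnorm_neg, ← localNorm_eq_qnorm, inner_neg_left]
        linarith
      · exact ⟨v, by linarith⟩
    have hupos : 0 < localNorm F x u := by
      refine (Real.sqrt_nonneg _).lt_of_ne' fun h => ?_
      rw [hF.eq_zero_of_localNorm_eq_zero hK hx h] at hu
      simp [localNorm] at hu
    set t := 1 / (80 * localNorm F x u) with ht
    have htpos : 0 < t := by positivity
    have hn : localNorm F x (t • u) = 1 / 80 := by
      rw [localNorm_eq_qnorm, qnorm_smul, abs_of_pos htpos, ← localNorm_eq_qnorm, ht]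
      field_simp
    have hmem := hF.add_mem_of_localNorm_lt hx (hn.trans_lt (by norm_num))
    have h₁ := hF.bregman_le hx (by rw [hn]; norm_num)
    have h₂ : sInf ((fun y => F y + ⟪s, y⟫_ℝ) '' interior (K : Set (Vec n))) ≤
      F (x + t • u) + ⟪s, x + t • u⟫_ℝ := csInf_le hbdd ⟨_, hmem, rfl⟩
    have h₃ := mul_lt_mul_of_pos_left hu htpos
    have h₄ : t * localNorm F x u = 1 / 80 := by rw [ht]; field_simp
    rw [hn] at h₁
    rw [inner_add_right, real_inner_comm, real_inner_comm (gradient F x)] at h₃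
    rw [inner_add_right, inner_smul_right] at h₂
    rw [inner_smul_right] at h₁
    simp only at hlt
    nlinarith
  obtain ⟨h, hh, hg⟩ := hF.exists_gradient_eq_near hK hx (by norm_num) hsmall
  exact ⟨x + h, hF.add_mem_of_localNorm_lt hx (hh.trans (by norm_num)), hg⟩

/-! #### The conjugate barrier -/

/-- Near `x` the loss `r²/8` against the gain `θ r` leaves at most `2 θ²`; beyond local distance
`1/2` the linear loss `r/16` already wins. -/
theorem conjugate_bound {s s' : Vec n} (hx : x ∈ interior (K : Set (Vec n)))
    (hg : gradient F x = -s) {θ : ℝ} (hθ : θ ≤ 1 / 16)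
    (hs : ∀ v, |⟪v, s' - s⟫_ℝ| ≤ θ * localNorm F x v) {y : Vec n}
    (hy : y ∈ interior (K : Set (Vec n))) :
    -⟪s', y⟫_ℝ - F y ≤ -⟪s', x⟫_ℝ - F x + 2 * θ ^ 2 := by
  obtain ⟨h, rfl⟩ : ∃ h, y = x + h := ⟨y - x, by abel⟩
  have h₁ := (abs_le.1 (hs h)).1
  have h₂ : ⟪h, s' - s⟫_ℝ = ⟪s', h⟫_ℝ + ⟪gradient F x, h⟫_ℝ := by
    rw [hg, inner_sub_right, inner_neg_left, real_inner_comm, real_inner_comm h s]; ring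
  rw [inner_add_right]
  set r := localNorm F x h with hr
  rcases le_total r (1 / 2) with hle | hge
  · have := hF.bregman_ge hx hle
    nlinarith [sq_nonneg (r - 4 * θ)]
  · have := hF.bregman_ge_of_half_le hx hy hge
    have h₃ : θ * r ≤ 1 / 16 * r := mul_le_mul_of_nonneg_right hθ (Real.sqrt_nonneg _)
    nlinarith [sq_nonneg θ]

/-- Near `s` the conjugate is squeezed between its supporting affine function `-⟨s', x⟩ - F(x)` and
the same plus `O(‖s' - s‖²)`. The upper bound also shows that the supremum is finite there. -/
theorem hasGradientAt_conjugate (hK : IsProper K) {s : Vec n}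
    (hx : x ∈ interior (K : Set (Vec n))) (hg : gradient F x = -s) :
    HasGradientAt (conjugate K F) (-x) s := by
  obtain ⟨c, hc, hcn⟩ := hF.exists_norm_le_localNorm hK hx
  have hdual : ∀ s' v : Vec n, |⟪v, s' - s⟫_ℝ| ≤ (c * ‖s' - s‖) * localNorm F x v := by
    intro s' v
    refine (abs_real_inner_le_norm v (s' - s)).trans ?_
    have := mul_le_mul_of_nonneg_right (hcn v) (norm_nonneg (s' - s))
    linarith
  have key : ∀ s' : Vec n, c * ‖s' - s‖ ≤ 1 / 16 →
      -⟪s', x⟫_ℝ - F x ≤ conjugate K F s' ∧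
        conjugate K F s' ≤ -⟪s', x⟫_ℝ - F x + 2 * (c * ‖s' - s‖) ^ 2 := by
    intro s' hs'
    have hub : -⟪s', x⟫_ℝ - F x + 2 * (c * ‖s' - s‖) ^ 2 ∈
        upperBounds ((fun y : Vec n => -⟪s', y⟫_ℝ - F y) '' interior (K : Set (Vec n))) := by
      rintro _ ⟨y, hy, rfl⟩
      exact hF.conjugate_bound hx hg hs' (hdual s') hy
    exact ⟨le_csSup ⟨_, hub⟩ ⟨x, hx, rfl⟩, csSup_le ⟨_, x, hx, rfl⟩ hub⟩
  have hbig : (fun s' => conjugate K F s' + ⟪x, s'⟫_ℝ + F x) =O[nhds s]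
      fun s' => ‖s' - s‖ ^ 2 := by
    refine Asymptotics.IsBigO.of_bound (2 * c ^ 2) ?_
    have hcontn : Filter.Tendsto (fun s' => c * ‖s' - s‖) (nhds s) (nhds (c * ‖s - s‖)) :=
      Continuous.tendsto (by fun_prop) s
    rw [sub_self, norm_zero, mul_zero] at hcontn
    filter_upwards [hcontn.eventually (gt_mem_nhds (show (0 : ℝ) < 1 / 16 by norm_num))]
      with s' hs'
    obtain ⟨h₁, h₂⟩ := key s' hs'.le
    rw [real_inner_comm] at h₁ h₂
    rw [Real.norm_eq_abs, Real.norm_of_nonneg (by positivity), abs_le]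
    constructor <;> nlinarith [mul_nonneg (sq_nonneg c) (sq_nonneg ‖s' - s‖)]
  have h₁ := hbig.hasFDerivAt (𝕜 := ℝ) one_lt_two
  have h₂ := (h₁.sub (InnerProductSpace.toDual ℝ (Vec n) x).hasFDerivAt).sub_const (F x)
  rw [hasGradientAt_iff_hasFDerivAt, map_neg, ← zero_sub]
  refine h₂.congr_of_eventuallyEq (Filter.Eventually.of_forall fun s' => ?_)
  simp only [Pi.sub_apply, InnerProductSpace.toDual_apply_apply]
  ring

theorem xTilde_eq (hK : IsProper K) {s : Vec n}
    (hx : x ∈ interior (K : Set (Vec n))) (hg : gradient F x = -s) : xTilde K F s = x := by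
  rw [xTilde, (hF.hasGradientAt_conjugate hK hx hg).gradient, neg_neg]

theorem xTilde_mem (hK : IsProper K) {s : Vec n}
    (hs : s ∈ interior (dualCone K : Set (Vec n))) :
    xTilde K F s ∈ interior (K : Set (Vec n)) ∧ gradient F (xTilde K F s) = -s := by
  obtain ⟨y, hy, hg⟩ := hF.exists_gradient_eq_neg hK hs
  rw [hF.xTilde_eq hK hy hg]
  exact ⟨hy, hg⟩

end IsLHSCB

/-! ### The scaling matrix -/

/-- Relative errors `ω` in both factors and in the denominator perturb a rank-one form by `O(ω)`.
Applied twice, it compares the last two terms of `W` with the same model form, so that their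
difference is small. -/
theorem abs_rank_one_sub_le {A B α β q a ω U V : ℝ} (ha : 0 < a) (hω : 0 ≤ ω) (hω' : ω ≤ 1 / 10)
    (hU : 0 ≤ U) (hV : 0 ≤ V) (hA : |A| ≤ a * U) (hB : |B| ≤ a * V) (hα : |α| ≤ ω * (a * U))
    (hβ : |β| ≤ ω * (a * V)) (hq : |q - a ^ 2| ≤ ω * a ^ 2) :
    |(A + α) * (B + β) / q - A * B / a ^ 2| ≤ 4 * ω * (U * V) := by
  have ha2 : 0 < a ^ 2 := by positivity
  have hq' := abs_le.1 hq
  have hqpos : 0 < q := by nlinarith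
  have e : (A + α) * (B + β) / q - A * B / a ^ 2 =
      (A * β + α * B + α * β + A * B / a ^ 2 * (a ^ 2 - q)) / q := by
    field_simp; ring
  have hAU : 0 ≤ a * U := by positivity
  have hAV : 0 ≤ a * V := by positivity
  have h₁ : |A * β| ≤ ω * (a ^ 2 * (U * V)) := by
    rw [abs_mul]
    calc |A| * |β| ≤ (a * U) * (ω * (a * V)) := mul_le_mul hA hβ (abs_nonneg _) hAU
      _ = _ := by ring
  have h₂ : |α * B| ≤ ω * (a ^ 2 * (U * V)) := by
    rw [abs_mul]
    calc |α| * |B| ≤ (ω * (a * U)) * (a * V) := mul_le_mul hα hB (abs_nonneg _) (by positivity)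
      _ = _ := by ring
  have h₃ : |α * β| ≤ ω * (1 / 10) * (a ^ 2 * (U * V)) := by
    rw [abs_mul]
    calc |α| * |β| ≤ (ω * (a * U)) * (ω * (a * V)) :=
          mul_le_mul hα hβ (abs_nonneg _) (by positivity)
      _ = ω * ω * (a ^ 2 * (U * V)) := by ring
      _ ≤ _ := by gcongr
  have h₄ : |A * B / a ^ 2 * (a ^ 2 - q)| ≤ ω * (a ^ 2 * (U * V)) := by
    rw [abs_mul, abs_div, abs_mul, abs_of_pos ha2, abs_sub_comm]
    calc |A| * |B| / a ^ 2 * |q - a ^ 2| ≤ (a * U) * (a * V) / a ^ 2 * (ω * a ^ 2) := by gcongr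
      _ = _ := by field_simp
  rw [e, abs_div, abs_of_pos hqpos, div_le_iff₀ hqpos]
  calc |A * β + α * B + α * β + A * B / a ^ 2 * (a ^ 2 - q)|
      ≤ |A * β| + |α * B| + |α * β| + |A * B / a ^ 2 * (a ^ 2 - q)| :=
        (abs_add_le _ _).trans (add_le_add_left ((abs_add_le _ _).trans
          (add_le_add_left (abs_add_le _ _) _)) _)
    _ ≤ 3.1 * (ω * (a ^ 2 * (U * V))) := by linarith
    _ ≤ 4 * (ω * ((0.9 * a ^ 2) * (U * V))) := by
        have : 0 ≤ ω * (a ^ 2 * (U * V)) := by positivity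
        linarith
    _ ≤ 4 * (ω * (q * (U * V))) := by
        have : 0.9 * a ^ 2 ≤ q := by nlinarith
        gcongr
    _ = _ := by ring

/-- The scalar estimate behind `abs_inner_scaling_sub_le`. -/
theorem abs_scaling_terms_le {ν a g U V Su Sv Pu Pv fu fv : ℝ} (hν : 1 ≤ ν) (ha : 0 < a)
    (ha' : a ≤ 1 / 100) (hU : 0 ≤ U) (hV : 0 ≤ V) (hSu : |Su| ≤ Real.sqrt ν * U)
    (hSv : |Sv| ≤ Real.sqrt ν * V) (hPu : |Pu| ≤ a * U) (hPv : |Pv| ≤ a * V)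
    (hfu : |fu| ≤ 5 / 2 * a ^ 2 * U) (hfv : |fv| ≤ 5 / 2 * a ^ 2 * V)
    (hg : |g - a ^ 2| ≤ 5 / 2 * a ^ 3) :
    |(Su * (Pv + fv) + (Pu + fu) * Sv + (Pu + fu) * (Pv + fv)) / ν
      + (Pu + fu) * (Pv + fv) / g
      - (Pu + g / ν * Su) * (Pv + g / ν * Sv) / (a ^ 2 - g ^ 2 / ν)| ≤ 17 * a * (U * V) := by
  -- Everything is divided by `μ`: `S` stands for pairings with `s̃`, `P` for pairings with `F''δᴾ`,
  -- `f` for those with `δᴰ/μ - F''δᴾ`, and `g` for `⟨δᴾ, δᴰ⟩/μ`.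
  have hν0 : 0 < ν := by linarith
  have hsq : Real.sqrt ν ≤ ν := by
    rw [Real.sqrt_le_left hν0.le]; nlinarith
  have hUV : 0 ≤ U * V := by positivity
  have hg' := abs_le.1 hg
  have ha3 : a ^ 3 ≤ 1 / 100 * a ^ 2 := by nlinarith [sq_nonneg a]
  have ha2 : 0 < a ^ 2 := by positivity
  have hg0 : 0 < g := by linarith
  have hg1 : g ≤ 1.025 * a ^ 2 := by linarith
  have heu : |Pu + fu| ≤ 1.025 * a * U := by
    refine (abs_add_le _ _).trans ?_
    have : 5 / 2 * a ^ 2 * U ≤ 0.025 * a * U := by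
      apply mul_le_mul_of_nonneg_right _ hU; nlinarith
    linarith
  have hev : |Pv + fv| ≤ 1.025 * a * V := by
    refine (abs_add_le _ _).trans ?_
    have : 5 / 2 * a ^ 2 * V ≤ 0.025 * a * V := by
      apply mul_le_mul_of_nonneg_right _ hV; nlinarith
    linarith
  have t₁ : |(Su * (Pv + fv) + (Pu + fu) * Sv + (Pu + fu) * (Pv + fv)) / ν| ≤
      2.1 * a * (U * V) := by
    rw [abs_div, abs_of_pos hν0, div_le_iff₀ hν0]
    have h₁ : |Su * (Pv + fv)| ≤ 1.025 * a * (U * V) * ν := by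
      rw [abs_mul]
      calc |Su| * |Pv + fv| ≤ (Real.sqrt ν * U) * (1.025 * a * V) :=
            mul_le_mul hSu hev (abs_nonneg _) (by positivity)
        _ = 1.025 * a * (U * V) * Real.sqrt ν := by ring
        _ ≤ _ := by gcongr
    have h₂ : |(Pu + fu) * Sv| ≤ 1.025 * a * (U * V) * ν := by
      rw [abs_mul]
      calc |Pu + fu| * |Sv| ≤ (1.025 * a * U) * (Real.sqrt ν * V) :=
            mul_le_mul heu hSv (abs_nonneg _) (by positivity)
        _ = 1.025 * a * (U * V) * Real.sqrt ν := by ring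
        _ ≤ _ := by gcongr
    have h₃ : |(Pu + fu) * (Pv + fv)| ≤ 0.02 * a * (U * V) * ν := by
      rw [abs_mul]
      calc |Pu + fu| * |Pv + fv| ≤ (1.025 * a * U) * (1.025 * a * V) :=
            mul_le_mul heu hev (abs_nonneg _) (by positivity)
        _ = (1.050625 * a) * (a * (U * V) * 1) := by ring
        _ ≤ 0.02 * (a * (U * V) * ν) := by
            gcongr
            linarith
        _ = _ := by ring
    calc _ ≤ |Su * (Pv + fv)| + |(Pu + fu) * Sv| + |(Pu + fu) * (Pv + fv)| :=
          (abs_add_le _ _).trans (add_le_add_left (abs_add_le _ _) _)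
      _ ≤ _ := by
        have : 0 ≤ a * (U * V) * ν := by positivity
        linarith
  have t₂ := abs_rank_one_sub_le (A := Pu) (B := Pv) (α := fu) (β := fv) (q := g)
    (ω := 5 / 2 * a) ha (by positivity) (by linarith) hU hV hPu hPv
    (by convert hfu using 1; ring) (by convert hfv using 1; ring) (by convert hg using 1; ring)
  have hc : ∀ S W : ℝ, 0 ≤ W → |S| ≤ Real.sqrt ν * W → |g / ν * S| ≤ 1.1 * a * (a * W) := by
    intro S W hW hS
    rw [abs_mul, abs_of_pos (by positivity)]
    calc g / ν * |S| ≤ g / ν * (ν * W) := by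
          gcongr
          exact hS.trans (mul_le_mul_of_nonneg_right hsq hW)
      _ = g * W := by field_simp
      _ ≤ (1.1 * a ^ 2) * W := by
          apply mul_le_mul_of_nonneg_right _ hW; linarith
      _ = _ := by ring
  have t₃ := abs_rank_one_sub_le (A := Pu) (B := Pv) (α := g / ν * Su) (β := g / ν * Sv)
    (q := a ^ 2 - g ^ 2 / ν) (ω := 1.1 * a) ha (by positivity) (by linarith) hU hV hPu hPv
    (hc Su U hU hSu) (hc Sv V hV hSv) (by
      rw [sub_sub_cancel_left, abs_neg, abs_of_nonneg (by positivity), div_le_iff₀ hν0]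
      have h₁ : g ^ 2 ≤ 1.1 * a * a ^ 2 := by
        calc g ^ 2 ≤ (1.025 * a ^ 2) ^ 2 := by gcongr
          _ = 1.050625 * a * (a ^ 2 * a) := by ring
          _ ≤ 1.1 * a * (a ^ 2 * 1) := by gcongr <;> linarith
          _ = _ := by ring
      calc g ^ 2 ≤ 1.1 * a * a ^ 2 * 1 := by linarith
        _ ≤ _ := by gcongr)
  -- The three contributions are `2.1`, `4 · 5/2` and `4 · 1.1`, in total `16.5 ≤ 17`.
  rw [abs_le] at t₁ t₂ t₃ ⊢
  have : 0 ≤ a * (U * V) := by positivity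
  constructor <;> linarith [t₁.1, t₁.2, t₂.1, t₂.2, t₃.1, t₃.2]

/-! ### Shadow iterates, proximity vectors and the secant equations -/

section Shadow

variable {m n : ℕ} {K : ProperCone ℝ (Vec n)} {F : Vec n → ℝ} {ν : ℝ} (hF : IsLHSCB K F ν)
  (hK : IsProper K) (hν : 1 ≤ ν) {z : Point m n} (hx : z.x ∈ interior (K : Set (Vec n)))
  (hs : z.s ∈ interior (dualCone K : Set (Vec n)))

theorem sTilde_xTilde (hF : IsLHSCB K F ν) (hK : IsProper K)
    (hs : z.s ∈ interior (dualCone K : Set (Vec n))) : sTilde F (xTilde K F z.s) = z.s := by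
  rw [sTilde, (hF.xTilde_mem hK hs).2, neg_neg]

theorem inner_xTilde_s (hF : IsLHSCB K F ν) (hK : IsProper K)
    (hs : z.s ∈ interior (dualCone K : Set (Vec n))) : ⟪xTilde K F z.s, z.s⟫_ℝ = ν := by
  have := hF.inner_sTilde_self (hF.xTilde_mem hK hs).1
  rwa [sTilde_xTilde hF hK hs] at this

theorem inner_x_s (hν : 1 ≤ ν) : ⟪z.x, z.s⟫_ℝ = ν * mu ν z := by
  rw [mu]; field_simp

theorem inner_xTilde_sTilde (hν : 1 ≤ ν) :
    ⟪xTilde K F z.s, sTilde F z.x⟫_ℝ = ν * muTilde K F ν z := by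
  rw [muTilde]; field_simp

theorem inner_scaling (K : ProperCone ℝ (Vec n)) (F : Vec n → ℝ) (ν : ℝ) (z : Point m n)
    (u v : Vec n) :
    ⟪u, scaling K F ν z v⟫_ℝ = mu ν z * ⟪u, hessian F z.x v⟫_ℝ
      + 1 / (ν * mu ν z) * (⟪u, z.s⟫_ℝ * ⟪v, z.s⟫_ℝ)
      - mu ν z / ν * (⟪u, sTilde F z.x⟫_ℝ * ⟪v, sTilde F z.x⟫_ℝ)
      + 1 / ⟪deltaP K F ν z, deltaD F ν z⟫_ℝ * (⟪u, deltaD F ν z⟫_ℝ * ⟪v, deltaD F ν z⟫_ℝ)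
      - mu ν z / (localNorm F z.x (xTilde K F z.s) ^ 2 - ν * muTilde K F ν z ^ 2) *
        (⟪u, hessian F z.x (xTilde K F z.s) - muTilde K F ν z • sTilde F z.x⟫_ℝ *
         ⟪v, hessian F z.x (xTilde K F z.s) - muTilde K F ν z • sTilde F z.x⟫_ℝ) := by
  unfold scaling outer
  generalize hessian F z.x (xTilde K F z.s) - muTilde K F ν z • sTilde F z.x = w
  simp only [sub_apply, add_apply, smul_apply,
    InnerProductSpace.rankOne_apply, inner_add_right, inner_sub_right, inner_smul_right]
  rw [real_inner_comm v z.s, real_inner_comm v (sTilde F z.x), real_inner_comm v (deltaD F ν z),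
    real_inner_comm v w]
  ring

include hF hK hν in
theorem inner_sTilde_pos {x y : Vec n} (hx : x ∈ interior (K : Set (Vec n)))
    (hy : y ∈ interior (K : Set (Vec n))) : 0 < ⟪y, sTilde F x⟫_ℝ := by
  refine lt_of_lt_of_le ?_ (hF.localNorm_le_inner_sTilde (by linarith) hx (interior_subset hy))
  have : 0 < localNorm F x y := by
    refine (localNorm_nonneg F x y).lt_of_ne' fun h => ?_
    have h0 := hF.eq_zero_of_localNorm_eq_zero hK hx h
    have := hF.localNorm_self_sq hy
    rw [h0, localNorm_eq_qnorm, qnorm_zero] at this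
    linarith
  positivity

include hF hK hν hx hs

theorem mu_pos : 0 < mu ν z := by
  have := inner_sTilde_pos hF hK hν (hF.xTilde_mem hK hs).1 hx
  rw [sTilde_xTilde hF hK hs] at this
  exact div_pos this (by linarith)

theorem muTilde_pos : 0 < muTilde K F ν z :=
  div_pos (inner_sTilde_pos hF hK hν hx (hF.xTilde_mem hK hs).1) (by linarith)

/-- This identity links the proximity measure to `μ μ̃`, hence to (A4). -/
theorem inner_deltaP_deltaD :
    ⟪deltaP K F ν z, deltaD F ν z⟫_ℝ = ν * mu ν z * (mu ν z * muTilde K F ν z - 1) := by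
  simp only [deltaP, deltaD, inner_sub_left, inner_sub_right, inner_smul_left, inner_smul_right,
    conj_trivial]
  rw [inner_x_s hν, hF.inner_sTilde_self hx, inner_xTilde_s hF hK hs, inner_xTilde_sTilde hν]
  ring

/-- By homogeneity `-δᴰ` is the increment of `F'` from `μ⁻¹x` to `x̃ = μ⁻¹x - μ⁻¹δᴾ`, so the Taylor
estimate at `μ⁻¹x` gives `δᴰ ≈ μ F''(x) δᴾ`. -/
theorem abs_inner_deltaD_sub_le (ha : localNorm F z.x (deltaP K F ν z) ≤ 1 / 10) (v : Vec n) :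
    |⟪v, deltaD F ν z - mu ν z • hessian F z.x (deltaP K F ν z)⟫_ℝ| ≤
      5 / 2 * localNorm F z.x (deltaP K F ν z) ^ 2 * (mu ν z * localNorm F z.x v) := by
  have hμ := mu_pos hF hK hν hx hs
  set μ := mu ν z with hμdef
  set p := deltaP K F ν z with hp
  have hμi : 0 < μ⁻¹ := inv_pos.2 hμ
  have hn : localNorm F (μ⁻¹ • z.x) (-(μ⁻¹ • p)) = localNorm F z.x p := by
    rw [hF.localNorm_smul_base hx hμi, inv_inv, ← neg_smul, localNorm_smul, abs_neg,
      abs_of_pos hμi, ← mul_assoc, mul_inv_cancel₀ hμ.ne', one_mul]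
  have h := hF.abs_inner_gradient_sub_le hK (smul_mem_interior hx hμi) (h := -(μ⁻¹ • p))
    (by rw [hn]; exact ha) v
  have hxt : μ⁻¹ • z.x + -(μ⁻¹ • p) = xTilde K F z.s := by
    rw [hp, deltaP, smul_sub, smul_smul, ← hμdef, inv_mul_cancel₀ hμ.ne', one_smul]; abel
  rw [hn, hxt, (hF.xTilde_mem hK hs).2, hF.gradient_smul hx hμi, hF.hessian_smul hx hμi,
    hF.localNorm_smul_base hx hμi, inv_inv] at h
  have he : -z.s - μ • gradient F z.x - (μ * μ) • hessian F z.x (-(μ⁻¹ • p)) =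
      -(deltaD F ν z - μ • hessian F z.x p) := by
    rw [map_neg, map_smul, smul_neg, smul_smul, mul_assoc, mul_inv_cancel₀ hμ.ne', mul_one,
      deltaD, sTilde, ← hμdef]
    module
  rwa [he, inner_neg_right, abs_neg] at h

theorem abs_inner_deltaD_le (ha : localNorm F z.x (deltaP K F ν z) ≤ 1 / 100) (v : Vec n) :
    |⟪v, deltaD F ν z⟫_ℝ| ≤
      41 / 40 * localNorm F z.x (deltaP K F ν z) * (mu ν z * localNorm F z.x v) := by
  have hμ := mu_pos hF hK hν hx hs
  have h₁ := abs_inner_deltaD_sub_le hF hK hν hx hs (ha.trans (by norm_num)) v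
  have h₂ := (hF.isPSD hx).abs_inner_le v (deltaP K F ν z)
  rw [← localNorm_eq_qnorm, ← localNorm_eq_qnorm] at h₂
  have h₃ : ⟪v, deltaD F ν z⟫_ℝ =
      ⟪v, deltaD F ν z - mu ν z • hessian F z.x (deltaP K F ν z)⟫_ℝ +
      mu ν z * ⟪v, hessian F z.x (deltaP K F ν z)⟫_ℝ := by
    rw [inner_sub_right, inner_smul_right]; ring
  rw [h₃]
  refine (abs_add_le _ _).trans ?_
  rw [abs_mul, abs_of_pos hμ]
  set a := localNorm F z.x (deltaP K F ν z)
  set V := localNorm F z.x v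
  have ha0 : 0 ≤ a := localNorm_nonneg _ _ _
  have hV : 0 ≤ mu ν z * V := mul_nonneg hμ.le (localNorm_nonneg _ _ _)
  have h₄ := mul_le_mul_of_nonneg_left h₂ hμ.le
  have h₅ : a ^ 2 * (mu ν z * V) ≤ 1 / 100 * a * (mu ν z * V) := by
    apply mul_le_mul_of_nonneg_right _ hV; nlinarith
  linarith

theorem deltaD_eq_zero (ha : localNorm F z.x (deltaP K F ν z) = 0) : deltaD F ν z = 0 := by
  have := abs_inner_deltaD_le hF hK hν hx hs (by rw [ha]; norm_num) (deltaD F ν z)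
  rw [ha, mul_zero, zero_mul] at this
  exact inner_self_eq_zero.1 (abs_nonpos_iff.1 this)

theorem inner_deltaP_deltaD_bound (ha : localNorm F z.x (deltaP K F ν z) ≤ 1 / 10) :
    |⟪deltaP K F ν z, deltaD F ν z⟫_ℝ / mu ν z - localNorm F z.x (deltaP K F ν z) ^ 2| ≤
      5 / 2 * localNorm F z.x (deltaP K F ν z) ^ 3 := by
  have hμ := mu_pos hF hK hν hx hs
  have h := abs_inner_deltaD_sub_le hF hK hν hx hs ha (deltaP K F ν z)
  rw [inner_sub_right, inner_smul_right, ← hF.localNorm_sq hx] at h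
  set a := localNorm F z.x (deltaP K F ν z)
  have e : ⟪deltaP K F ν z, deltaD F ν z⟫_ℝ / mu ν z - a ^ 2 =
      (⟪deltaP K F ν z, deltaD F ν z⟫_ℝ - mu ν z * a ^ 2) / mu ν z := by field_simp
  rw [e, abs_div, abs_of_pos hμ, div_le_iff₀ hμ]
  linarith

/-- Shows `μ w ≈ -F''(x) δᴾ` for small `δᴾ`, as the coefficient of `s̃` is of second order. This is
why the term with `w` nearly cancels the one with `δᴰ`. -/
theorem mu_smul_w :
    mu ν z • (hessian F z.x (xTilde K F z.s) - muTilde K F ν z • sTilde F z.x) =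
      -(hessian F z.x (deltaP K F ν z)
        + (⟪deltaP K F ν z, deltaD F ν z⟫_ℝ / mu ν z / ν) • sTilde F z.x) := by
  have hμ := mu_pos hF hK hν hx hs
  rw [inner_deltaP_deltaD hF hK hν hx hs, deltaP, map_sub, map_smul, hF.hessian_self hx]
  change _ = -(sTilde F z.x - _ + _)
  rw [show ν * mu ν z * (mu ν z * muTilde K F ν z - 1) / mu ν z / ν =
    mu ν z * muTilde K F ν z - 1 by field_simp]
  module

omit hK hs in
theorem inner_w_xTilde :
    ⟪hessian F z.x (xTilde K F z.s) - muTilde K F ν z • sTilde F z.x, xTilde K F z.s⟫_ℝ =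
      localNorm F z.x (xTilde K F z.s) ^ 2 - ν * muTilde K F ν z ^ 2 := by
  rw [hF.localNorm_sq hx, inner_sub_left, inner_smul_left, real_inner_comm,
    real_inner_comm _ (sTilde F z.x), inner_xTilde_sTilde hν, conj_trivial]
  ring

theorem mu_sq_mul_denominator :
    mu ν z ^ 2 * (localNorm F z.x (xTilde K F z.s) ^ 2 - ν * muTilde K F ν z ^ 2) =
      localNorm F z.x (deltaP K F ν z) ^ 2
        - (⟪deltaP K F ν z, deltaD F ν z⟫_ℝ / mu ν z) ^ 2 / ν := by
  have hμ := mu_pos hF hK hν hx hs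
  have h₁ : ⟪z.x, hessian F z.x (xTilde K F z.s)⟫_ℝ = ν * muTilde K F ν z := by
    rw [hF.hessian_symm hx, hF.hessian_self hx, ← inner_xTilde_sTilde hν]; rfl
  have h₂ : ⟪xTilde K F z.s, hessian F z.x z.x⟫_ℝ = ν * muTilde K F ν z := by
    rw [hF.hessian_symm hx, h₁]
  rw [inner_deltaP_deltaD hF hK hν hx hs, hF.localNorm_sq hx, hF.localNorm_sq hx]
  simp only [deltaP, map_sub, map_smul, inner_sub_left, inner_sub_right, inner_smul_left,
    inner_smul_right, conj_trivial]
  rw [h₁, h₂, ← hF.localNorm_sq hx z.x, hF.localNorm_self_sq hx]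
  field_simp
  ring

/-- Both `δᴰ` and `w` are orthogonal to `x`, and `F''(x)x = s̃` makes the first and third terms
cancel. Only the contribution of `s sᵀ` remains. -/
theorem scaling_apply_x : scaling K F ν z z.x = z.s := by
  have hμ := mu_pos hF hK hν hx hs
  have h₁ : ⟪deltaD F ν z, z.x⟫_ℝ = 0 := by
    rw [deltaD, inner_sub_left, inner_smul_left, real_inner_comm, real_inner_comm z.x,
      hF.inner_sTilde_self hx, inner_x_s hν, conj_trivial]
    ring
  have h₂ : ⟪hessian F z.x (xTilde K F z.s) - muTilde K F ν z • sTilde F z.x, z.x⟫_ℝ = 0 := by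
    rw [inner_sub_left, inner_smul_left, real_inner_comm, real_inner_comm z.x,
      hF.inner_sTilde_self hx, hF.hessian_symm hx, hF.hessian_self hx]
    change ⟪xTilde K F z.s, sTilde F z.x⟫_ℝ - _ = 0
    rw [inner_xTilde_sTilde hν, conj_trivial]
    ring
  simp only [scaling, outer, sub_apply, add_apply, smul_apply,
    InnerProductSpace.rankOne_apply, h₁, h₂]
  rw [real_inner_comm, real_inner_comm z.x (sTilde F z.x), inner_x_s hν, hF.inner_sTilde_self hx,
    hF.hessian_self hx, smul_smul, smul_smul, one_div_mul_cancel (by positivity),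
    div_mul_cancel₀ _ (by positivity)]
  change mu ν z • sTilde F z.x + _ - _ + _ - _ = _
  module

/-- The error of the approximation `W ≈ μ F''(x)`. -/
theorem abs_inner_scaling_sub_le (ha : localNorm F z.x (deltaP K F ν z) ≤ 1 / 100)
    (u v : Vec n) :
    |⟪u, scaling K F ν z v⟫_ℝ - mu ν z * ⟪u, hessian F z.x v⟫_ℝ| ≤
      17 * localNorm F z.x (deltaP K F ν z) * mu ν z *
        (localNorm F z.x u * localNorm F z.x v) := by
  have hμ := mu_pos hF hK hν hx hs
  have hν0 : 0 < ν := by linarith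
  have hden := mu_sq_mul_denominator hF hK hν hx hs
  have hw := mu_smul_w hF hK hν hx hs
  have hgb := inner_deltaP_deltaD_bound hF hK hν hx hs (ha.trans (by norm_num))
  have hf : ∀ v, |⟪v, deltaD F ν z⟫_ℝ / mu ν z - ⟪v, hessian F z.x (deltaP K F ν z)⟫_ℝ| ≤
      5 / 2 * localNorm F z.x (deltaP K F ν z) ^ 2 * localNorm F z.x v := by
    intro v
    have h := abs_inner_deltaD_sub_le hF hK hν hx hs (ha.trans (by norm_num)) v
    rw [inner_sub_right, inner_smul_right] at h
    have e : ⟪v, deltaD F ν z⟫_ℝ / mu ν z - ⟪v, hessian F z.x (deltaP K F ν z)⟫_ℝ =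
      (⟪v, deltaD F ν z⟫_ℝ - mu ν z * ⟪v, hessian F z.x (deltaP K F ν z)⟫_ℝ) / mu ν z := by
      field_simp
    rw [e, abs_div, abs_of_pos hμ, div_le_iff₀ hμ]
    linarith
  have hP : ∀ v, |⟪v, hessian F z.x (deltaP K F ν z)⟫_ℝ| ≤
      localNorm F z.x (deltaP K F ν z) * localNorm F z.x v := fun v => by
    have := (hF.isPSD hx).abs_inner_le v (deltaP K F ν z)
    rwa [mul_comm] at this
  have hS : ∀ v, |⟪v, sTilde F z.x⟫_ℝ| ≤ Real.sqrt ν * localNorm F z.x v := fun v => by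
    have := (hF.isPSD hx).abs_inner_le v z.x
    rw [← localNorm_eq_qnorm, ← localNorm_eq_qnorm, hF.localNorm_self hx, hF.hessian_self hx,
      mul_comm] at this
    exact this
  -- The vector of the outer product gets its own name so that `s = μ s̃ + δᴰ` is substituted there
  -- and not inside `μ`, `x̃` or `δᴾ`.
  have hexp : ∀ s : Vec n, s = z.s → ⟪u, scaling K F ν z v⟫_ℝ - mu ν z * ⟪u, hessian F z.x v⟫_ℝ =
      1 / (ν * mu ν z) * (⟪u, s⟫_ℝ * ⟪v, s⟫_ℝ)
      - mu ν z / ν * (⟪u, sTilde F z.x⟫_ℝ * ⟪v, sTilde F z.x⟫_ℝ)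
      + 1 / ⟪deltaP K F ν z, deltaD F ν z⟫_ℝ * (⟪u, deltaD F ν z⟫_ℝ * ⟪v, deltaD F ν z⟫_ℝ)
      - mu ν z / (localNorm F z.x (xTilde K F z.s) ^ 2 - ν * muTilde K F ν z ^ 2) *
        (⟪u, hessian F z.x (xTilde K F z.s) - muTilde K F ν z • sTilde F z.x⟫_ℝ *
         ⟪v, hessian F z.x (xTilde K F z.s) - muTilde K F ν z • sTilde F z.x⟫_ℝ) := by
    rintro _ rfl
    rw [inner_scaling]
    ring
  have hsplit : z.s = mu ν z • sTilde F z.x + deltaD F ν z := by rw [deltaD]; abel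
  rw [hexp _ hsplit.symm]
  have hw' : ∀ v, ⟪v, hessian F z.x (xTilde K F z.s) - muTilde K F ν z • sTilde F z.x⟫_ℝ =
      -(⟪v, hessian F z.x (deltaP K F ν z)⟫_ℝ +
        ⟪deltaP K F ν z, deltaD F ν z⟫_ℝ / mu ν z / ν * ⟪v, sTilde F z.x⟫_ℝ) / mu ν z := by
    intro v
    have := congrArg (fun y => ⟪v, y⟫_ℝ) hw
    simp only [inner_smul_right, inner_neg_right, inner_add_right] at this
    rw [← this]
    field_simp
  rw [hw', hw']
  simp only [inner_add_right, inner_smul_right]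
  have hfu := hf u
  have hfv := hf v
  have hPu := hP u
  have hPv := hP v
  have hSu := hS u
  have hSv := hS v
  have hU := localNorm_nonneg F z.x u
  have hV := localNorm_nonneg F z.x v
  have hD0 := deltaD_eq_zero hF hK hν hx hs
  generalize localNorm F z.x (xTilde K F z.s) ^ 2 - ν * muTilde K F ν z ^ 2 = den at *
  set a := localNorm F z.x (deltaP K F ν z) with hadef
  have ha0 : 0 ≤ a := localNorm_nonneg _ _ _
  clear_value a
  generalize hPu' : ⟪u, hessian F z.x (deltaP K F ν z)⟫_ℝ = Pu at *
  generalize hPv' : ⟪v, hessian F z.x (deltaP K F ν z)⟫_ℝ = Pv at *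
  generalize ⟪u, sTilde F z.x⟫_ℝ = Su at *
  generalize ⟪v, sTilde F z.x⟫_ℝ = Sv at *
  generalize localNorm F z.x u = U at *
  generalize localNorm F z.x v = V at *
  -- If `δᴾ = 0`, the numerators of the last two terms vanish, so their zero denominators do no
  -- harm. Otherwise both denominators are positive.
  rcases ha0.eq_or_lt with h0 | hpos
  · have hd := hD0 h0.symm
    subst h0
    rw [hd]
    have hPu0 : Pu = 0 := by simpa using hPu
    have hPv0 : Pv = 0 := by simpa using hPv
    rw [hPu0, hPv0]
    simp only [inner_zero_right]
    rw [show 1 / (ν * mu ν z) * ((mu ν z * Su + 0) * (mu ν z * Sv + 0)) = mu ν z / ν * (Su * Sv) by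
      field_simp; ring]
    simp
  · have hg0 : 0 < ⟪deltaP K F ν z, deltaD F ν z⟫_ℝ / mu ν z := by
      have := (abs_le.1 hgb).1
      nlinarith [mul_pos hpos hpos]
    generalize hG : ⟪deltaP K F ν z, deltaD F ν z⟫_ℝ = G at *
    generalize ⟪u, deltaD F ν z⟫_ℝ = Du at *
    generalize ⟪v, deltaD F ν z⟫_ℝ = Dv at *
    generalize mu ν z = μ at *
    have key := abs_scaling_terms_le hν hpos ha hU hV hSu hSv hPu hPv hfu hfv hgb
    obtain ⟨g, rfl⟩ : ∃ g, G = μ * g := ⟨G / μ, by field_simp⟩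
    rw [mul_div_cancel_left₀ _ hμ.ne'] at key hden hg0 hgb
    have hdpos : 0 < a ^ 2 - g ^ 2 / ν := by
      have h₁ : g ^ 2 / ν ≤ g ^ 2 := div_le_self (sq_nonneg g) hν
      have h₂ := (abs_le.1 hgb).2
      have h₃ : g < a := by nlinarith [mul_pos hpos hpos]
      nlinarith
    have hden' : den = (a ^ 2 - g ^ 2 / ν) / μ ^ 2 := by
      rw [← hden]; field_simp
    rw [hden', mul_div_cancel_left₀ _ hμ.ne']
    have hfin := mul_le_mul_of_nonneg_left key hμ.le
    rw [← abs_of_pos hμ, ← abs_mul, abs_of_pos hμ] at hfin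
    refine le_trans (le_of_eq ?_) (hfin.trans_eq (by ring))
    congr 1
    obtain ⟨q, hq⟩ : ∃ q, q = a ^ 2 - g ^ 2 / ν := ⟨_, rfl⟩
    rw [← hq] at hdpos ⊢
    have : Pu + (Du / μ - Pu) = Du / μ := by ring
    rw [this, show Pv + (Dv / μ - Pv) = Dv / μ by ring]
    field_simp
    ring

theorem scaling_isPSD (ha : localNorm F z.x (deltaP K F ν z) ≤ 1 / 100) :
    IsPSD (scaling K F ν z) := by
  have hμ := mu_pos hF hK hν hx hs
  constructor
  · intro u v
    rw [inner_scaling, inner_scaling, hF.hessian_symm hx u v]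
    ring
  · intro v
    have h := (abs_le.1 (abs_inner_scaling_sub_le hF hK hν hx hs ha v v)).1
    rw [← hF.localNorm_sq hx] at h
    have h₂ : 0 ≤ mu ν z * localNorm F z.x v ^ 2 := by positivity
    nlinarith

theorem qnorm_scaling_bounds (ha : localNorm F z.x (deltaP K F ν z) ≤ 1 / 100) (v : Vec n) :
    (1 - 17 * localNorm F z.x (deltaP K F ν z)) * (mu ν z * localNorm F z.x v ^ 2) ≤
        qnorm (scaling K F ν z) v ^ 2 ∧
      qnorm (scaling K F ν z) v ^ 2 ≤
        (1 + 17 * localNorm F z.x (deltaP K F ν z)) * (mu ν z * localNorm F z.x v ^ 2) := by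
  have h := abs_le.1 (abs_inner_scaling_sub_le hF hK hν hx hs ha v v)
  rw [← hF.localNorm_sq hx] at h
  rw [(scaling_isPSD hF hK hν hx hs ha).qnorm_sq]
  constructor <;> linarith [h.1, h.2]

/-- Pairing with `x̃` reproduces the two denominators, up to the factor `-1/μ` for `δᴰ`, so the last
two terms contribute `-δᴰ/μ` and `-μ w`; the rest telescopes to `s̃`. Smallness of `δᴾ` keeps the
denominators nonzero; if `δᴾ = 0`, then `x = μ x̃` and `s = μ s̃` reduce the claim to `W x = s`. -/
theorem scaling_apply_xTilde (ha : localNorm F z.x (deltaP K F ν z) ≤ 1 / 100) :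
    scaling K F ν z (xTilde K F z.s) = sTilde F z.x := by
  have hμ := mu_pos hF hK hν hx hs
  rcases (localNorm_nonneg F z.x (deltaP K F ν z)).eq_or_lt with h0 | hpos
  · have hD : z.s = mu ν z • sTilde F z.x := by
      have := deltaD_eq_zero hF hK hν hx hs h0.symm
      rw [deltaD] at this
      exact sub_eq_zero.1 this
    have hp : z.x = mu ν z • xTilde K F z.s :=
      sub_eq_zero.1 (hF.eq_zero_of_localNorm_eq_zero hK hx h0.symm)
    have hW := scaling_apply_x hF hK hν hx hs
    have h₁ : mu ν z • scaling K F ν z (xTilde K F z.s) = mu ν z • sTilde F z.x := by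
      rw [← map_smul, ← hp, hW]
      exact hD
    exact smul_right_injective _ hμ.ne' h₁
  have hgb := (abs_le.1
    (inner_deltaP_deltaD_bound hF hK hν hx hs (ha.trans (by norm_num))))
  have hden := mu_sq_mul_denominator hF hK hν hx hs
  set a := localNorm F z.x (deltaP K F ν z)
  have hg0 : 0 < ⟪deltaP K F ν z, deltaD F ν z⟫_ℝ / mu ν z := by
    nlinarith [mul_pos hpos hpos]
  have hg0' : ⟪deltaP K F ν z, deltaD F ν z⟫_ℝ ≠ 0 := fun h => by simp [h] at hg0
  have hd0 : localNorm F z.x (xTilde K F z.s) ^ 2 - ν * muTilde K F ν z ^ 2 ≠ 0 := by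
    intro h
    rw [h, mul_zero] at hden
    set g := ⟪deltaP K F ν z, deltaD F ν z⟫_ℝ / mu ν z
    have h₁ : g ^ 2 / ν ≤ g ^ 2 := div_le_self (sq_nonneg g) hν
    have h₃ : g < a := by nlinarith [mul_pos hpos hpos]
    nlinarith
  have h₁ : ⟪deltaD F ν z, xTilde K F z.s⟫_ℝ =
      -(1 / mu ν z) * ⟪deltaP K F ν z, deltaD F ν z⟫_ℝ := by
    rw [inner_deltaP_deltaD hF hK hν hx hs, deltaD, inner_sub_left, inner_smul_left,
      real_inner_comm, real_inner_comm _ (sTilde F z.x), inner_xTilde_s hF hK hs,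
      inner_xTilde_sTilde hν, conj_trivial]
    field_simp
    ring
  have h₂ := inner_w_xTilde hF hν hx
  have hν0 : ν ≠ 0 := by linarith
  simp only [scaling, outer, sub_apply, add_apply, smul_apply,
    InnerProductSpace.rankOne_apply, h₁, h₂]
  rw [real_inner_comm, real_inner_comm _ (sTilde F z.x), inner_xTilde_s hF hK hs,
    inner_xTilde_sTilde hν]
  simp only [smul_smul]
  rw [div_mul_cancel₀ _ hd0, show 1 / ⟪deltaP K F ν z, deltaD F ν z⟫_ℝ *
    (-(1 / mu ν z) * ⟪deltaP K F ν z, deltaD F ν z⟫_ℝ) = -(1 / mu ν z) by field_simp,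
    show 1 / (ν * mu ν z) * ν = 1 / mu ν z by field_simp,
    show mu ν z / ν * (ν * muTilde K F ν z) = mu ν z * muTilde K F ν z by field_simp, deltaD]
  have : (-(1 / mu ν z)) • (z.s - mu ν z • sTilde F z.x) =
      -((1 / mu ν z) • z.s) + sTilde F z.x := by
    rw [smul_sub, smul_smul, show -(1 / mu ν z) * mu ν z = -1 by field_simp]
    module
  rw [this]
  module

end Shadow

/-! ### The homogeneous model -/

section LinearAlgebra

variable {m n : ℕ}

namespace Point

@[simp] theorem add_y (z w : Point m n) : (z + w).y = z.y + w.y := rfl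
@[simp] theorem add_x (z w : Point m n) : (z + w).x = z.x + w.x := rfl
@[simp] theorem add_τ (z w : Point m n) : (z + w).τ = z.τ + w.τ := rfl
@[simp] theorem add_s (z w : Point m n) : (z + w).s = z.s + w.s := rfl
@[simp] theorem add_κ (z w : Point m n) : (z + w).κ = z.κ + w.κ := rfl
@[simp] theorem smul_y (a : ℝ) (z : Point m n) : (a • z).y = a • z.y := rfl
@[simp] theorem smul_x (a : ℝ) (z : Point m n) : (a • z).x = a • z.x := rfl
@[simp] theorem smul_τ (a : ℝ) (z : Point m n) : (a • z).τ = a * z.τ := rfl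
@[simp] theorem smul_s (a : ℝ) (z : Point m n) : (a • z).s = a • z.s := rfl
@[simp] theorem smul_κ (a : ℝ) (z : Point m n) : (a • z).κ = a * z.κ := rfl

end Point

theorem inner_toEuclideanLin_transpose (A : Matrix (Fin m) (Fin n) ℝ) (x : Vec n) (y : Vec m) :
    ⟪Matrix.toEuclideanLin A x, y⟫_ℝ = ⟪x, Matrix.toEuclideanLin A.transpose y⟫_ℝ := by
  rw [← Matrix.conjTranspose_eq_transpose_of_trivial,
    Matrix.toEuclideanLin_conjTranspose_eq_adjoint, LinearMap.adjoint_inner_right]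

namespace ConicProgram

variable (P : ConicProgram m n)

theorem G_add (z w : Point m n) : P.G (z + w) = P.G z + P.G w := by
  simp only [G, Point.add_y, Point.add_x, Point.add_τ, Point.add_s, Point.add_κ, map_add,
    add_smul, inner_add_right, ← WithLp.toLp_add, Prod.mk_add_mk]
  congr 2
  · abel
  · congr 2
    · abel
    · ring

theorem G_smul (a : ℝ) (z : Point m n) : P.G (a • z) = a • P.G z := by
  simp only [G, Point.smul_y, Point.smul_x, Point.smul_τ, Point.smul_s, Point.smul_κ, map_smul,
    inner_smul_right, ← WithLp.toLp_smul, Prod.smul_mk, smul_eq_mul]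
  congr 2
  · module
  · congr 2
    · module
    · ring

theorem G_eq_zero_iff (d : Point m n) : P.G d = 0 ↔
    Matrix.toEuclideanLin P.A d.x = d.τ • P.b ∧
      d.s = -Matrix.toEuclideanLin P.A.transpose d.y + d.τ • P.c ∧
      d.κ = ⟪P.b, d.y⟫_ℝ - ⟪P.c, d.x⟫_ℝ := by
  rw [G, WithLp.toLp_eq_zero, Prod.mk_eq_zero, WithLp.toLp_eq_zero (V := Vec n × ℝ),
    Prod.mk_eq_zero, sub_eq_zero, sub_eq_zero, sub_eq_zero, eq_comm (b := d.s), eq_comm (b := d.κ)]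

/-- Skew-symmetry of the homogeneous model. -/
theorem inner_add_mul_eq_zero {d : Point m n} (hd : P.G d = 0) :
    ⟪d.x, d.s⟫_ℝ + d.τ * d.κ = 0 := by
  obtain ⟨h₁, h₂, h₃⟩ := (P.G_eq_zero_iff d).1 hd
  rw [h₂, h₃, inner_add_right, inner_neg_right, ← inner_toEuclideanLin_transpose, h₁,
    inner_smul_left, inner_smul_right, real_inner_comm, conj_trivial, real_inner_comm P.c]
  ring

end ConicProgram

/-- The compression of `M` to `N` is injective by definiteness, hence onto in finite dimension. `M`
need not be symmetric. -/
theorem exists_mem_sub_mem_orthogonal {E : Type*} [NormedAddCommGroup E] [InnerProductSpace ℝ E]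
    [FiniteDimensional ℝ E] (N : Submodule ℝ E) (M : E →ₗ[ℝ] E)
    (hM : ∀ u ∈ N, ⟪u, M u⟫_ℝ = 0 → u = 0) (r : E) : ∃ u ∈ N, M u - r ∈ Nᗮ := by
  let f : N →ₗ[ℝ] N := (N.orthogonalProjectionOnto.toLinearMap ∘ₗ M) ∘ₗ N.subtype
  have hinj : Function.Injective f := by
    rw [injective_iff_map_eq_zero]
    intro u hu
    have h₁ : M u ∈ Nᗮ := N.orthogonalProjectionOnto_eq_zero_iff.1 hu
    exact Subtype.ext (hM u u.2 ((Submodule.mem_orthogonal _ _).1 h₁ u u.2))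
  obtain ⟨u, hu⟩ := LinearMap.injective_iff_surjective.1 hinj (N.orthogonalProjectionOnto r)
  refine ⟨u, u.2, ?_⟩
  rw [← N.orthogonalProjectionOnto_eq_zero_iff, map_sub, sub_eq_zero]
  exact hu

/-- Solvability of the systems that define the search directions. -/
theorem ConicProgram.exists_direction (P : ConicProgram m n) {W : Vec n →L[ℝ] Vec n}
    (hW : IsPSD W) (hdef : ∀ v : Vec n, ⟪v, W v⟫_ℝ = 0 → v = 0) {τ κ : ℝ} (hτ : 0 < τ)
    (hκ : 0 < κ) (r : Vec n) (ρ : ℝ) :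
    ∃ d : Point m n, P.G d = 0 ∧ τ * d.κ + κ * d.τ = ρ ∧ W d.x + d.s = r := by
  -- After elimination of `s` and `κ` the unknown is `(x, τ)` in the kernel of `T`, the primal
  -- equation. `M` is a positive definite part plus a skew part coming from `c`.
  let T : WithLp 2 (Vec n × ℝ) →ₗ[ℝ] Vec m :=
    { toFun := fun u => Matrix.toEuclideanLin P.A u.fst - u.snd • P.b
      map_add' := fun u v => by
        simp only [WithLp.add_fst, WithLp.add_snd, map_add, add_smul]; abel
      map_smul' := fun a u => by
        simp only [WithLp.smul_fst, WithLp.smul_snd, map_smul, smul_eq_mul, RingHom.id_apply]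
        module }
  let M : WithLp 2 (Vec n × ℝ) →ₗ[ℝ] WithLp 2 (Vec n × ℝ) :=
    { toFun := fun u =>
        WithLp.toLp 2 (W u.fst + u.snd • P.c, -⟪P.c, u.fst⟫_ℝ + κ / τ * u.snd)
      map_add' := fun u v => by
        simp only [WithLp.add_fst, WithLp.add_snd, map_add, add_smul, inner_add_right,
          ← WithLp.toLp_add, Prod.mk_add_mk]
        congr 2
        · abel
        · ring
      map_smul' := fun a u => by
        simp only [WithLp.smul_fst, WithLp.smul_snd, map_smul, smul_eq_mul, RingHom.id_apply,
          inner_smul_right, ← WithLp.toLp_smul, Prod.smul_mk]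
        congr 2
        · module
        · ring }
  have hM : ∀ u ∈ LinearMap.ker T, ⟪u, M u⟫_ℝ = 0 → u = 0 := by
    intro u _ hu
    have h₁ : ⟪u, M u⟫_ℝ = ⟪u.fst, W u.fst⟫_ℝ + κ / τ * u.snd ^ 2 := by
      change ⟪u, WithLp.toLp 2 (W u.fst + u.snd • P.c, -⟪P.c, u.fst⟫_ℝ + κ / τ * u.snd)⟫_ℝ = _
      rw [WithLp.prod_inner_apply]
      change ⟪u.fst, W u.fst + u.snd • P.c⟫_ℝ + ⟪u.snd, -⟪P.c, u.fst⟫_ℝ + κ / τ * u.snd⟫_ℝ = _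
      rw [inner_add_right, inner_smul_right, RCLike.inner_apply, conj_trivial]
      rw [real_inner_comm u.fst P.c]
      ring
    have h₂ := hW.nonneg u.fst
    have h₃ : 0 ≤ κ / τ * u.snd ^ 2 := by positivity
    have h₄ : u.fst = 0 := hdef _ (by linarith)
    have h₅ : u.snd = 0 := by
      have : κ / τ * u.snd ^ 2 = 0 := by linarith
      simpa [hτ.ne', hκ.ne'] using this
    rw [← WithLp.ofLp_eq_zero]
    exact Prod.ext h₄ h₅
  obtain ⟨u, hu, hort⟩ := exists_mem_sub_mem_orthogonal (LinearMap.ker T) M hM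
    (WithLp.toLp 2 (r, ρ / τ))
  -- The defect is orthogonal to `ker T`, so it lies in the range of the adjoint of `T`. The
  -- multiplier found there is `y`.
  rw [LinearMap.orthogonal_ker] at hort
  obtain ⟨y, hy⟩ := hort
  have hy' : ∀ w, ⟪w, M u - WithLp.toLp 2 (r, ρ / τ)⟫_ℝ = ⟪T w, y⟫_ℝ := fun w => by
    rw [← hy, LinearMap.adjoint_inner_right]
  have e₁ : W u.fst + u.snd • P.c - r = Matrix.toEuclideanLin P.A.transpose y := by
    apply ext_inner_left ℝ
    intro v
    have := hy' (WithLp.toLp 2 (v, 0))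
    rw [WithLp.prod_inner_apply] at this
    change ⟪v, W u.fst + u.snd • P.c - r⟫_ℝ + ⟪(0 : ℝ), _⟫_ℝ =
      ⟪Matrix.toEuclideanLin P.A v - (0 : ℝ) • P.b, y⟫_ℝ at this
    rwa [inner_zero_left, add_zero, zero_smul, sub_zero, inner_toEuclideanLin_transpose] at this
  have e₂ : -⟪P.c, u.fst⟫_ℝ + κ / τ * u.snd - ρ / τ = -⟪P.b, y⟫_ℝ := by
    have := hy' (WithLp.toLp 2 (0, 1))
    rw [WithLp.prod_inner_apply] at this
    change ⟪(0 : Vec n), _⟫_ℝ + ⟪(1 : ℝ), -⟪P.c, u.fst⟫_ℝ + κ / τ * u.snd - ρ / τ⟫_ℝ =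
      ⟪Matrix.toEuclideanLin P.A 0 - (1 : ℝ) • P.b, y⟫_ℝ at this
    rwa [inner_zero_left, zero_add, RCLike.inner_apply, conj_trivial, mul_one, map_zero, zero_sub,
      one_smul, inner_neg_left] at this
  refine ⟨⟨y, u.fst, u.snd, -Matrix.toEuclideanLin P.A.transpose y + u.snd • P.c,
    ⟪P.b, y⟫_ℝ - ⟪P.c, u.fst⟫_ℝ⟩, (P.G_eq_zero_iff _).2 ⟨?_, rfl, rfl⟩, ?_, ?_⟩
  · exact sub_eq_zero.1 hu
  · have : ⟪P.b, y⟫_ℝ = ⟪P.c, u.fst⟫_ℝ - κ / τ * u.snd + ρ / τ := by linarith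
    simp only
    rw [this]
    field_simp
    ring
  · simp only
    rw [← e₁]
    abel

/-- The energy identity for the solutions of the systems that define the search directions. -/
theorem ConicProgram.energy_eq (P : ConicProgram m n) {W : Vec n →L[ℝ] Vec n}
    (hW : IsPSD W) {τ κ : ℝ} (hτ : 0 < τ) (hκ : 0 < κ) {d : Point m n} {g : Vec n} {ρ : ℝ}
    (hG : P.G d = 0) (hρ : τ * d.κ + κ * d.τ = ρ) (hg : W d.x + d.s = W g) :
    qnorm W d.x ^ 2 + qnorm W (g - d.x) ^ 2 + κ / τ * d.τ ^ 2 + τ / κ * d.κ ^ 2 =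
      qnorm W g ^ 2 + ρ ^ 2 / (τ * κ) := by
  have h₁ := P.inner_add_mul_eq_zero hG
  have h₂ : d.s = W g - W d.x := eq_sub_of_add_eq' hg
  rw [h₂, inner_sub_right] at h₁
  simp only [hW.qnorm_sq, map_sub, inner_sub_left, inner_sub_right]
  rw [hW.symm g d.x, ← hρ]
  have h₃ : (τ * d.κ + κ * d.τ) ^ 2 / (τ * κ) =
      κ / τ * d.τ ^ 2 + τ / κ * d.κ ^ 2 + 2 * (d.τ * d.κ) := by
    field_simp
    ring
  rw [h₃]
  linarith

end LinearAlgebra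

/-! ### The effect of a step on the neighbourhood -/

section Step

variable {m n : ℕ} {K : ProperCone ℝ (Vec n)} {F : Vec n → ℝ} {ν : ℝ} (hF : IsLHSCB K F ν)
  (hK : IsProper K) (hν : 1 ≤ ν) {z z' : Point m n} (hx : z.x ∈ interior (K : Set (Vec n)))
  (hs : z.s ∈ interior (dualCone K : Set (Vec n)))

include hF hK hν hx

/-- If `δᴰ` is small, then `s` is in the interior of the dual cone and `δᴾ` is small. -/
theorem deltaP_le_of_deltaD (hμ : 0 < mu ν z) {θ : ℝ} (hθ0 : 0 ≤ θ) (hθ : θ ≤ 1 / 40)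
    (hD : ∀ v, |⟪v, deltaD F ν z⟫_ℝ| ≤ θ * (mu ν z * localNorm F z.x v)) :
    z.s ∈ interior (dualCone K : Set (Vec n)) ∧
      localNorm F z.x (deltaP K F ν z) ≤ 4 / 3 * θ := by
  set μ := mu ν z with hμdef
  have hμi : 0 < μ⁻¹ := inv_pos.2 hμ
  have hy := smul_mem_interior hx hμi
  have hgy : gradient F (μ⁻¹ • z.x) = μ • gradient F z.x := by
    rw [hF.gradient_smul hx hμi, inv_inv]
  have hny : ∀ v, localNorm F (μ⁻¹ • z.x) v = μ * localNorm F z.x v := fun v => by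
    rw [hF.localNorm_smul_base hx hμi, inv_inv]
  have hdual : ∀ v, |⟪v, z.s + gradient F (μ⁻¹ • z.x)⟫_ℝ| ≤
      θ * localNorm F (μ⁻¹ • z.x) v := by
    intro v
    rw [hny, hgy]
    have : z.s + μ • gradient F z.x = deltaD F ν z := by
      rw [deltaD, sTilde, ← hμdef, smul_neg, sub_neg_eq_add]
    rw [this]
    exact hD v
  refine ⟨hF.mem_interior_dualCone hK (by linarith) hy (by linarith) hdual, ?_⟩
  obtain ⟨h, hh, hg⟩ := hF.exists_gradient_eq_near hK hy (by linarith) hdual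
  have hxt := hF.xTilde_eq hK (hF.add_mem_of_localNorm_lt hy (hh.trans (by norm_num))) hg
  have hP : localNorm F z.x (deltaP K F ν z) = localNorm F (μ⁻¹ • z.x) h := by
    rw [deltaP, hxt, hny, ← hμdef, smul_add, smul_smul, mul_inv_cancel₀ hμ.ne', one_smul,
      sub_add_cancel_left, ← neg_smul, localNorm_smul, abs_neg, abs_of_pos hμ]
  rw [hP]
  have h₁ := hF.le_inner_gradient_sub hy hh.le
  have h₂ := (abs_le.1 (hdual h)).1
  have e : ⟪h, gradient F (μ⁻¹ • z.x + h) - gradient F (μ⁻¹ • z.x)⟫_ℝ =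
      -⟪h, z.s + gradient F (μ⁻¹ • z.x)⟫_ℝ := by
    rw [hg, ← inner_neg_right]; congr 1; abel
  set r := localNorm F (μ⁻¹ • z.x) h with hr
  rcases (localNorm_nonneg F (μ⁻¹ • z.x) h).eq_or_lt with h0 | hpos
  · rw [hr, ← h0]; positivity
  rw [← hr] at hpos
  have h₃ : r ≤ 4 * θ := by nlinarith
  -- The crude bound `r ≤ 4θ ≤ 1/10` makes the Taylor remainder at most `r²/4`. This improves the
  -- constant from 4 to `4/3`.
  have h₄ := (abs_le.1 (hF.abs_inner_gradient_sub_le hK hy (h := h) (by linarith) h)).1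
  rw [inner_sub_right, ← hF.localNorm_sq hy, e, ← hr] at h₄
  have h₅ : 3 / 4 * r ^ 2 ≤ θ * r := by nlinarith [mul_pos hpos hpos]
  nlinarith

include hs

/-- The new complementarity after a step. -/
theorem mu_step {h k : Vec n} (hx' : z'.x = z.x + h) (hs' : z'.s = z.s + k) {l σ : ℝ}
    (hk : k + scaling K F ν z h = -(l • z.s) + σ • sTilde F z.x)
    (hsymm : ⟪z.x, scaling K F ν z h⟫_ℝ = ⟪h, scaling K F ν z z.x⟫_ℝ) :
    ν * mu ν z' = ν * ((1 - l) * mu ν z + σ) + ⟪h, k⟫_ℝ := by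
  have h₁ := congrArg (fun y => ⟪z.x, y⟫_ℝ) hk
  simp only [inner_add_right, inner_neg_right, inner_smul_right] at h₁
  rw [hsymm, scaling_apply_x hF hK hν hx hs, hF.inner_sTilde_self hx, inner_x_s hν] at h₁
  rw [← inner_x_s hν, hx', hs']
  simp only [inner_add_left, inner_add_right]
  rw [inner_x_s hν]
  linarith

/-- The new `δᴰ` splits exactly into `(1 - l)` times the old one and four errors: the change of `μ`
caused by `⟨h, k⟩`, the change of `μ` in front of `F''h`, the error of `W ≈ μF''` and the Taylor
remainder. For the corrector `l = 1`. -/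
theorem abs_inner_deltaD_step_le {h k : Vec n} (hx' : z'.x = z.x + h) (hs' : z'.s = z.s + k)
    {l σ ρ : ℝ} (hk : k + scaling K F ν z h = -(l • z.s) + σ • sTilde F z.x)
    (ha : localNorm F z.x (deltaP K F ν z) ≤ 1 / 100) (hρ0 : 0 ≤ ρ) (hρ : ρ ≤ 1 / 10)
    (hh : localNorm F z.x h ≤ ρ)
    (hkd : ∀ v, |⟪v, k⟫_ℝ| ≤ ρ * (mu ν z * localNorm F z.x v)) (v : Vec n) :
    |⟪v, deltaD F ν z'⟫_ℝ| ≤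
      (|1 - l| * (41 / 40 * localNorm F z.x (deltaP K F ν z) * mu ν z) + ρ ^ 2 * mu ν z
        + |mu ν z' - mu ν z| * ρ + 17 * localNorm F z.x (deltaP K F ν z) * mu ν z * ρ
        + 5 / 2 * |mu ν z'| * ρ ^ 2) * localNorm F z.x v := by
  have hμ := mu_pos hF hK hν hx hs
  have hV := localNorm_nonneg F z.x v
  have ha0 := localNorm_nonneg F z.x (deltaP K F ν z)
  have hmu := mu_step hF hK hν hx hs hx' hs' hk ((scaling_isPSD hF hK hν hx hs ha).symm _ _)
  set R := gradient F (z.x + h) - gradient F z.x - hessian F z.x h with hR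
  have hid : deltaD F ν z' = (1 - l) • deltaD F ν z - (⟪h, k⟫_ℝ / ν) • sTilde F z.x
      + (mu ν z' - mu ν z) • hessian F z.x h
      - (scaling K F ν z h - mu ν z • hessian F z.x h) + mu ν z' • R := by
    have e₁ : sTilde F z'.x = sTilde F z.x - hessian F z.x h - R := by
      rw [sTilde, sTilde, hx', hR]; abel
    have e₂ : k = -(l • z.s) + σ • sTilde F z.x - scaling K F ν z h := eq_sub_of_add_eq hk
    have e₃ : ⟪h, k⟫_ℝ / ν = mu ν z' - (1 - l) * mu ν z - σ := by
      rw [div_eq_iff (by linarith)]; linarith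
    rw [e₃, deltaD, e₁, hs', deltaD, e₂]
    module
  have hS : |⟪v, sTilde F z.x⟫_ℝ| ≤ ν * localNorm F z.x v := by
    have h₁ := (hF.isPSD hx).abs_inner_le v z.x
    rw [← localNorm_eq_qnorm, ← localNorm_eq_qnorm, hF.localNorm_self hx, hF.hessian_self hx,
      mul_comm] at h₁
    refine le_trans h₁ (mul_le_mul_of_nonneg_right ?_ hV)
    rw [Real.sqrt_le_left (by linarith)]
    nlinarith
  have b₁ : |(1 - l) * ⟪v, deltaD F ν z⟫_ℝ| ≤
      |1 - l| * (41 / 40 * localNorm F z.x (deltaP K F ν z) * mu ν z) * localNorm F z.x v := by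
    rw [abs_mul, mul_assoc]
    refine mul_le_mul_of_nonneg_left ?_ (abs_nonneg _)
    exact (abs_inner_deltaD_le hF hK hν hx hs ha v).trans_eq (by ring)
  have b₂ : |⟪h, k⟫_ℝ / ν * ⟪v, sTilde F z.x⟫_ℝ| ≤ ρ ^ 2 * mu ν z * localNorm F z.x v := by
    rw [abs_mul, abs_div, abs_of_pos (by linarith : 0 < ν)]
    have h₁ : |⟪h, k⟫_ℝ| ≤ ρ ^ 2 * mu ν z := by
      calc |⟪h, k⟫_ℝ| ≤ ρ * (mu ν z * localNorm F z.x h) := hkd h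
        _ ≤ ρ * (mu ν z * ρ) := by gcongr
        _ = _ := by ring
    have hν0 : 0 < ν := by linarith
    calc |⟪h, k⟫_ℝ| / ν * |⟪v, sTilde F z.x⟫_ℝ|
        ≤ ρ ^ 2 * mu ν z / ν * (ν * localNorm F z.x v) := by gcongr
      _ = _ := by field_simp
  have b₃ : |(mu ν z' - mu ν z) * ⟪v, hessian F z.x h⟫_ℝ| ≤
      |mu ν z' - mu ν z| * ρ * localNorm F z.x v := by
    rw [abs_mul, mul_assoc]
    refine mul_le_mul_of_nonneg_left ?_ (abs_nonneg _)
    refine ((hF.isPSD hx).abs_inner_le v h).trans ?_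
    rw [mul_comm]
    exact mul_le_mul_of_nonneg_right hh hV
  have b₄ : |⟪v, scaling K F ν z h⟫_ℝ - mu ν z * ⟪v, hessian F z.x h⟫_ℝ| ≤
      17 * localNorm F z.x (deltaP K F ν z) * mu ν z * ρ * localNorm F z.x v := by
    refine (abs_inner_scaling_sub_le hF hK hν hx hs ha v h).trans ?_
    rw [mul_assoc _ ρ, mul_comm ρ]
    gcongr
  have b₅ : |mu ν z' * ⟪v, R⟫_ℝ| ≤ 5 / 2 * |mu ν z'| * ρ ^ 2 * localNorm F z.x v := by
    rw [abs_mul]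
    have h₁ := hF.abs_inner_gradient_sub_le hK hx (hh.trans hρ) v
    calc |mu ν z'| * |⟪v, R⟫_ℝ|
        ≤ |mu ν z'| * (5 / 2 * ρ ^ 2 * localNorm F z.x v) := by
          refine mul_le_mul_of_nonneg_left (h₁.trans ?_) (abs_nonneg _)
          have := localNorm_nonneg F z.x h
          gcongr
      _ = _ := by ring
  have e : ⟪v, deltaD F ν z'⟫_ℝ = (1 - l) * ⟪v, deltaD F ν z⟫_ℝ
      - ⟪h, k⟫_ℝ / ν * ⟪v, sTilde F z.x⟫_ℝ + (mu ν z' - mu ν z) * ⟪v, hessian F z.x h⟫_ℝ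
      - (⟪v, scaling K F ν z h⟫_ℝ - mu ν z * ⟪v, hessian F z.x h⟫_ℝ) + mu ν z' * ⟪v, R⟫_ℝ := by
    conv_lhs => rw [hid]
    simp only [inner_add_right, inner_sub_right, inner_smul_right]
  rw [e]
  rw [abs_le] at b₁ b₂ b₃ b₄ b₅ ⊢
  constructor <;> linarith [b₁.1, b₁.2, b₂.1, b₂.2, b₃.1, b₃.2, b₄.1, b₄.2, b₅.1, b₅.2]

/-- A step with small error stays in a neighbourhood of the central path. -/
theorem step_mem {h k : Vec n} (hx' : z'.x = z.x + h) (hs' : z'.s = z.s + k)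
    {l σ ρ θ : ℝ} (hk : k + scaling K F ν z h = -(l • z.s) + σ • sTilde F z.x)
    (ha : localNorm F z.x (deltaP K F ν z) ≤ 1 / 100) (hρ0 : 0 ≤ ρ) (hρ : ρ ≤ 1 / 10)
    (hh : localNorm F z.x h ≤ ρ)
    (hkd : ∀ v, |⟪v, k⟫_ℝ| ≤ ρ * (mu ν z * localNorm F z.x v)) (hμ' : 0 < mu ν z')
    (hθ0 : 0 ≤ θ) (hθ : θ ≤ 1 / 40)
    (hbound : |1 - l| * (41 / 40 * localNorm F z.x (deltaP K F ν z) * mu ν z) + ρ ^ 2 * mu ν z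
        + |mu ν z' - mu ν z| * ρ + 17 * localNorm F z.x (deltaP K F ν z) * mu ν z * ρ
        + 5 / 2 * |mu ν z'| * ρ ^ 2 ≤ θ * mu ν z' * (1 - ρ)) :
    z'.x ∈ interior (K : Set (Vec n)) ∧ z'.s ∈ interior (dualCone K : Set (Vec n)) ∧
      localNorm F z'.x (deltaP K F ν z') ≤ 4 / 3 * θ := by
  have hmem : z'.x ∈ interior (K : Set (Vec n)) := by
    rw [hx']
    exact hF.add_mem_of_localNorm_lt hx (by linarith)
  refine ⟨hmem, deltaP_le_of_deltaD hF hK hν hmem hμ' hθ0 hθ fun v => ?_⟩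
  refine (abs_inner_deltaD_step_le hF hK hν hx hs hx' hs' hk ha hρ0 hρ hh hkd v).trans ?_
  refine (mul_le_mul_of_nonneg_right hbound (localNorm_nonneg _ _ _)).trans ?_
  have h₁ := hF.localNorm_le_of_near hx hh (by linarith) v
  rw [← hx'] at h₁
  calc θ * mu ν z' * (1 - ρ) * localNorm F z.x v
      = θ * (mu ν z' * ((1 - ρ) * localNorm F z.x v)) := by ring
    _ ≤ _ := by gcongr

/-- Bounds in the local norm from bounds in the `W`-norm. -/
theorem bounds_of_qnorm_sq_le (ha : localNorm F z.x (deltaP K F ν z) ≤ 1 / 170) {u : Vec n}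
    {c : ℝ} (hc : 0 ≤ c) (hu : qnorm (scaling K F ν z) u ^ 2 ≤ c ^ 2 * mu ν z) :
    localNorm F z.x u ≤ 1.06 * c ∧
      ∀ v, |⟪v, scaling K F ν z u⟫_ℝ| ≤ 1.05 * c * (mu ν z * localNorm F z.x v) := by
  have hμ := mu_pos hF hK hν hx hs
  have ha' : localNorm F z.x (deltaP K F ν z) ≤ 1 / 100 := ha.trans (by norm_num)
  -- The bound `1/170` makes `17 a ≤ 1/10`; then `0.9 · 1.06² ≥ 1` and `1.05² ≥ 1.1`.
  constructor
  · refine (sq_le_sq₀ (localNorm_nonneg _ _ _) (by positivity)).1 ?_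
    have h₁ := (qnorm_scaling_bounds hF hK hν hx hs ha' u).1
    have h₂ : 0 ≤ mu ν z * localNorm F z.x u ^ 2 := by positivity
    have h₃ : mu ν z * localNorm F z.x u ^ 2 ≤ mu ν z * (1.06 * c) ^ 2 := by
      have : 0 ≤ c ^ 2 * mu ν z := by positivity
      nlinarith
    exact le_of_mul_le_mul_left h₃ hμ
  · intro v
    refine ((scaling_isPSD hF hK hν hx hs ha').abs_inner_le v u).trans ?_
    have hV := localNorm_nonneg F z.x v
    refine (sq_le_sq₀ (mul_nonneg (qnorm_nonneg _ _) (qnorm_nonneg _ _)) (by positivity)).1 ?_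
    have h₁ := (qnorm_scaling_bounds hF hK hν hx hs ha' v).2
    have h₂ : 0 ≤ mu ν z * localNorm F z.x v ^ 2 := by positivity
    have h₃ : qnorm (scaling K F ν z) v ^ 2 ≤ 1.1 * (mu ν z * localNorm F z.x v ^ 2) := by
      nlinarith
    rw [mul_pow]
    calc _ ≤ (1.1 * (mu ν z * localNorm F z.x v ^ 2)) * (c ^ 2 * mu ν z) :=
          mul_le_mul h₃ hu (sq_nonneg _) (by positivity)
      _ = 1.1 * (c * (mu ν z * localNorm F z.x v)) ^ 2 := by ring
      _ ≤ 1.1025 * (c * (mu ν z * localNorm F z.x v)) ^ 2 := by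
          gcongr
          norm_num
      _ = _ := by ring

/-- Solvability of the systems at points near the central path. -/
theorem exists_direction_of_deltaP_le (P : ConicProgram m n) {τ κ : ℝ} (hτ : 0 < τ) (hκ : 0 < κ)
    (ha : localNorm F z.x (deltaP K F ν z) ≤ 1 / 100) (r : Vec n) (ρ : ℝ) :
    ∃ d : Point m n, P.G d = 0 ∧ τ * d.κ + κ * d.τ = ρ ∧ scaling K F ν z d.x + d.s = r := by
  refine P.exists_direction (scaling_isPSD hF hK hν hx hs ha) (fun v hv => ?_) hτ hκ r ρ
  have hμ := mu_pos hF hK hν hx hs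
  have h₁ := (qnorm_scaling_bounds hF hK hν hx hs ha v).1
  rw [(scaling_isPSD hF hK hν hx hs ha).qnorm_sq, hv] at h₁
  have h₂ : mu ν z * localNorm F z.x v ^ 2 ≤ 0 := by
    by_contra! hc
    nlinarith
  have h₃ : localNorm F z.x v ^ 2 ≤ 0 := nonpos_of_mul_nonpos_right h₂ hμ
  exact hF.eq_zero_of_localNorm_eq_zero hK hx (pow_eq_zero_iff two_ne_zero |>.1
    (le_antisymm h₃ (sq_nonneg _)))

theorem inner_deltaP_deltaD_le (ha : localNorm F z.x (deltaP K F ν z) ≤ 1 / 100) :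
    0 ≤ ⟪deltaP K F ν z, deltaD F ν z⟫_ℝ ∧
      ⟪deltaP K F ν z, deltaD F ν z⟫_ℝ ≤
        41 / 40 * (localNorm F z.x (deltaP K F ν z) ^ 2 * mu ν z) := by
  have hμ := mu_pos hF hK hν hx hs
  have h := abs_le.1 (inner_deltaP_deltaD_bound hF hK hν hx hs (ha.trans (by norm_num)))
  have ha0 := localNorm_nonneg F z.x (deltaP K F ν z)
  set a := localNorm F z.x (deltaP K F ν z)
  have h₁ : a ^ 3 ≤ 1 / 100 * a ^ 2 := by nlinarith [sq_nonneg a]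
  have h₂ := sq_nonneg a
  constructor
  · have : 0 ≤ ⟪deltaP K F ν z, deltaD F ν z⟫_ℝ / mu ν z := by linarith
    rwa [le_div_iff₀ hμ, zero_mul] at this
  · have : ⟪deltaP K F ν z, deltaD F ν z⟫_ℝ / mu ν z ≤ 41 / 40 * a ^ 2 := by linarith
    rw [div_le_iff₀ hμ] at this
    linarith

/-- Nonnegativity of `⟨δᴾ, δᴰ⟩`, read through its formula. It converts (A4) into a lower bound on
`μ`. -/
theorem one_le_mu_mul_muTilde (ha : localNorm F z.x (deltaP K F ν z) ≤ 1 / 100) :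
    1 ≤ mu ν z * muTilde K F ν z := by
  have hμ := mu_pos hF hK hν hx hs
  have h := (inner_deltaP_deltaD_le hF hK hν hx hs ha).1
  rw [inner_deltaP_deltaD hF hK hν hx hs] at h
  have := nonneg_of_mul_nonneg_right h (by positivity)
  linarith

end Step

/-! ### The predictor and the corrector -/

/-- With `E = μᵉ`, `M = μ`, `T = τκ`, `t = μ̃`, the left side is the energy of the shifted predictor
system. (A2) controls `E²/T` and (A4) controls `E² t`. -/
theorem energy_bound {ν E M T t : ℝ} (hν : 1 ≤ ν) (hE : 0 < E) (hsum : (ν + 1) * E = ν * M + T)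
    (hT : 9 / 10 * E ≤ T) (ht : 9 / 10 * E * t ≤ 1) :
    (16 / 25 * (ν * M) - 36 / 25 * (E * ν) + 81 / 100 * (E ^ 2 * (ν * t)))
      + (-(4 / 5) * T + 9 / 10 * E) ^ 2 / T ≤ 1 / 5 * (ν * E) := by
  have hT0 : 0 < T := by linarith
  have h₁ : (-(4 / 5) * T + 9 / 10 * E) ^ 2 / T ≤ 16 / 25 * T - 36 / 25 * E + 9 / 10 * E := by
    rw [div_le_iff₀ hT0]
    nlinarith
  have h₂ : 81 / 100 * (E ^ 2 * (ν * t)) ≤ 9 / 10 * (E * ν) := by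
    have : 9 / 10 * (E * ν) * (9 / 10 * E * t) ≤ 9 / 10 * (E * ν) * 1 :=
      mul_le_mul_of_nonneg_left ht (by positivity)
    linarith
  have h₃ : E ≤ ν * E := by nlinarith
  linarith

/-- The hypothesis of `step_mem` for a step of size `q/125`. The target `θ = 7q/2000` gives `4/3 θ <
q/200`. -/
theorem predictor_error_bound {q a M M' l : ℝ} (hq : 0 < q) (hq1 : q ≤ 1) (ha0 : 0 ≤ a)
    (ha : a ≤ q / 400) (hM : 0 < M) (hM' : |M' - M| ≤ 101 / 10000 * q ^ 2 * M)
    (hl : |1 - l| ≤ 1) :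
    0 < M' ∧ |1 - l| * (41 / 40 * a * M) + (q / 125) ^ 2 * M + |M' - M| * (q / 125)
      + 17 * a * M * (q / 125) + 5 / 2 * |M'| * (q / 125) ^ 2
      ≤ 7 / 2000 * q * M' * (1 - q / 125) := by
  have hqq : q ^ 2 ≤ q := by nlinarith
  have hq2 : q ^ 2 * M ≤ q * M := mul_le_mul_of_nonneg_right hqq hM.le
  have hq1M : q * M ≤ M := by nlinarith
  have hqM : 0 < q * M := by positivity
  have h := abs_le.1 hM'
  have hlow : 0.9899 * M ≤ M' := by linarith
  have hpos : 0 < M' := by linarith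
  refine ⟨hpos, ?_⟩
  rw [abs_of_pos hpos]
  have b₁ : |1 - l| * (41 / 40 * a * M) ≤ 1 * (41 / 40 * (q / 400) * M) := by gcongr
  have b₃ : |M' - M| * (q / 125) ≤ (101 / 10000 * M) * (q / 125) := by
    gcongr
    linarith
  have b₄ : 17 * a * M * (q / 125) ≤ 17 * (q / 400) * M * (q / 125) := by gcongr
  have b₅ : 5 / 2 * M' * (q / 125) ^ 2 ≤ 5 / 2 * (1.0101 * M) * (q / 125) ^ 2 := by
    gcongr
    linarith
  have b₆ : 7 / 2000 * q * (0.9899 * M) * (1 - 1 / 125) ≤ 7 / 2000 * q * M' * (1 - q / 125) := by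
    gcongr
  nlinarith

/-- The hypothesis of `step_mem` for `l = 1` and a step of size `11a/10`. The target `θ = q/1500`
gives `4/3 θ < q/1000`, well inside the required `q/400`. -/
theorem corrector_error_bound {q a M M' : ℝ} (hq1 : q ≤ 1) (ha0 : 0 ≤ a)
    (ha : a ≤ q / 200) (hM : 0 < M) (hM1 : M ≤ M') (hM2 : M' ≤ M + 1 / 50000 * q ^ 2 * M) :
    (11 / 10 * a) ^ 2 * M + |M' - M| * (11 / 10 * a)
      + 17 * a * M * (11 / 10 * a) + 5 / 2 * |M'| * (11 / 10 * a) ^ 2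
      ≤ q / 1500 * M' * (1 - 11 / 10 * a) := by
  have hq : 0 ≤ q := by linarith
  have hqq : q ^ 2 ≤ q := by nlinarith
  have hq2 : q ^ 2 * M ≤ q * M := mul_le_mul_of_nonneg_right hqq hM.le
  have hqM : q * M ≤ M := by nlinarith
  rw [abs_of_nonneg (by linarith), abs_of_pos (by linarith)]
  have ha2 : a ^ 2 * M ≤ (q / 200) ^ 2 * M := by gcongr
  have b₁ : (M' - M) * (11 / 10 * a) ≤ (1 / 50000 * M) * (11 / 10 * (q / 200)) := by
    gcongr
    linarith
  have b₂ : 5 / 2 * M' * (11 / 10 * a) ^ 2 ≤ 5 / 2 * (1.01 * M) * (11 / 10 * a) ^ 2 := by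
    gcongr
    linarith
  have b₃ : q / 1500 * M * (1 - 11 / 10 * (1 / 200)) ≤ q / 1500 * M' * (1 - 11 / 10 * a) := by
    have : 0 ≤ M' := by linarith
    gcongr
    linarith
  nlinarith

/-- What holds after the predictor step. -/
structure IsPredicted {m n : ℕ} (K : ProperCone ℝ (Vec n)) (F : Vec n → ℝ) (ν q : ℝ)
    (z : Point m n) : Prop where
  interior : IsInterior K z
  deltaP_le : localNorm F z.x (deltaP K F ν z) ≤ q / 200
  tauKappa : (9 / 10 + q ^ 2 / 1250) * muE ν z ≤ z.τ * z.κ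
  mu_ge : (9 / 10 + q ^ 2 / 1250) * muE ν z ≤ mu ν z

/-! ### Existence of the steps -/

section Iteration

variable {m n : ℕ} {P : ConicProgram m n} {F : Vec n → ℝ} {ν q : ℝ}

theorem muE_mul (hν : 1 ≤ ν) (z : Point m n) :
    (ν + 1) * muE ν z = ν * mu ν z + z.τ * z.κ := by
  rw [muE, mu]; field_simp

theorem muE_pos (hF : IsLHSCB P.K F ν) (hK : IsProper P.K) (hν : 1 ≤ ν) {z : Point m n}
    (hz : IsInterior P.K z) : 0 < muE ν z := by
  have h₁ := muE_mul hν z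
  have h₂ := mu_pos hF hK hν hz.x_mem hz.s_mem
  have h₃ := mul_pos hz.τ_pos hz.κ_pos
  have : 0 < (ν + 1) * muE ν z := by rw [h₁]; positivity
  exact pos_of_mul_pos_right this (by linarith)

theorem exists_predictorStep (hF : IsLHSCB P.K F ν) (hK : IsProper P.K) (hν : 1 ≤ ν)
    {α γ : ℝ} {z : Point m n} (hz : IsInterior P.K z)
    (ha : localNorm F z.x (deltaP P.K F ν z) ≤ 1 / 100) :
    ∃ z₁, IsPredictorStep P F ν α γ z z₁ := by
  have hsol := exists_direction_of_deltaP_le hF hK hν hz.x_mem hz.s_mem P hz.τ_pos hz.κ_pos ha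
  have hWx := scaling_apply_x hF hK hν hz.x_mem hz.s_mem
  -- Adding `c z` to a direction with zero residual produces the residual `c G(z)`. Since `W x = s`,
  -- it also adds `2cτκ` and `2c s` to the other two equations.
  have hshift : ∀ (c : ℝ) (r : Vec n) (ρ : ℝ), ∃ d : Point m n, P.G d = c • P.G z ∧
      z.τ * d.κ + z.κ * d.τ = ρ ∧ scaling P.K F ν z d.x + d.s = r := by
    intro c r ρ
    obtain ⟨d, h₁, h₂, h₃⟩ := hsol (r - (2 * c) • z.s) (ρ - 2 * c * (z.τ * z.κ))
    refine ⟨d + c • z, ?_, ?_, ?_⟩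
    · rw [P.G_add, P.G_smul, h₁, zero_add]
    · simp only [Point.add_κ, Point.add_τ, Point.smul_κ, Point.smul_τ]
      linarith
    · have : d.s = r - (2 * c) • z.s - scaling P.K F ν z d.x := eq_sub_of_add_eq' h₃
      simp only [Point.add_x, Point.add_s, Point.smul_x, Point.smul_s, map_add, map_smul, hWx]
      rw [this]
      module
  obtain ⟨dA, hA₁, hA₂, hA₃⟩ := hshift (-1) (-z.s) (-(z.τ * z.κ))
  obtain ⟨dC, hC₁, hC₂, hC₃⟩ := hshift 1 (muE ν z • sTilde F z.x) (muE ν z)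
  exact ⟨_, dA, dC, ⟨by rw [hA₁, neg_one_smul], hA₂, hA₃⟩, ⟨by rw [hC₁, one_smul], hC₂, hC₃⟩, rfl⟩

theorem exists_correctorStep (hF : IsLHSCB P.K F ν) (hK : IsProper P.K) (hν : 1 ≤ ν)
    {z : Point m n} (hz : IsInterior P.K z)
    (ha : localNorm F z.x (deltaP P.K F ν z) ≤ 1 / 100) :
    ∃ z₁, IsCorrectorStep P F ν z z₁ := by
  obtain ⟨d, h₁, h₂, h₃⟩ := exists_direction_of_deltaP_le hF hK hν hz.x_mem hz.s_mem P hz.τ_pos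
    hz.κ_pos ha (mu ν z • sTilde F z.x - z.s) 0
  exact ⟨_, d, ⟨h₁, h₂, h₃⟩, rfl⟩

end Iteration

/-! ### The predictor step -/

section Iteration

variable {m n : ℕ} {P : ConicProgram m n} {F : Vec n → ℝ} {ν q : ℝ}

/-- The systems satisfied by the combined direction `Δz_aff + 9/10 Δz_cen`. -/
structure IsPredictorDirection (P : ConicProgram m n) (F : Vec n → ℝ) (ν : ℝ)
    (z d : Point m n) : Prop where
  residual : P.G d = (-(1 / 10) : ℝ) • P.G z
  tauKappa : z.τ * d.κ + z.κ * d.τ = -(z.τ * z.κ) + 9 / 10 * muE ν z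
  xs : scaling P.K F ν z d.x + d.s = -z.s + (9 / 10 * muE ν z) • sTilde F z.x

theorem IsAffineDirection.isPredictorDirection {z dA dC : Point m n}
    (hA : IsAffineDirection P F ν z dA) (hC : IsCenteringDirection P F ν z dC) :
    IsPredictorDirection P F ν z (dA + (9 / 10 : ℝ) • dC) where
  residual := by rw [P.G_add, P.G_smul, hA.residual, hC.residual]; module
  tauKappa := by
    have h₁ := hA.tauKappa
    have h₂ := hC.tauKappa
    simp only [Point.add_τ, Point.add_κ, Point.smul_τ, Point.smul_κ]
    linarith
  xs := by
    have h₁ : dA.s = -z.s - scaling P.K F ν z dA.x := eq_sub_of_add_eq' hA.xs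
    have h₂ : dC.s = muE ν z • sTilde F z.x - scaling P.K F ν z dC.x := eq_sub_of_add_eq' hC.xs
    simp only [Point.add_x, Point.add_s, Point.smul_x, Point.smul_s, map_add, map_smul]
    rw [h₁, h₂]
    module

theorem mu_ge_of_inNeighborhood (hF : IsLHSCB P.K F ν) (hK : IsProper P.K) (hν : 1 ≤ ν)
    {z : Point m n} {η : ℝ} (hη : η ≤ 1 / 100)
    (hz : InNeighborhood P.K F ν (9 / 10) η z) : 9 / 10 * muE ν z ≤ mu ν z :=
  le_of_mul_le_mul_right (hz.muTilde_le.trans (one_le_mu_mul_muTilde hF hK hν hz.interior.x_mem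
    hz.interior.s_mem (hz.deltaP_le.trans hη)))
    (muTilde_pos hF hK hν hz.interior.x_mem hz.interior.s_mem)

theorem two_mul_abs_mul_le {τ κ dτ dκ : ℝ} (hτ : 0 < τ) (hκ : 0 < κ) :
    2 * |dτ * dκ| ≤ κ / τ * dτ ^ 2 + τ / κ * dκ ^ 2 := by
  have e₁ : 0 ≤ (κ * dτ - τ * dκ) ^ 2 / (τ * κ) := by positivity
  have e₂ : 0 ≤ (κ * dτ + τ * dκ) ^ 2 / (τ * κ) := by positivity
  have e₃ : (κ * dτ - τ * dκ) ^ 2 / (τ * κ) =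
      κ / τ * dτ ^ 2 + τ / κ * dκ ^ 2 - 2 * (dτ * dκ) := by
    field_simp; ring
  have e₄ : (κ * dτ + τ * dκ) ^ 2 / (τ * κ) =
      κ / τ * dτ ^ 2 + τ / κ * dκ ^ 2 + 2 * (dτ * dκ) := by
    field_simp; ring
  rcases abs_cases (dτ * dκ) with h | h <;> linarith

/-- Bounds on the combined predictor direction. -/
theorem IsPredictorDirection.bounds (hF : IsLHSCB P.K F ν) (hK : IsProper P.K) (hν : 1 ≤ ν)
    {z d : Point m n} {η : ℝ} (hη : η ≤ 1 / 400)
    (hz : InNeighborhood P.K F ν (9 / 10) η z) (hd : IsPredictorDirection P F ν z d) :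
    localNorm F z.x d.x ≤ 4 / 5 * Real.sqrt ν ∧
    (∀ v, |⟪v, d.s⟫_ℝ| ≤ 4 / 5 * Real.sqrt ν * (mu ν z * localNorm F z.x v)) ∧
    -(11 / 100) * (ν * muE ν z) ≤ ⟪d.x, d.s⟫_ℝ ∧
    -(11 / 100) * (ν * muE ν z) ≤ d.τ * d.κ ∧
    ⟪d.x, d.s⟫_ℝ + d.τ * d.κ = 0 ∧
    -(3 / 5 * (ν * z.τ)) ≤ d.τ := by
  have hx := hz.interior.x_mem
  have hs := hz.interior.s_mem
  have hτ := hz.interior.τ_pos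
  have hκ := hz.interior.κ_pos
  have hS : 0 < Real.sqrt ν := Real.sqrt_pos.2 (by linarith)
  have hSν : Real.sqrt ν ^ 2 = ν := Real.sq_sqrt (by linarith)
  have ha170 : localNorm F z.x (deltaP P.K F ν z) ≤ 1 / 170 := by linarith [hz.deltaP_le]
  have ha100 : localNorm F z.x (deltaP P.K F ν z) ≤ 1 / 100 := by linarith
  have hμ := mu_pos hF hK hν hx hs
  have hE := muE_pos hF hK hν hz.interior
  have hsum := muE_mul hν z
  have hT := hz.tauKappa
  have hEt := hz.muTilde_le
  have hEM := mu_ge_of_inNeighborhood hF hK hν (by linarith) hz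
  have hWpsd := scaling_isPSD hF hK hν hx hs ha100
  have hWx := scaling_apply_x hF hK hν hx hs
  have hWt := scaling_apply_xTilde hF hK hν hx hs ha100
  have hxs := inner_x_s (z := z) hν
  have hxst := hF.inner_sTilde_self hx
  have hts := inner_xTilde_s hF hK hs
  have htst := inner_xTilde_sTilde (K := P.K) (F := F) (z := z) hν
  have hbounds := @bounds_of_qnorm_sq_le m n P.K F ν hF hK hν z hx hs ha170
  have hWd := hd.xs
  have hτd := hd.tauKappa
  -- The shift by `z/10` removes the residual, so skew-symmetry and the energy identity apply to
  -- `d'`.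
  obtain ⟨d', hd'x, hd's, hd'τ, hd'κ, hGd'⟩ : ∃ d' : Point m n,
      d'.x = d.x + (1 / 10 : ℝ) • z.x ∧ d'.s = d.s + (1 / 10 : ℝ) • z.s ∧
      d'.τ = d.τ + 1 / 10 * z.τ ∧ d'.κ = d.κ + 1 / 10 * z.κ ∧ P.G d' = 0 :=
    ⟨d + (1 / 10 : ℝ) • z, rfl, rfl, rfl, rfl, by
      rw [P.G_add, P.G_smul, hd.residual]; module⟩
  set E := muE ν z with hEdef
  set M := mu ν z with hMdef
  set W := scaling P.K F ν z with hWdef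
  set t := muTilde P.K F ν z with htdef
  clear_value E M W t
  -- The shift adds `(W x + s)/10 = s/5`, so the right-hand side becomes `-4/5 s + 9/10 E s̃`, which
  -- is `W g` by the secant equations.
  obtain ⟨g, hg⟩ : ∃ g, g = (-(4 / 5) : ℝ) • z.x + (9 / 10 * E) • xTilde P.K F z.s := ⟨_, rfl⟩
  have hWg : W g = (-(4 / 5) : ℝ) • z.s + (9 / 10 * E) • sTilde F z.x := by
    rw [hg, map_add, map_smul, map_smul, hWx, hWt]
  have hWd' : W d'.x + d'.s = W g := by
    have h₁ : d.s = -z.s + (9 / 10 * E) • sTilde F z.x - W d.x := eq_sub_of_add_eq' hWd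
    rw [hd'x, hd's, map_add, map_smul, hWg, hWx, h₁]
    module
  have hτd' : z.τ * d'.κ + z.κ * d'.τ = -(4 / 5) * (z.τ * z.κ) + 9 / 10 * E := by
    rw [hd'τ, hd'κ]
    linarith
  have hqg : qnorm W g ^ 2 = 16 / 25 * (ν * M) - 36 / 25 * (E * ν)
      + 81 / 100 * (E ^ 2 * (ν * t)) := by
    rw [hWpsd.qnorm_sq, hWg, hg]
    simp only [inner_add_left, inner_add_right, inner_smul_left, inner_smul_right, conj_trivial]
    rw [hxs, hxst, hts, htst]
    ring
  have henergy := P.energy_eq hWpsd hτ hκ hGd' hτd' hWd'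
  rw [hqg] at henergy
  have hbd := energy_bound hν hE hsum hT hEt
  rw [← henergy] at hbd
  have hskew := P.inner_add_mul_eq_zero hGd'
  have n₁ : 0 ≤ qnorm W d'.x ^ 2 := sq_nonneg _
  have n₂ : 0 ≤ qnorm W (g - d'.x) ^ 2 := sq_nonneg _
  have n₃ : 0 ≤ z.κ / z.τ * d'.τ ^ 2 := by positivity
  have n₄ : 0 ≤ z.τ / z.κ * d'.κ ^ 2 := by positivity
  have hνE : 0 < ν * E := by positivity
  have hνEM : 9 / 10 * (ν * E) ≤ ν * M := by
    have := mul_le_mul_of_nonneg_left hEM (by linarith : 0 ≤ ν)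
    linarith
  have hνET : 9 / 10 * (ν * E) ≤ ν * (z.τ * z.κ) := by
    have := mul_le_mul_of_nonneg_left hT (by linarith : 0 ≤ ν)
    linarith
  have hEν : E ≤ ν * E := le_mul_of_one_le_left hE.le hν
  -- The energy is at most `νE/5 ≤ 2/9 νM`, and `2/9 < (12/25)²`.
  have hc : (0 : ℝ) ≤ 12 / 25 * Real.sqrt ν := by positivity
  have hc2 : (12 / 25 * Real.sqrt ν) ^ 2 * M = 144 / 625 * (ν * M) := by
    rw [mul_pow, hSν]; ring
  obtain ⟨hdx, -⟩ := hbounds (u := d'.x) hc (by rw [hc2]; linarith)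
  obtain ⟨-, hdg⟩ := hbounds (u := g - d'.x) hc (by rw [hc2]; linarith)
  obtain ⟨-, hsb⟩ := hbounds (u := z.x) hS.le (by rw [hWpsd.qnorm_sq, hWx, hxs, hSν])
  rw [hWx] at hsb
  have hds : d.s = W (g - d'.x) - (1 / 10 : ℝ) • z.s := by
    rw [map_sub, ← hWd', hd's]; abel
  have hdxe : d.x = d'.x - (1 / 10 : ℝ) • z.x := by
    rw [hd'x]; abel
  have hds' : d.s = d'.s - (1 / 10 : ℝ) • z.s := by
    rw [hd's]; abel
  have hxWg : ⟪z.x, d'.s⟫_ℝ + ⟪d'.x, z.s⟫_ℝ = -(4 / 5) * (ν * M) + 9 / 10 * (ν * E) := by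
    rw [← hWx, hWpsd.symm d'.x z.x, ← inner_add_right, add_comm d'.s, hWd', hWg, inner_add_right,
      inner_smul_right, inner_smul_right, hxs, hxst]
    ring
  have hinner : ⟪d.x, d.s⟫_ℝ = ⟪d'.x, d'.s⟫_ℝ + 9 / 100 * (ν * M) - 9 / 100 * (ν * E) := by
    rw [hdxe, hds']
    simp only [inner_sub_left, inner_sub_right, inner_smul_left, inner_smul_right, conj_trivial]
    rw [hxs]
    linarith
  have hprod : d.τ * d.κ = d'.τ * d'.κ + 9 / 100 * (z.τ * z.κ) - 9 / 100 * E := by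
    rw [hd'τ, hd'κ]
    linarith
  have hττ : |d'.τ * d'.κ| ≤ 1 / 10 * (ν * E) := by
    have := two_mul_abs_mul_le (dτ := d'.τ) (dκ := d'.κ) hτ hκ
    linarith
  have hττ' := abs_le.1 hττ
  refine ⟨?_, fun v => ?_, by linarith, by linarith, by linarith, ?_⟩
  · have := (hF.isPSD hx).qnorm_sub_le d'.x ((1 / 10 : ℝ) • z.x)
    rw [← localNorm_eq_qnorm, ← localNorm_eq_qnorm, ← localNorm_eq_qnorm, localNorm_smul,
      hF.localNorm_self hx, abs_of_pos (by norm_num), ← hdxe] at this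
    linarith
  · rw [hds, inner_sub_right, inner_smul_right]
    have h₂ := abs_le.1 (hdg v)
    have h₃ := abs_le.1 (hsb v)
    have : 0 ≤ Real.sqrt ν * (M * localNorm F z.x v) :=
      mul_nonneg hS.le (mul_nonneg hμ.le (localNorm_nonneg _ _ _))
    rw [abs_le]
    constructor <;> linarith
  -- The energy bound gives `|d'.τ| ≤ ντ/2`; undoing the shift costs another `τ/10`. A step
  -- `1/(100ν)` therefore keeps `τ` positive.
  · have h₀ : ν * (z.τ * z.κ) ≤ ν ^ 2 * (z.τ * z.κ) := by
      have : 0 ≤ z.τ * z.κ := by positivity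
      gcongr
      exact le_self_pow₀ hν two_ne_zero
    have h₁ : z.κ / z.τ * d'.τ ^ 2 ≤ 1 / 4 * (ν ^ 2 * (z.τ * z.κ)) := by linarith
    have h₂ : d'.τ ^ 2 ≤ (1 / 2 * (ν * z.τ)) ^ 2 := by
      rw [div_mul_eq_mul_div, div_le_iff₀ hτ] at h₁
      refine le_of_mul_le_mul_left (a := z.κ) ?_ hκ
      linarith
    have h₃ := (abs_le.1 (abs_le_of_sq_le_sq h₂ (by positivity))).1
    have h₄ : z.τ ≤ ν * z.τ := le_mul_of_one_le_left hτ.le hν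
    linarith

theorem predictorStep_spec (hF : IsLHSCB P.K F ν) (hK : IsProper P.K) (hν : 1 ≤ ν)
    (hq : 0 < q) (hqν : q * Real.sqrt ν = 1) {z z₁ : Point m n}
    (hz : InNeighborhood P.K F ν (9 / 10) (q / 400) z)
    (hstep : IsPredictorStep P F ν (q ^ 2 / 100) (9 / 10) z z₁) :
    IsPredicted P.K F ν q z₁ ∧ muE ν z₁ = (1 - q ^ 2 / 1000) * muE ν z ∧
      P.G z₁ = (1 - q ^ 2 / 1000) • P.G z := by
  obtain ⟨d, hd, hz₁⟩ : ∃ d, IsPredictorDirection P F ν z d ∧ z₁ = z + (q ^ 2 / 100) • d := by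
    obtain ⟨dA, dC, hA, hC, h⟩ := hstep
    exact ⟨_, hA.isPredictorDirection hC, h⟩
  have hx := hz.interior.x_mem
  have hs := hz.interior.s_mem
  have hτ := hz.interior.τ_pos
  have hκ := hz.interior.κ_pos
  have hS1 : 1 ≤ Real.sqrt ν := Real.one_le_sqrt.2 hν
  have hSν : Real.sqrt ν ^ 2 = ν := Real.sq_sqrt (by linarith)
  have hq1 : q ≤ 1 := by nlinarith
  have hq2ν : q ^ 2 * ν = 1 := by rw [← hSν, ← mul_pow, hqν, one_pow]
  have ha := hz.deltaP_le
  have ha100 : localNorm F z.x (deltaP P.K F ν z) ≤ 1 / 100 := by linarith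
  have ha0 := localNorm_nonneg F z.x (deltaP P.K F ν z)
  have hμ := mu_pos hF hK hν hx hs
  have hE := muE_pos hF hK hν hz.interior
  have hsum := muE_mul hν z
  have hT := hz.tauKappa
  have hEM := mu_ge_of_inNeighborhood hF hK hν (by linarith) hz
  obtain ⟨hdx, hds, hxslow, hτκlow, hskew, hdτ⟩ := hd.bounds hF hK hν (by linarith) hz
  have hαS : q ^ 2 / 100 * Real.sqrt ν = q / 100 := by
    rw [div_mul_eq_mul_div, pow_two, mul_assoc, hqν, mul_one]
  have hα : 0 < q ^ 2 / 100 := by positivity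
  obtain ⟨α, hαdef⟩ : ∃ α, α = q ^ 2 / 100 := ⟨_, rfl⟩
  have hq2 : q ^ 2 = 100 * α := by rw [hαdef]; ring
  rw [← hαdef] at hz₁ hαS hα
  have hz₁x : z₁.x = z.x + α • d.x := by rw [hz₁]; rfl
  have hz₁s : z₁.s = z.s + α • d.s := by rw [hz₁]; rfl
  have hz₁τ : z₁.τ = z.τ + α * d.τ := by rw [hz₁]; rfl
  have hz₁κ : z₁.κ = z.κ + α * d.κ := by rw [hz₁]; rfl
  have hG : P.G z₁ = (1 - q ^ 2 / 1000) • P.G z := by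
    rw [hz₁, P.G_add, P.G_smul, hd.residual, hαdef]
    module
  have hh : localNorm F z.x (α • d.x) ≤ q / 125 := by
    rw [localNorm_smul, abs_of_pos hα]
    calc α * localNorm F z.x d.x ≤ α * (4 / 5 * Real.sqrt ν) := by gcongr
      _ = 4 / 5 * (α * Real.sqrt ν) := by ring
      _ = q / 125 := by rw [hαS]; ring
  have hk : ∀ v, |⟪v, α • d.s⟫_ℝ| ≤ q / 125 * (mu ν z * localNorm F z.x v) := by
    intro v
    rw [inner_smul_right, abs_mul, abs_of_pos hα]
    calc α * |⟪v, d.s⟫_ℝ| ≤ α * (4 / 5 * Real.sqrt ν * (mu ν z * localNorm F z.x v)) := by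
          gcongr
          exact hds v
      _ = 4 / 5 * (α * Real.sqrt ν) * (mu ν z * localNorm F z.x v) := by ring
      _ = _ := by rw [hαS]; ring
  have hkh : α • d.s + scaling P.K F ν z (α • d.x) =
      -(α • z.s) + (α * (9 / 10 * muE ν z)) • sTilde F z.x := by
    rw [map_smul, ← smul_add, add_comm d.s, hd.xs]
    module
  have hαν : α * ν = 1 / 100 := by rw [hαdef]; linarith only [hq2ν]
  have hα1 : α ≤ 1 / 100 := by
    have : q ^ 2 ≤ 1 := pow_le_one₀ hq.le hq1
    linarith only [this, hq2]
  have hmu := mu_step hF hK hν hx hs hz₁x hz₁s hkh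
    ((scaling_isPSD hF hK hν hx hs ha100).symm _ _)
  have hhk' : ⟪α • d.x, α • d.s⟫_ℝ = α ^ 2 * ⟪d.x, d.s⟫_ℝ := by
    rw [inner_smul_left, inner_smul_right, conj_trivial]; ring
  have hhk : |⟪α • d.x, α • d.s⟫_ℝ| ≤ (q / 125) ^ 2 * mu ν z := by
    calc _ ≤ q / 125 * (mu ν z * localNorm F z.x (α • d.x)) := hk _
      _ ≤ q / 125 * (mu ν z * (q / 125)) := by gcongr
      _ = _ := by ring
  have hstepmem := fun hM' hb => step_mem (l := α) (θ := 7 / 2000 * q) hF hK hν hx hs hz₁x hz₁s hkh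
    ha100 (by positivity : 0 ≤ q / 125) (by linarith only [hq1]) hh hk hM' (by positivity) (by linarith only [hq1]) hb
  have hτκd := hd.tauKappa
  have hmuE₁ := muE_mul hν z₁
  obtain ⟨E₁, hE₁def⟩ : ∃ E₁, E₁ = muE ν z₁ := ⟨_, rfl⟩
  obtain ⟨M₁, hM₁def⟩ : ∃ M₁, M₁ = mu ν z₁ := ⟨_, rfl⟩
  obtain ⟨E, hEdef⟩ : ∃ E, E = muE ν z := ⟨_, rfl⟩
  obtain ⟨M, hMdef⟩ : ∃ M, M = mu ν z := ⟨_, rfl⟩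
  rw [hhk'] at hmu hhk
  rw [← hEdef, ← hE₁def]
  rw [← hM₁def, ← hE₁def] at hmuE₁
  rw [← hEdef] at hE hτκd hτκlow hxslow hT
  rw [← hEdef, ← hMdef] at hsum hEM
  rw [← hEdef, ← hMdef, ← hM₁def] at hmu
  rw [← hMdef, ← hM₁def] at hstepmem
  rw [← hMdef] at hμ hhk
  -- Since `9/10 E ≤ M`, the first-order change of `μ` is at most `α M`; the quadratic term adds at
  -- most one percent of that.
  have hdev : |M₁ - M| ≤ 101 / 10000 * q ^ 2 * M := by
    have h₁ : ν * (M₁ - M) = ν * (α * (9 / 10 * E - M)) + α ^ 2 * ⟪d.x, d.s⟫_ℝ := by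
      linear_combination hmu
    have h₂ := abs_le.1 hhk
    have h₃ : 0 ≤ α * (M - 9 / 10 * E) := mul_nonneg hα.le (sub_nonneg.2 hEM)
    have h₄ : α * (M - 9 / 10 * E) ≤ α * M := by
      gcongr; linarith only [hE]
    have h₅ : 0 ≤ α * M := by positivity
    have h₇ : α * M ≤ ν * (α * M) := le_mul_of_one_le_left h₅ hν
    have h₈ : ν * (α * (M - 9 / 10 * E)) ≤ ν * (α * M) := by gcongr
    have h₉ : 0 ≤ ν * (α * (M - 9 / 10 * E)) := by positivity
    have e' : (q / 125) ^ 2 * M ≤ 1 / 100 * (α * M) := by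
      rw [hαdef]
      have : 0 ≤ q ^ 2 * M := by positivity
      linarith only [this]
    rw [hq2, abs_le]
    constructor
    · refine le_of_mul_le_mul_left (a := ν) ?_ (by linarith)
      rw [h₁]
      linarith only [h₂.1, h₂.2, h₇, h₈, h₉, e', h₅]
    · refine le_of_mul_le_mul_left (a := ν) ?_ (by linarith)
      rw [h₁]
      linarith only [h₂.1, h₂.2, h₇, h₈, h₉, e', h₅]
  obtain ⟨hM₁, herr⟩ := predictor_error_bound (l := α) hq hq1 ha0 ha hμ hdev
    (by rw [abs_le]; constructor <;> linarith only [hα, hα1])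
  obtain ⟨hx₁, hs₁, hP₁⟩ := hstepmem hM₁ herr
  have hτκ₁ : z₁.τ * z₁.κ = z.τ * z.κ + α * (-(z.τ * z.κ) + 9 / 10 * E) + α ^ 2 * (d.τ * d.κ) := by
    rw [← hτκd, hz₁τ, hz₁κ]; ring
  have hE₁ : E₁ = (1 - q ^ 2 / 1000) * E := by
    have h₂ : ⟪d.x, d.s⟫_ℝ = -(d.τ * d.κ) := eq_neg_of_add_eq_zero_left hskew
    rw [hmu, hτκ₁, h₂] at hmuE₁
    refine mul_left_cancel₀ (by positivity : ν + 1 ≠ 0) ?_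
    rw [hmuE₁, hq2]
    linear_combination (α - 1) * hsum
  have hαEpos : 0 < α * E := by positivity
  have hαα : α ^ 2 * (ν * E) = 1 / 100 * (α * E) := by
    rw [← hαν]; ring
  -- Here `q²/1250 = 8α/100`, while `9/10 E₁` lies `9α/100 · E` below `9/10 E`. The remaining `α/100
  -- · E` pays for the second-order losses of `τκ` and `μ`.
  have hstep₁ : (9 / 10 + q ^ 2 / 1250) * E₁ ≤ 9 / 10 * E - 1 / 100 * (α * E) := by
    rw [hE₁, hq2]
    have : 0 ≤ α ^ 2 * E := by positivity
    linarith only [this, hαEpos]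
  have hταT : 9 / 10 * E - 1 / 100 * (α * E) ≤ z₁.τ * z₁.κ := by
    have h₂ := mul_le_mul_of_nonneg_left hτκlow (sq_nonneg α)
    have h₃ : (1 - α) * (9 / 10 * E) ≤ (1 - α) * (z.τ * z.κ) := by
      gcongr
      linarith only [hα1]
    rw [hτκ₁]
    linarith only [h₂, h₃, hαα, hαEpos]
  have hMα : 9 / 10 * E - 1 / 100 * (α * E) ≤ M₁ := by
    have h₂ := mul_le_mul_of_nonneg_left hxslow (sq_nonneg α)
    have h₃ : α * E ≤ ν * (α * E) := le_mul_of_one_le_left hαEpos.le hν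
    have h₄ : ν * ((1 - α) * (9 / 10 * E)) ≤ ν * ((1 - α) * M) := by
      gcongr
      linarith only [hα1]
    refine le_of_mul_le_mul_left (a := ν) ?_ (zero_lt_one.trans_le hν)
    rw [hmu]
    linarith only [h₂, h₃, h₄, hαα, hαEpos]
  have hτ₁ : 0 < z₁.τ := by
    have h₅ : α * (-(3 / 5 * (ν * z.τ))) ≤ α * d.τ := by gcongr
    have h₆ : α * (ν * z.τ) = 1 / 100 * z.τ := by rw [← mul_assoc, hαν]
    rw [hz₁τ]
    linarith only [h₅, h₆, hτ]
  have hκ₁ : 0 < z₁.κ := by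
    have h₁ : α * E ≤ 1 / 100 * E := by gcongr
    have : 0 < z₁.τ * z₁.κ := by linarith only [h₁, hταT, hE]
    exact pos_of_mul_pos_right this hτ₁.le
  refine ⟨⟨⟨hx₁, hs₁, hτ₁, hκ₁⟩, by linarith only [hP₁, hq], ?_, ?_⟩, hE₁, hG⟩
  · rw [← hE₁def]
    exact hstep₁.trans hταT
  · rw [← hE₁def, ← hM₁def]
    exact hstep₁.trans hMα

end Iteration

/-! ### The corrector step -/

section Iteration

variable {m n : ℕ} {P : ConicProgram m n} {F : Vec n → ℝ} {ν q : ℝ}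

/-- The slack `q²/1250` in the bound on `μ` compensates the excess of `μ μ̃` over 1, which is at
most the same amount. -/
theorem muE_mul_muTilde_le {a E M₂ t : ℝ} (hν : 1 ≤ ν) (hE : 0 < E)
    (hM₂ : 0 < M₂) (hM : (9 / 10 + q ^ 2 / 1250) * E ≤ M₂)
    (h : ν * M₂ * (M₂ * t - 1) ≤ 41 / 40 * (a ^ 2 * M₂)) (ha : a ^ 2 ≤ (q / 1000) ^ 2) :
    9 / 10 * E * t ≤ 1 := by
  have h₁ : ν * (M₂ * t - 1) ≤ 41 / 40 * a ^ 2 := by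
    refine le_of_mul_le_mul_left (a := M₂) ?_ hM₂
    linarith only [h]
  have h₂ : M₂ * t ≤ 1 + q ^ 2 / 1250 := by
    by_contra! hcon
    have h₃ : M₂ * t - 1 ≤ ν * (M₂ * t - 1) :=
      le_mul_of_one_le_left (by linarith only [hcon, sq_nonneg q]) hν
    linarith only [h₁, h₃, ha, hcon, sq_nonneg q]
  refine le_of_mul_le_mul_left (a := M₂) ?_ hM₂
  have h₄ : E * (M₂ * t) ≤ E * (1 + q ^ 2 / 1250) := by gcongr
  have h₅ : 0 ≤ q ^ 2 * E := by positivity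
  linarith only [h₄, h₅, hM]

theorem correctorStep_spec (hF : IsLHSCB P.K F ν) (hK : IsProper P.K) (hν : 1 ≤ ν)
    (hq : 0 < q) (hq1 : q ≤ 1) {z z₂ : Point m n} (hz : IsPredicted P.K F ν q z)
    (hstep : IsCorrectorStep P F ν z z₂) :
    InNeighborhood P.K F ν (9 / 10) (q / 400) z₂ ∧ muE ν z₂ = muE ν z ∧ P.G z₂ = P.G z := by
  obtain ⟨d, hd, hz₂⟩ := hstep
  have hx := hz.interior.x_mem
  have hs := hz.interior.s_mem
  have hτ := hz.interior.τ_pos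
  have hκ := hz.interior.κ_pos
  have ha := hz.deltaP_le
  have ha170 : localNorm F z.x (deltaP P.K F ν z) ≤ 1 / 170 := by linarith
  have ha100 : localNorm F z.x (deltaP P.K F ν z) ≤ 1 / 100 := by linarith
  have ha0 := localNorm_nonneg F z.x (deltaP P.K F ν z)
  have hμ := mu_pos hF hK hν hx hs
  have hE := muE_pos hF hK hν hz.interior
  have hsum := muE_mul hν z
  have hT := hz.tauKappa
  have hM := hz.mu_ge
  have hWpsd := scaling_isPSD hF hK hν hx hs ha100
  have hWx := scaling_apply_x hF hK hν hx hs
  have hWt := scaling_apply_xTilde hF hK hν hx hs ha100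
  -- By the secant equations the right-hand side is `W(-δᴾ)`, so the energy of the corrector is
  -- `⟨δᴾ, δᴰ⟩`, of order `μ a²`.
  have hWP : scaling P.K F ν z (-deltaP P.K F ν z) = mu ν z • sTilde F z.x - z.s := by
    rw [deltaP, neg_sub, map_sub, map_smul, hWx, hWt]
  have hqP : qnorm (scaling P.K F ν z) (-deltaP P.K F ν z) ^ 2 =
      ⟪deltaP P.K F ν z, deltaD F ν z⟫_ℝ := by
    rw [hWpsd.qnorm_sq, hWP, inner_neg_left, ← inner_neg_right, neg_sub]; rfl
  have henergy := P.energy_eq hWpsd hτ hκ hd.residual hd.tauKappa (hd.xs.trans hWP.symm)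
  rw [hqP] at henergy
  have hPD := (inner_deltaP_deltaD_le hF hK hν hx hs ha100).2
  have hskew := P.inner_add_mul_eq_zero hd.residual
  have hbounds := @bounds_of_qnorm_sq_le m n P.K F ν hF hK hν z hx hs ha170
  have hz₂x : z₂.x = z.x + d.x := by rw [hz₂]; rfl
  have hz₂s : z₂.s = z.s + d.s := by rw [hz₂]; rfl
  have hz₂τ : z₂.τ = z.τ + d.τ := by rw [hz₂]; rfl
  have hz₂κ : z₂.κ = z.κ + d.κ := by rw [hz₂]; rfl
  have hkh : d.s + scaling P.K F ν z d.x = -((1 : ℝ) • z.s) + mu ν z • sTilde F z.x := by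
    rw [add_comm, hd.xs, one_smul]; abel
  have hmu := mu_step hF hK hν hx hs hz₂x hz₂s hkh (hWpsd.symm _ _)
  have hstepmem := @step_mem m n P.K F ν hF hK hν z z₂ hx hs d.x d.s hz₂x hz₂s 1 (mu ν z)
    (11 / 10 * localNorm F z.x (deltaP P.K F ν z)) (q / 1500) hkh ha100
  have hmuE₂ := muE_mul hν z₂
  have hPD₂ := fun hx₂ hs₂ ha₂ => (@inner_deltaP_deltaD_le m n P.K F ν hF hK hν z₂ hx₂ hs₂ ha₂).2
  have hid₂ := fun hx₂ hs₂ => @inner_deltaP_deltaD m n P.K F ν hF hK hν z₂ hx₂ hs₂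
  have hxsd := hd.xs
  have hτκd := hd.tauKappa
  have hG : P.G z₂ = P.G z := by rw [hz₂, P.G_add, hd.residual, add_zero]
  clear hd hz hz₂
  suffices IsInterior P.K z₂ ∧ 9 / 10 * muE ν z₂ ≤ z₂.τ * z₂.κ ∧
      9 / 10 * muE ν z₂ * muTilde P.K F ν z₂ ≤ 1 ∧
      localNorm F z₂.x (deltaP P.K F ν z₂) ≤ q / 400 ∧ muE ν z₂ = muE ν z from
    ⟨⟨this.1, this.2.1, this.2.2.1, this.2.2.2.1⟩, this.2.2.2.2, hG⟩
  generalize localNorm F z.x (deltaP P.K F ν z) = a at *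
  generalize muE ν z = E at *
  generalize mu ν z = M at *
  generalize scaling P.K F ν z = W at *
  generalize ⟪deltaP P.K F ν z, deltaD F ν z⟫_ℝ = PD at *
  generalize ⟪deltaP P.K F ν z₂, deltaD F ν z₂⟫_ℝ = PD₂ at *
  generalize deltaP P.K F ν z = p at *
  generalize muE ν z₂ = E₂ at *
  generalize mu ν z₂ = M₂ at *
  generalize muTilde P.K F ν z₂ = t at *
  have hdκ : d.κ = -(z.κ / z.τ * d.τ) := by
    field_simp
    linarith
  -- The linearised `τκ` equation has zero right-hand side, so `Δτ Δκ = -w ≤ 0` and, by skewness,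
  -- `⟨Δx, Δs⟩ = w`. Thus `νμ` gains exactly what `τκ` loses, and `w` occurs twice in the energy.
  obtain ⟨w, hw⟩ : ∃ w, w = z.κ / z.τ * d.τ ^ 2 := ⟨_, rfl⟩
  have hw0 : 0 ≤ w := by rw [hw]; positivity
  have hτκ : d.τ * d.κ = -w := by rw [hdκ, hw]; ring
  have hw' : z.τ / z.κ * d.κ ^ 2 = w := by rw [hdκ, hw]; field_simp
  rw [← hw, hw', zero_pow two_ne_zero, zero_div, add_zero] at henergy
  have n₁ : 0 ≤ qnorm W d.x ^ 2 := sq_nonneg _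
  have n₂ : 0 ≤ qnorm W (-p - d.x) ^ 2 := sq_nonneg _
  have hc : (0 : ℝ) ≤ 51 / 50 * a := by positivity
  have hc2 : 41 / 40 * (a ^ 2 * M) ≤ (51 / 50 * a) ^ 2 * M := by
    have : 0 ≤ a ^ 2 * M := by positivity
    linarith only [this]
  obtain ⟨hdx, -⟩ := hbounds (u := d.x) hc (by linarith only [henergy, hPD, n₂, hw0, hc2])
  obtain ⟨-, hdg⟩ := hbounds
    (u := -p - d.x) hc (by linarith only [henergy, hPD, n₁, hw0, hc2])
  have hds : d.s = W (-p - d.x) := by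
    rw [map_sub, hWP, ← hxsd]; abel
  rw [← hds] at hdg
  have hh : localNorm F z.x d.x ≤ 11 / 10 * a := by linarith only [hdx, ha0]
  have hk : ∀ v, |⟪v, d.s⟫_ℝ| ≤ 11 / 10 * a * (M * localNorm F z.x v) := by
    intro v
    refine (hdg v).trans ?_
    have hV : 0 ≤ M * localNorm F z.x v := mul_nonneg hμ.le (localNorm_nonneg _ _ _)
    exact mul_le_mul_of_nonneg_right (by linarith only [ha0]) hV
  have hdxs : ⟪d.x, d.s⟫_ℝ = w := by linarith only [hskew, hτκ]
  rw [hdxs, sub_self, zero_mul, zero_add] at hmu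
  have hq2 : q ^ 2 ≤ 1 := pow_le_one₀ hq.le hq1
  have ha2 : a ^ 2 * M ≤ (q / 200) ^ 2 * M := by gcongr
  have hq2M : 0 ≤ q ^ 2 * M := by positivity
  have hwM : w ≤ 1 / 50000 * q ^ 2 * M := by
    linarith only [henergy, hPD, ha2, hq2M, n₁, n₂, hw0]
  have hνpos : 0 < ν := zero_lt_one.trans_le hν
  have hM₂ : M ≤ M₂ := by
    refine le_of_mul_le_mul_left (a := ν) ?_ hνpos
    linarith only [hmu, hw0]
  have hM₂' : M₂ ≤ M + 1 / 50000 * q ^ 2 * M := by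
    refine le_of_mul_le_mul_left (a := ν) ?_ hνpos
    have : q ^ 2 * M ≤ ν * (q ^ 2 * M) := le_mul_of_one_le_left hq2M hν
    linarith only [hmu, hwM, this]
  have herr := corrector_error_bound hq1 ha0 ha hμ hM₂ hM₂'
  have hM₂pos : 0 < M₂ := hμ.trans_le hM₂
  obtain ⟨hx₂, hs₂, hP₂⟩ := hstepmem (by positivity) (by linarith only [ha, hq1]) hh hk hM₂pos
    (by positivity) (by linarith only [hq1])
    (by rw [sub_self, abs_zero, zero_mul, zero_add]; exact herr)
  have hτκ₂ : z₂.τ * z₂.κ = z.τ * z.κ - w := by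
    rw [hz₂τ, hz₂κ]
    linear_combination hτκd + hτκ
  have hE₂ : E₂ = E := by
    rw [hmu, hτκ₂] at hmuE₂
    refine mul_left_cancel₀ (show ν + 1 ≠ 0 by positivity) ?_
    linear_combination hmuE₂ - hsum
  have hME : M ≤ 2 * E := by
    refine le_of_mul_le_mul_left (a := ν) ?_ hνpos
    have h₁ : 0 < z.τ * z.κ := by positivity
    have h₂ : E ≤ ν * E := le_mul_of_one_le_left hE.le hν
    linarith only [hsum, h₁, h₂]
  have hq2E : 0 ≤ q ^ 2 * E := by positivity
  have hwE : w ≤ 1 / 25000 * (q ^ 2 * E) := by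
    have h₁ : q ^ 2 * M ≤ q ^ 2 * (2 * E) := by gcongr
    linarith only [hwM, h₁]
  -- The predictor's slack `q²/1250` absorbs the loss `w ≤ q²E/25000`.
  have hT₂ : 9 / 10 * E ≤ z₂.τ * z₂.κ := by linarith only [hτκ₂, hT, hwE, hq2E]
  have hτ₂ : 0 < z₂.τ := by
    have h₁ : q ^ 2 * E ≤ E := mul_le_of_le_one_left hE.le hq2
    have h₂ : w ≤ 1 / 4 * (z.τ * z.κ) := by linarith only [hwE, h₁, hT, hq2E, hE]
    have h₃ : d.τ ^ 2 ≤ (1 / 2 * z.τ) ^ 2 := by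
      rw [hw, div_mul_eq_mul_div, div_le_iff₀ hτ] at h₂
      refine le_of_mul_le_mul_left (a := z.κ) ?_ hκ
      linarith only [h₂]
    have h₄ := (abs_le.1 (abs_le_of_sq_le_sq h₃ (by positivity))).1
    rw [hz₂τ]
    linarith only [h₄, hτ]
  have hκ₂ : 0 < z₂.κ := by
    have : 0 < z₂.τ * z₂.κ := by linarith only [hT₂, hE]
    exact pos_of_mul_pos_right this hτ₂.le
  have hA4 : 9 / 10 * E₂ * t ≤ 1 := by
    have h₁ := hPD₂ hx₂ hs₂ (by linarith only [hP₂, hq1])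
    rw [hid₂ hx₂ hs₂] at h₁
    rw [hE₂]
    have ha₂0 : 0 ≤ localNorm F z₂.x (deltaP P.K F ν z₂) := localNorm_nonneg _ _ _
    have ha₂2 : localNorm F z₂.x (deltaP P.K F ν z₂) ^ 2 ≤ (q / 1000) ^ 2 := by
      gcongr
      linarith only [hP₂, hq]
    exact muE_mul_muTilde_le hν hE hM₂pos (hM.trans hM₂) h₁ ha₂2
  exact ⟨⟨hx₂, hs₂, hτ₂, hκ₂⟩, by rw [hE₂]; exact hT₂, hA4, by linarith only [hP₂, hq], hE₂⟩

end Iteration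

/-! ### Starting points, runs and the iteration count -/

theorem IsStart.inNeighborhood {m n : ℕ} {K : ProperCone ℝ (Vec n)} {F : Vec n → ℝ} {ν β η : ℝ}
    (hF : IsLHSCB K F ν) (hK : IsProper K) (hν : 1 ≤ ν) (hβ : β ≤ 1) (hη : 0 ≤ η)
    {z : Point m n} (hz : IsStart K F z) :
    InNeighborhood K F ν β η z ∧ muE ν z = 1 := by
  have hν0 : ν ≠ 0 := by linarith
  have hx := hz.x_mem
  have hg : gradient F z.x = -z.s := by rw [hz.s_eq]; exact (neg_eq_iff_eq_neg.2 hz.x_eq).symm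
  have hs : sTilde F z.x = z.s := by rw [sTilde, hg, neg_neg]
  -- The starting point coincides with its shadow, so it lies on the central path with `μ = μ̃ = 1`
  -- and `δᴾ = 0`.
  have ht : xTilde K F z.s = z.x := hF.xTilde_eq hK hx hg
  have hxs : ⟪z.x, z.s⟫_ℝ = ν := by rw [← hs, hF.inner_sTilde_self hx]
  have hmu : mu ν z = 1 := by rw [mu, hxs, div_self hν0]
  have hmuT : muTilde K F ν z = 1 := by rw [muTilde, ht, hs, hxs, div_self hν0]
  have hE : muE ν z = 1 := by
    rw [muE, hxs, hz.τ_eq, hz.κ_eq, mul_one, div_self (by linarith)]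
  have hP : localNorm F z.x (deltaP K F ν z) = 0 := by
    rw [deltaP, ht, hmu, one_smul, sub_self, localNorm, inner_zero_left, Real.sqrt_zero]
  have hsK : z.s ∈ interior (dualCone K : Set (Vec n)) :=
    hF.mem_interior_dualCone hK (by linarith) hx (θ := 0) (by norm_num) fun v => by
      rw [hg, add_neg_cancel, inner_zero_right, abs_zero, zero_mul]
  refine ⟨⟨⟨hx, hsK, ?_, ?_⟩, ?_, ?_, hP.le.trans hη⟩, hE⟩
  · rw [hz.τ_eq]; exact one_pos
  · rw [hz.κ_eq]; exact one_pos
  · rw [hE, hz.τ_eq, hz.κ_eq]; linarith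
  · rw [hE, hmuT]; linarith

theorem iteration_spec {m n : ℕ} {P : ConicProgram m n} {F : Vec n → ℝ} {ν q : ℝ}
    (hF : IsLHSCB P.K F ν) (hK : IsProper P.K) (hν : 1 ≤ ν) (hq : 0 < q) (hq1 : q ≤ 1)
    (hqν : q * Real.sqrt ν = 1) {z : Point m n}
    (hz : InNeighborhood P.K F ν (9 / 10) (q / 400) z) :
    (∃ z₁, IsPredictorStep P F ν (q ^ 2 / 100) (9 / 10) z z₁) ∧
    ∀ z₁, IsPredictorStep P F ν (q ^ 2 / 100) (9 / 10) z z₁ →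
      IsInterior P.K z₁ ∧
      (∃ z₂, IsCorrectorStep P F ν z₁ z₂) ∧
      ∀ z₂, IsCorrectorStep P F ν z₁ z₂ →
        InNeighborhood P.K F ν (9 / 10) (q / 400) z₂ ∧
        muE ν z₂ = (1 - q ^ 2 / 1000) * muE ν z ∧
        P.G z₂ = (1 - q ^ 2 / 1000) • P.G z := by
  refine ⟨exists_predictorStep hF hK hν hz.interior (hz.deltaP_le.trans (by linarith)),
    fun z₁ h₁ => ?_⟩
  obtain ⟨hp, hE, hG⟩ := predictorStep_spec hF hK hν hq hqν hz h₁
  refine ⟨hp.interior,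
    exists_correctorStep hF hK hν hp.interior (hp.deltaP_le.trans (by linarith)), fun z₂ h₂ => ?_⟩
  obtain ⟨hN, hE₂, hG₂⟩ := correctorStep_spec hF hK hν hq hq1 hp h₂
  exact ⟨hN, hE₂.trans hE, hG₂.trans hG⟩

theorem exists_run {m n : ℕ} {P : ConicProgram m n} {F : Vec n → ℝ} {ν α γ : ℝ}
    {N : Point m n → Prop}
    (hN : ∀ z, N z → ∃ z₁ z₂, IsPredictorStep P F ν α γ z z₁ ∧ IsCorrectorStep P F ν z₁ z₂ ∧ N z₂)
    {z₀ : Point m n} (h₀ : N z₀) : ∃ z zp, IsRun P F ν α γ z₀ z zp := by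
  choose p c hp hc hpc using fun z : {z // N z} => hN z.1 z.2
  let f : ℕ → {z // N z} := fun k => Nat.rec ⟨z₀, h₀⟩ (fun _ z => ⟨c z, hpc z⟩) k
  exact ⟨fun k => (f k).1, fun k => p (f k), rfl, fun k => hp (f k), fun k => hc (f k)⟩

theorem pow_natCeil_le {δ ε : ℝ} (hδ : 0 < δ) (hδ1 : δ ≤ 1) (hε : 0 < ε) :
    (1 - δ) ^ ⌈δ⁻¹ * Real.log (1 / ε)⌉₊ ≤ ε := by
  set k := ⌈δ⁻¹ * Real.log (1 / ε)⌉₊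
  have hk : δ⁻¹ * Real.log (1 / ε) ≤ k := Nat.le_ceil _
  rw [inv_mul_le_iff₀ hδ, one_div, Real.log_inv] at hk
  calc (1 - δ) ^ k ≤ Real.exp (-δ) ^ k := by
        gcongr
        exact Real.one_sub_le_exp_neg δ
    _ = Real.exp (k * -δ) := (Real.exp_nat_mul _ _).symm
    _ ≤ Real.exp (Real.log ε) := by
        gcongr
        linarith
    _ = ε := Real.exp_log hε

end ConicIPM

end

/-! ### The main theorem -/

theorem mainTheorem1 :
    ∃ C : ℝ, 0 < C ∧
      ∀ (m n : ℕ) (P : ConicIPM.ConicProgram m n) (F : ConicIPM.Vec n → ℝ) (ν : ℝ),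
        0 < n → ConicIPM.IsProper P.K → ConicIPM.IsLHSCB P.K F ν →
        ∀ α β γ η : ℝ,
          α = 1 / (100 * ν) → β = 0.9 → γ = 0.9 → η = 1 / (400 * Real.sqrt ν) →
          -- one iteration from any point satisfying the assumptions
          (∀ z : ConicIPM.Point m n, ConicIPM.InNeighborhood P.K F ν β η z →
            (∃ z₁, ConicIPM.IsPredictorStep P F ν α γ z z₁) ∧
            ∀ z₁, ConicIPM.IsPredictorStep P F ν α γ z z₁ →
              ConicIPM.IsInterior P.K z₁ ∧
              (∃ z₂, ConicIPM.IsCorrectorStep P F ν z₁ z₂) ∧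
              ∀ z₂, ConicIPM.IsCorrectorStep P F ν z₁ z₂ →
                ConicIPM.InNeighborhood P.K F ν β η z₂ ∧
                ConicIPM.muE ν z₂ = (1 - α * (1 - γ)) * ConicIPM.muE ν z ∧
                P.G z₂ = (1 - α * (1 - γ)) • P.G z) ∧
          -- the whole algorithm
          (∀ z₀ : ConicIPM.Point m n, ConicIPM.IsStart P.K F z₀ →
            (∃ z zp : ℕ → ConicIPM.Point m n, ConicIPM.IsRun P F ν α γ z₀ z zp) ∧
            ∀ z zp : ℕ → ConicIPM.Point m n, ConicIPM.IsRun P F ν α γ z₀ z zp →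
              (∀ k : ℕ, ConicIPM.InNeighborhood P.K F ν β η (z k) ∧
                ConicIPM.muE ν (z k) = (1 - α * (1 - γ)) ^ k ∧
                P.G (z k) = (1 - α * (1 - γ)) ^ k • P.G z₀) ∧
              ∀ ε : ℝ, 0 < ε → ε < 1 →
                ∃ k : ℕ, k ≤ ⌈C * (ν * Real.log (1 / ε))⌉₊ ∧
                  ConicIPM.muE ν (z k) ≤ ε ∧ ‖P.G (z k)‖ ≤ ε * ‖P.G z₀‖) := by
  -- The contraction factor per iteration is `1 - δ` with `δ = α(1 - γ) = 1/(1000ν)`, and `δ⁻¹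
  -- log(1/ε)` iterations suffice.
  refine ⟨1000, by norm_num, fun m n P F ν hn hK hF α β γ η hα hβ hγ hη => ?_⟩
  have hν := hF.one_le_parameter hn hK
  have hsq : 1 ≤ Real.sqrt ν := Real.one_le_sqrt.2 hν
  have hsq0 : 0 < Real.sqrt ν := one_pos.trans_le hsq
  obtain ⟨q, hq⟩ : ∃ q, q = (Real.sqrt ν)⁻¹ := ⟨_, rfl⟩
  have hq0 : 0 < q := by rw [hq]; positivity
  have hq1 : q ≤ 1 := by rw [hq]; exact inv_le_one_of_one_le₀ hsq
  have hqν : q * Real.sqrt ν = 1 := by rw [hq]; exact inv_mul_cancel₀ hsq0.ne'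
  have hq2 : q ^ 2 = ν⁻¹ := by rw [hq, inv_pow, Real.sq_sqrt (by linarith)]
  obtain rfl : α = q ^ 2 / 100 := by rw [hα, hq2]; field_simp
  obtain rfl : η = q / 400 := by rw [hη, hq]; field_simp
  obtain rfl : β = 9 / 10 := by rw [hβ]; norm_num
  obtain rfl : γ = 9 / 10 := by rw [hγ]; norm_num
  have hrate : 1 - q ^ 2 / 100 * (1 - 9 / 10) = 1 - q ^ 2 / 1000 := by ring
  rw [hrate]
  have hiter := fun z hz => ConicIPM.iteration_spec (P := P) (z := z) hF hK hν hq0 hq1 hqν hz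
  refine ⟨hiter, fun z₀ hz₀ => ?_⟩
  obtain ⟨hN₀, hE₀⟩ := hz₀.inNeighborhood hF hK hν (β := 9 / 10) (η := q / 400)
    (by norm_num) (by positivity)
  refine ⟨ConicIPM.exists_run (N := ConicIPM.InNeighborhood P.K F ν (9 / 10) (q / 400))
    (fun z hz => ?_) hN₀, fun z zp hrun => ?_⟩
  · obtain ⟨⟨z₁, h₁⟩, h⟩ := hiter z hz
    obtain ⟨-, ⟨z₂, h₂⟩, h'⟩ := h z₁ h₁
    exact ⟨z₁, z₂, h₁, h₂, (h' z₂ h₂).1⟩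
  have hall : ∀ k : ℕ, ConicIPM.InNeighborhood P.K F ν (9 / 10) (q / 400) (z k) ∧
      ConicIPM.muE ν (z k) = (1 - q ^ 2 / 1000) ^ k ∧
      P.G (z k) = (1 - q ^ 2 / 1000) ^ k • P.G z₀ := by
    intro k
    induction k with
    | zero =>
      rw [hrun.start, pow_zero, one_smul]
      exact ⟨hN₀, hE₀, rfl⟩
    | succ k ih =>
      obtain ⟨hN, hE, hG⟩ := ih
      obtain ⟨-, -, h⟩ := (hiter _ hN).2 _ (hrun.predictor k)
      obtain ⟨hN', hE', hG'⟩ := h _ (hrun.corrector k)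
      refine ⟨hN', ?_, ?_⟩
      · rw [hE', hE, pow_succ' _ k]
      · rw [hG', hG, smul_smul, pow_succ' _ k]
  refine ⟨hall, fun ε hε _ => ⟨_, le_rfl, ?_⟩⟩
  have hq21 : q ^ 2 ≤ 1 := pow_le_one₀ hq0.le hq1
  have hpow : (1 - q ^ 2 / 1000) ^ ⌈1000 * (ν * Real.log (1 / ε))⌉₊ ≤ ε := by
    have h := ConicIPM.pow_natCeil_le (δ := q ^ 2 / 1000) (by positivity) (by linarith) hε
    rwa [inv_div, hq2, div_inv_eq_mul, mul_assoc, ← hq2] at h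
  obtain ⟨-, hE, hG⟩ := hall ⌈1000 * (ν * Real.log (1 / ε))⌉₊
  refine ⟨hE.trans_le hpow, ?_⟩
  rw [hG, norm_smul, Real.norm_of_nonneg (pow_nonneg (by linarith) _)]
  exact mul_le_mul_of_nonneg_right hpow (norm_nonneg _)
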